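/- Let $k$ be a field of characteristic zero, let $\mathcal A_1,\mathcal A_2$ be associative, not necessarily unital $k$-algebras, and let $\varphi_i:\mathcal A_i\to k$ be linear forms. Let $\mathcal A=\mathcal A_1\star\mathcal A_2$ be the non-unital free product. It is spanned by the products $x_1\cdots x_n$ ($n\ge 1$) of alternating words, i.e. each $x_i$ lies in $\mathcal A_1$ or $\mathcal A_2$ and consecutive letters come from different algebras. Let $T(V)=\bigoplus_{n>0}V^{\otimes n}$ and $\overline T(V)=k\oplus T(V)$. Write $w_1|\cdots|w_m$ for the elements of $H=\overline T(T(\mathcal A))$, with $w_i\in T(\mathcal A)$. For a word $a_1\cdots a_n\in T(\mathcal A)$ and $S\subseteq[n]$ let $a_S$ be the subword indexed by $S$, and let $J_1,\dots,J_r$ be the maximal intervals of $[n]\setminus S$, in increasing order. The coproduct of $H$ is the algebra map $\Delta:H\to H\otimes H$ with $\Delta(a_1\cdots a_n)=\sum_{S\subseteq[n]}a_S\otimes a_{J_1}|\cdots|a_{J_r}$ on words. Let $\Delta^+_\prec$ (resp. $\Delta^+_\succ$) be given on words by the part of this sum with $1\in S$ (resp. $1\notin S$), and on the augmentation ideal of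 $H$ by $\Delta^+_{\prec}(w_1|\cdots|w_m)=\Delta^+_{\prec}(w_1)\Delta(w_2)\cdots\Delta(w_m)$ (resp. with $\succ$). For linear forms $f,g$ on $H$ put $f*g=(f\otimes g)\circ\Delta$, and let $f\prec g$ (resp. $f\succ g$) be $(f\otimes g)\circ\Delta^+_\prec$ (resp. $(f\otimes g)\circ\Delta^+_\succ$) on the augmentation ideal and $0$ at $\mathbf 1$. Let $e$ be the augmentation of $H$. A character is a unital algebra map $H\to k$; an infinitesimal character is a linear form that vanishes at $\mathbf 1$ and on products of two elements of the augmentation ideal. For an infinitesimal character $\gamma$ put $$\mathcal E_\prec(\gamma)=e+\sum_{n>0}\gamma^{\prec n},\quad \gamma^{\prec 0}=e,\ \gamma^{\prec n}=\gamma\prec\gamma^{\prec (n-1)},\qquad \mathcal E_\succ(\gamma)=e+\sum_{n>0}\gamma^{\succ n},\quad \gamma^{\succ 0}=e,\ \gamma^{\succ n}=\gamma^{\succ (n-1)}\succ\gamma$$ (the sums are finite on each element of $H$). The left and right additive convolutions of characters are defined by $\mathcal E_\prec(\gamma_1)\,\square_\prec\,\mathcal E_\prec(\gamma_2)=\mathcal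 E_\prec(\gamma_1+\gamma_2)$ and $\mathcal E_\succ(\gamma_1)\,\square_\succ\,\mathcal E_\succ(\gamma_2)=\mathcal E_\succ(\gamma_1+\gamma_2)$ for infinitesimal characters $\gamma_1,\gamma_2$. Extend $\varphi_1$ (resp. $\varphi_2$) to $\mathcal A$ by zero on alternating words that contain a letter from $\mathcal A_2$ (resp. $\mathcal A_1$), and let $\Phi_i$ be the character of $H$ with $\Phi_i(a_1\cdots a_n)=\varphi_i(a_1\cdot_{\mathcal A}\cdots\cdot_{\mathcal A}a_n)$ on words. Embed $\mathcal A$ linearly into $T(\mathcal A)\subset H$ by sending the product of an alternating word $x_1\cdots x_n$ to the word $x_1\otimes\cdots\otimes x_n$. **Theorem.** The following four linear forms $\psi$ on $\mathcal A$ exist, are unique, and are the restrictions to $\mathcal A$ of the indicated characters of $H$; in particular $\Phi_1\square_\prec\Phi_2$ and $\Phi_1\square_\succ\Phi_2$ are well defined and are characters. 1. The restriction of $\Phi_1*\Phi_2$ is the monotone product of $\varphi_1$ and $\varphi_2$: for each alternating word, $\psi(x_1\cdots x_n)=\varphi_1\big(\prod_{x_i\in\mathcal A_1}x_i\big)\prod_{x_j\in\mathcal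 A_2}\varphi_2(x_j)$. 2. The restriction of $\Phi_2*\Phi_1$ is the antimonotone product: for each alternating word, $\psi(x_1\cdots x_n)=\varphi_2\big(\prod_{x_j\in\mathcal A_2}x_j\big)\prod_{x_i\in\mathcal A_1}\varphi_1(x_i)$. 3. The restriction of $\Phi_1\,\square_\prec\,\Phi_2$ is the free product: for each alternating word, $$\psi(x_1\cdots x_n)=\sum_{S\subsetneq[n]}(-1)^{n-|S|+1}\,\psi\Big(\prod_{i\in S}x_i\Big)\prod_{i\notin S,\ x_i\in\mathcal A_1}\varphi_1(x_i)\prod_{j\notin S,\ x_j\in\mathcal A_2}\varphi_2(x_j).$$ 4. The restriction of $\Phi_1\,\square_\succ\,\Phi_2$ is the boolean product: for each alternating word, $\psi(x_1\cdots x_n)=\prod_{x_i\in\mathcal A_1}\varphi_1(x_i)\prod_{x_j\in\mathcal A_2}\varphi_2(x_j)$. Here products of letters are taken in increasing order of their indices, in $\mathcal A_1$, $\mathcal A_2$ or $\mathcal A$, and $\varphi_i$ and $\psi$ of an empty product are $1$. -/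

import Mathlib

noncomputable section

namespace UniversalProducts

open scoped TensorProduct

/-! ### Tensor algebras and the double tensor algebra -/

section Tensor

variable (k : Type*) [Field k] (V : Type*) [AddCommGroup V] [Module k V]

/-- The non-unital tensor algebra `T(V) = ⨁_{n > 0} V^{⊗ n}`, realised as the augmentation ideal
of the unital tensor algebra `T̄(V) = TensorAlgebra k V`. -/
def PosTensor : Submodule k (TensorAlgebra k V) :=
  LinearMap.ker (TensorAlgebra.algebraMapInv (R := k) (M := V)).toLinearMap

/-- The unital double tensor algebra `T̄(T(V))`. The product `a * b` of two of its elements is the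
bar product `a | b`. -/
abbrev DoubleTensor : Type _ := TensorAlgebra k (PosTensor k V)

variable {k V}

/-- The component of an element of `T̄(V)` in `T(V)`. -/
def toPosTensor : TensorAlgebra k V →ₗ[k] PosTensor k V :=
  LinearMap.codRestrict _
    (LinearMap.id - Algebra.linearMap k (TensorAlgebra k V) ∘ₗ
      (TensorAlgebra.algebraMapInv (R := k) (M := V)).toLinearMap)
    (fun t => by
      simp [PosTensor, TensorAlgebra.algebraMap_leftInverse V (TensorAlgebra.algebraMapInv t)])

/-- The canonical linear map from `T̄(V) = k ⊕ T(V)` to `T̄(T(V))`: it maps the empty word to `1`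
and a non-empty word `w` to the one-letter word `w` of the double tensor algebra. -/
def bar : TensorAlgebra k V →ₗ[k] DoubleTensor k V :=
  Algebra.linearMap k (DoubleTensor k V) ∘ₗ
      (TensorAlgebra.algebraMapInv (R := k) (M := V)).toLinearMap +
    TensorAlgebra.ι k ∘ₗ toPosTensor

variable (k) in
/-- The word `a_{i₁} a_{i₂} ⋯ a_{iₚ}` in `T̄(V)` associated with a list `i₁, …, iₚ` of indices. -/
def word {n : ℕ} (a : Fin n → V) (l : List (Fin n)) : TensorAlgebra k V :=
  (l.map fun i => TensorAlgebra.ι k (a i)).prod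

/-- The elements of `S ⊆ [n]` in increasing order. -/
def increasing {n : ℕ} (S : Finset (Fin n)) : List (Fin n) :=
  (List.finRange n).filter fun i => decide (i ∈ S)

/-- The connected components `J₁, …, Jₖ` of `[n] - S`, from left to right: the list `0, …, n - 1`
is cut at the elements of `S`. Empty lists occur too; they contribute the empty word, which `bar`
identifies with the unit of the double tensor algebra. -/
def components {n : ℕ} (S : Finset (Fin n)) : List (List (Fin n)) :=
  (List.finRange n).splitOnP fun i => decide (i ∈ S)

variable (k) in
/-- The element `a_{J₁} | ⋯ | a_{Jₖ}` of `T̄(T(V))` for a list `J₁, …, Jₖ` of lists of indices. -/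
def barWord {n : ℕ} (a : Fin n → V) (L : List (List (Fin n))) : DoubleTensor k V :=
  (L.map fun J => bar (word k a J)).prod

theorem word_update_of_notMem {n : ℕ} (a : Fin n → V) {l : List (Fin n)} {i : Fin n} (h : i ∉ l)
    (x : V) : word k (Function.update a i x) l = word k a l := by
  unfold word
  congr 1
  refine List.map_congr_left fun j hj => ?_
  rw [Function.update_of_ne]
  rintro rfl
  exact h hj

theorem word_update_of_mem {n : ℕ} (a : Fin n → V) {l : List (Fin n)} {i : Fin n} (h : i ∈ l)
    (hl : l.Nodup) :
    ∃ P Q, ∀ x, word k (Function.update a i x) l = P * TensorAlgebra.ι k x * Q := by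
  obtain ⟨s, t, rfl⟩ := List.append_of_mem h
  rw [List.nodup_middle, List.nodup_cons, List.mem_append, not_or] at hl
  refine ⟨word k a s, word k a t, fun x => ?_⟩
  rw [← word_update_of_notMem a hl.1.1 x, ← word_update_of_notMem a hl.1.2 x]
  simp [word, mul_assoc]

theorem barWord_update_of_notMem {n : ℕ} (a : Fin n → V) {L : List (List (Fin n))} {i : Fin n}
    (h : i ∉ L.flatten) (x : V) : barWord k (Function.update a i x) L = barWord k a L := by
  unfold barWord
  congr 1
  refine List.map_congr_left fun J hJ => ?_
  rw [word_update_of_notMem]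
  exact fun hi => h (List.mem_flatten.2 ⟨J, hJ, hi⟩)

theorem barWord_update_of_mem {n : ℕ} (a : Fin n → V) {L : List (List (Fin n))} {i : Fin n}
    (h : i ∈ L.flatten) (hL : L.flatten.Nodup) :
    ∃ P Q P' Q', ∀ x, barWord k (Function.update a i x) L =
      P * bar (P' * TensorAlgebra.ι k x * Q') * Q := by
  obtain ⟨J, hJ, hi⟩ := List.mem_flatten.1 h
  obtain ⟨s, t, rfl⟩ := List.append_of_mem hJ
  simp only [List.flatten_append, List.flatten_cons, List.nodup_append, List.mem_append] at hL
  obtain ⟨P', Q', hP⟩ := word_update_of_mem (k := k) a hi hL.2.1.1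
  refine ⟨barWord k a s, barWord k a t, P', Q', fun x => ?_⟩
  have hs : i ∉ s.flatten := fun h1 => hL.2.2 i h1 i (Or.inl hi) rfl
  have ht : i ∉ t.flatten := fun h1 => hL.2.1.2.2 i hi i h1 rfl
  rw [← hP, ← barWord_update_of_notMem a hs x, ← barWord_update_of_notMem a ht x]
  simp [barWord, mul_assoc]

theorem flatten_splitOnP {α : Type*} (p : α → Bool) (l : List α) :
    (l.splitOnP p).flatten = l.filter fun x => !p x := by
  induction l with
  | nil => simp
  | cons x l ih =>
    rw [List.splitOnP_cons_eq_if_modifyHead]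
    by_cases hx : p x
    · simp [hx, ih]
    · obtain ⟨y, L, hL⟩ := List.exists_cons_of_ne_nil (List.splitOnP_ne_nil p l)
      rw [hL] at ih
      simp [hx, hL, ← ih]

theorem flatten_components {n : ℕ} (S : Finset (Fin n)) :
    (components S).flatten = increasing Sᶜ := by
  simp [components, increasing, flatten_splitOnP]

/-- The multilinear map `(a₁, …, aₙ) ↦ a_S ⊗ a_{J₁} | ⋯ | a_{Jₖ}`, where `J₁, …, Jₖ` are the
connected components of `[n] - S`. -/
def splitTerm {n : ℕ} (S : Finset (Fin n)) :
    MultilinearMap k (fun _ : Fin n => V) (DoubleTensor k V ⊗[k] DoubleTensor k V) where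
  toFun a := bar (word k a (increasing S)) ⊗ₜ[k] barWord k a (components S)
  map_update_add' {inst} a i x y := by
    cases Subsingleton.elim inst (instDecidableEqFin n)
    by_cases hi : i ∈ S
    · have h1 : i ∈ increasing S := by simp [increasing, hi]
      have h2 : i ∉ (components S).flatten := by simp [flatten_components, increasing, hi]
      obtain ⟨P, Q, h⟩ := word_update_of_mem (k := k) a h1 ((List.nodup_finRange n).filter _)
      simp only [h, barWord_update_of_notMem a h2, map_add, mul_add, add_mul, TensorProduct.add_tmul]
    · have h1 : i ∉ increasing S := by simp [increasing, hi]
      have h2 : i ∈ (components S).flatten := by simp [flatten_components, increasing, hi]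
      obtain ⟨P, Q, P', Q', h⟩ := barWord_update_of_mem (k := k) a h2
        (by rw [flatten_components]; exact (List.nodup_finRange n).filter _)
      simp only [h, word_update_of_notMem a h1, map_add, mul_add, add_mul, TensorProduct.tmul_add]
  map_update_smul' {inst} a i c x := by
    cases Subsingleton.elim inst (instDecidableEqFin n)
    by_cases hi : i ∈ S
    · have h1 : i ∈ increasing S := by simp [increasing, hi]
      have h2 : i ∉ (components S).flatten := by simp [flatten_components, increasing, hi]
      obtain ⟨P, Q, h⟩ := word_update_of_mem (k := k) a h1 ((List.nodup_finRange n).filter _)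
      simp only [h, barWord_update_of_notMem a h2, map_smul, mul_smul_comm, smul_mul_assoc,
        TensorProduct.smul_tmul']
    · have h1 : i ∉ increasing S := by simp [increasing, hi]
      have h2 : i ∈ (components S).flatten := by simp [flatten_components, increasing, hi]
      obtain ⟨P, Q, P', Q', h⟩ := barWord_update_of_mem (k := k) a h2
        (by rw [flatten_components]; exact (List.nodup_finRange n).filter _)
      simp only [h, word_update_of_notMem a h1, map_smul, mul_smul_comm, smul_mul_assoc,
        TensorProduct.tmul_smul]

/-- The linear map on `T̄(V)` whose value on a word `a₁ ⋯ aₙ` is `f n (a₁, …, aₙ)`. -/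
def ofMultilinear {M : Type*} [AddCommGroup M] [Module k M]
    (f : ∀ n : ℕ, MultilinearMap k (fun _ : Fin n => V) M) : TensorAlgebra k V →ₗ[k] M :=
  DirectSum.toModule k ℕ M (fun n => PiTensorProduct.lift (f n)) ∘ₗ
    (TensorAlgebra.toDirectSum (R := k) (M := V)).toLinearMap

theorem ofMultilinear_tprod {M : Type*} [AddCommGroup M] [Module k M]
    (f : ∀ n : ℕ, MultilinearMap k (fun _ : Fin n => V) M) {n : ℕ} (a : Fin n → V) :
    ofMultilinear f (TensorAlgebra.tprod k V n a) = f n a := by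
  simp only [ofMultilinear, LinearMap.comp_apply, AlgHom.toLinearMap_apply]
  rw [TensorAlgebra.toDirectSum_tensorPower_tprod]
  exact (DirectSum.toModule_lof k n _).trans (PiTensorProduct.lift.tprod a)

/-! ### The coproduct and the half-coproducts -/

/-- `Δ(a₁ ⋯ aₙ) = ∑_{S ⊆ [n]} a_S ⊗ a_{J₁} | ⋯ | a_{Jₖ}` on words. -/
def coproductWord : TensorAlgebra k V →ₗ[k] DoubleTensor k V ⊗[k] DoubleTensor k V :=
  ofMultilinear fun _ => ∑ S, splitTerm S

/-- The same sum, restricted to the `S` that contain the first index. -/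
def leftCoproductWord : TensorAlgebra k V →ₗ[k] DoubleTensor k V ⊗[k] DoubleTensor k V :=
  ofMultilinear fun _ => ∑ S with ∃ i ∈ S, i.val = 0, splitTerm S

/-- The same sum, restricted to the `S` that do not contain the first index. -/
def rightCoproductWord : TensorAlgebra k V →ₗ[k] DoubleTensor k V ⊗[k] DoubleTensor k V :=
  ofMultilinear fun _ => ∑ S with ¬ ∃ i ∈ S, i.val = 0, splitTerm S

variable (k V)

/-- The coproduct on `T̄(T(V))`, the multiplicative extension of `coproductWord`. -/
def coproduct : DoubleTensor k V →ₐ[k] DoubleTensor k V ⊗[k] DoubleTensor k V :=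
  TensorAlgebra.lift k (coproductWord ∘ₗ (PosTensor k V).subtype)

/-- For a linear map `D` on words, the linear map
`w₁ | ⋯ | wₘ ↦ D(w₁) Δ(w₂) ⋯ Δ(wₘ)` for `m ≥ 1`, and `1 ↦ 0`. -/
def halfExtend (D : TensorAlgebra k V →ₗ[k] DoubleTensor k V ⊗[k] DoubleTensor k V) :
    DoubleTensor k V →ₗ[k] DoubleTensor k V ⊗[k] DoubleTensor k V :=
  ofMultilinear fun m =>
    if m = 0 then 0 else
      (MultilinearMap.mkPiAlgebraFin k m (DoubleTensor k V ⊗[k] DoubleTensor k V)).compLinearMap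
        fun i => (if i.val = 0 then D else coproductWord) ∘ₗ (PosTensor k V).subtype

/-- The left half-coproduct `Δ≺⁺`. -/
def leftCoproduct : DoubleTensor k V →ₗ[k] DoubleTensor k V ⊗[k] DoubleTensor k V :=
  halfExtend k V leftCoproductWord

/-- The right half-coproduct `Δ≻⁺`. -/
def rightCoproduct : DoubleTensor k V →ₗ[k] DoubleTensor k V ⊗[k] DoubleTensor k V :=
  halfExtend k V rightCoproductWord

variable {k V}

/-! ### Characters, shuffle products and half-shuffle exponentials -/

/-- The shuffle (convolution) product `Φ * Ψ = m ∘ (Φ ⊗ Ψ) ∘ Δ` of two characters of `T̄(T(V))`. -/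
def convolution (Φ Ψ : DoubleTensor k V →ₐ[k] k) : DoubleTensor k V →ₐ[k] k :=
  (Algebra.TensorProduct.lmul' (S := k) k).comp
    ((Algebra.TensorProduct.map Φ Ψ).comp (coproduct k V))

/-- The left half-shuffle product `f ≺ g`. Working with `Δ≺⁺(b) = Δ≺(b) + b ⊗ 1` builds in the
conventions `f ≺ e = f` and `e ≺ f = 0` for `f` vanishing at `1`. -/
def leftShuffle (f g : DoubleTensor k V →ₗ[k] k) : DoubleTensor k V →ₗ[k] k :=
  LinearMap.mul' k k ∘ₗ TensorProduct.map f g ∘ₗ leftCoproduct k V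

/-- The right half-shuffle product `f ≻ g`. Working with `Δ≻⁺(b) = Δ≻(b) + 1 ⊗ b` builds in the
conventions `e ≻ f = f` and `f ≻ e = 0` for `f` vanishing at `1`. -/
def rightShuffle (f g : DoubleTensor k V →ₗ[k] k) : DoubleTensor k V →ₗ[k] k :=
  LinearMap.mul' k k ∘ₗ TensorProduct.map f g ∘ₗ rightCoproduct k V

variable (k V) in
/-- The augmentation map `e` of `T̄(T(V))`. -/
def augmentation : DoubleTensor k V →ₗ[k] k :=
  (TensorAlgebra.algebraMapInv (R := k) (M := PosTensor k V)).toLinearMap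

/-- Infinitesimal characters: linear forms that vanish at `1` and on all products of two elements
of the augmentation ideal. -/
def IsInfinitesimal (α : DoubleTensor k V →ₗ[k] k) : Prop :=
  α 1 = 0 ∧ ∀ a b : DoubleTensor k V,
    augmentation k V a = 0 → augmentation k V b = 0 → α (a * b) = 0

/-- `α^{≺ 0} = e` and `α^{≺ (n+1)} = α ≺ α^{≺ n}`. -/
def leftPow (α : DoubleTensor k V →ₗ[k] k) : ℕ → (DoubleTensor k V →ₗ[k] k)
  | 0 => augmentation k V
  | n + 1 => leftShuffle α (leftPow α n)

/-- `α^{≻ 0} = e` and `α^{≻ (n+1)} = α^{≻ n} ≻ α`. -/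
def rightPow (α : DoubleTensor k V →ₗ[k] k) : ℕ → (DoubleTensor k V →ₗ[k] k)
  | 0 => augmentation k V
  | n + 1 => rightShuffle (rightPow α n) α

/-- The left half-shuffle exponential `ℰ≺(α) = e + ∑_{n > 0} α^{≺ n}`; if `α` vanishes at `1`, then
the sum is finite on every element. -/
def leftExp (α : DoubleTensor k V →ₗ[k] k) (h : DoubleTensor k V) : k :=
  ∑ᶠ n : ℕ, leftPow α n h

/-- The right half-shuffle exponential `ℰ≻(α) = e + ∑_{n > 0} α^{≻ n}`; if `α` vanishes at `1`, then
the sum is finite on every element. -/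
def rightExp (α : DoubleTensor k V →ₗ[k] k) (h : DoubleTensor k V) : k :=
  ∑ᶠ n : ℕ, rightPow α n h

/-- `Φ` is the left additive convolution of `Φ₁` and `Φ₂`, that is, `Φ = ℰ≺(γ₁ + γ₂)` where `γ₁`
and `γ₂` are infinitesimal characters with `Φ₁ = ℰ≺(γ₁)` and `Φ₂ = ℰ≺(γ₂)`. -/
def IsLeftAdditiveConvolution (Φ₁ Φ₂ Φ : DoubleTensor k V → k) : Prop :=
  ∃ γ₁ γ₂ : DoubleTensor k V →ₗ[k] k, IsInfinitesimal γ₁ ∧ IsInfinitesimal γ₂ ∧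
    Φ₁ = leftExp γ₁ ∧ Φ₂ = leftExp γ₂ ∧ Φ = leftExp (γ₁ + γ₂)

/-- `Φ` is the right additive convolution of `Φ₁` and `Φ₂`, that is, `Φ = ℰ≻(γ₁ + γ₂)` where `γ₁`
and `γ₂` are infinitesimal characters with `Φ₁ = ℰ≻(γ₁)` and `Φ₂ = ℰ≻(γ₂)`. -/
def IsRightAdditiveConvolution (Φ₁ Φ₂ Φ : DoubleTensor k V → k) : Prop :=
  ∃ γ₁ γ₂ : DoubleTensor k V →ₗ[k] k, IsInfinitesimal γ₁ ∧ IsInfinitesimal γ₂ ∧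
    Φ₁ = rightExp γ₁ ∧ Φ₂ = rightExp γ₂ ∧ Φ = rightExp (γ₁ + γ₂)

end Tensor

/-! ### The character of a linear form on a non-unital algebra -/

section Character

variable {k : Type*} [Field k] {A : Type*} [NonUnitalRing A] [Module k A] [IsScalarTower k A A]
  [SMulCommClass k A A]

/-- The linear map `T(A) → A`, `a₁ ⋯ aₙ ↦ a₁ ·_A ⋯ ·_A aₙ`. The product is computed in the
unitization of `A`. -/
def multiplication : PosTensor k A →ₗ[k] A :=
  Unitization.sndHom k k A ∘ₗ
    (TensorAlgebra.lift k (Unitization.inrHom k k A)).toLinearMap ∘ₗ (PosTensor k A).subtype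

/-- The extension of a linear form `φ` on `A` to a character of `T̄(T(A))`:
`Φ(w₁ | ⋯ | wₘ) = φ(w₁) ⋯ φ(wₘ)` and `φ(a₁ ⋯ aₙ) = φ(a₁ ·_A ⋯ ·_A aₙ)`. -/
def character (φ : A →ₗ[k] k) : DoubleTensor k A →ₐ[k] k :=
  TensorAlgebra.lift k (φ ∘ₗ multiplication)

end Character

/-! ### The non-unital free product of two non-unital algebras -/

section FreeProduct

variable (k : Type*) [Field k]
  (A₁ : Type*) [NonUnitalRing A₁] [Module k A₁] [IsScalarTower k A₁ A₁] [SMulCommClass k A₁ A₁]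
  (A₂ : Type*) [NonUnitalRing A₂] [Module k A₂] [IsScalarTower k A₂ A₂] [SMulCommClass k A₂ A₂]

/-- The relations of the free product: the products of `A₁` and `A₂` are respected. -/
inductive FreeProductRel : TensorAlgebra k (A₁ × A₂) → TensorAlgebra k (A₁ × A₂) → Prop
  | left (a b : A₁) : FreeProductRel
      (TensorAlgebra.ι k (a, 0) * TensorAlgebra.ι k (b, 0)) (TensorAlgebra.ι k (a * b, 0))
  | right (a b : A₂) : FreeProductRel
      (TensorAlgebra.ι k (0, a) * TensorAlgebra.ι k (0, b)) (TensorAlgebra.ι k (0, a * b))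

/-- The unital algebra generated by the vector space `A₁ ⊕ A₂` subject to these relations: the
free product with a unit adjoined. -/
def UnitalFreeProduct : Type _ := RingQuot (FreeProductRel k A₁ A₂)

instance : Ring (UnitalFreeProduct k A₁ A₂) :=
  inferInstanceAs (Ring (RingQuot (FreeProductRel k A₁ A₂)))

instance : Algebra k (UnitalFreeProduct k A₁ A₂) :=
  inferInstanceAs (Algebra k (RingQuot (FreeProductRel k A₁ A₂)))

/-- The quotient map from the tensor algebra. -/
def unitalMk : TensorAlgebra k (A₁ × A₂) →ₐ[k] UnitalFreeProduct k A₁ A₂ :=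
  RingQuot.mkAlgHom k (FreeProductRel k A₁ A₂)

/-- The linear map `A₁ ⊕ A₂ → k ⊕ A₁ ⋆ A₂`. -/
def unitalLetter : A₁ × A₂ →ₗ[k] UnitalFreeProduct k A₁ A₂ :=
  (unitalMk k A₁ A₂).toLinearMap ∘ₗ TensorAlgebra.ι k

/-- The non-unital subalgebra `A₁ ⋆ A₂` of `k ⊕ A₁ ⋆ A₂` generated by `A₁` and `A₂`. -/
def freeProductSubalgebra : NonUnitalSubalgebra k (UnitalFreeProduct k A₁ A₂) :=
  NonUnitalAlgebra.adjoin k (Set.range (unitalLetter k A₁ A₂))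

/-- The non-unital free product `A₁ ⋆ A₂`, i.e. the coproduct of `A₁` and `A₂` in the category of
non-unital associative algebras. -/
def FreeProduct : Type _ := freeProductSubalgebra k A₁ A₂

instance : NonUnitalRing (FreeProduct k A₁ A₂) :=
  inferInstanceAs (NonUnitalRing (freeProductSubalgebra k A₁ A₂))

instance : Module k (FreeProduct k A₁ A₂) :=
  inferInstanceAs (Module k (freeProductSubalgebra k A₁ A₂))

instance : IsScalarTower k (FreeProduct k A₁ A₂) (FreeProduct k A₁ A₂) :=
  inferInstanceAs (IsScalarTower k (freeProductSubalgebra k A₁ A₂) (freeProductSubalgebra k A₁ A₂))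

instance : SMulCommClass k (FreeProduct k A₁ A₂) (FreeProduct k A₁ A₂) :=
  inferInstanceAs (SMulCommClass k (freeProductSubalgebra k A₁ A₂) (freeProductSubalgebra k A₁ A₂))

/-- The inclusion `A₁ ⋆ A₂ → k ⊕ A₁ ⋆ A₂`. -/
def inclusion : FreeProduct k A₁ A₂ →ₙₐ[k] UnitalFreeProduct k A₁ A₂ :=
  NonUnitalSubalgebraClass.subtype (freeProductSubalgebra k A₁ A₂)

variable {A₁ A₂}

/-- The linear map `A₁ ⊕ A₂ → A₁ ⋆ A₂`. -/
def pairLetter : A₁ × A₂ →ₗ[k] FreeProduct k A₁ A₂ :=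
  LinearMap.codRestrict (freeProductSubalgebra k A₁ A₂).toSubmodule
    (unitalLetter k A₁ A₂) fun x => NonUnitalAlgebra.subset_adjoin k ⟨x, rfl⟩

theorem inclusion_pairLetter (u : A₁ × A₂) :
    inclusion k A₁ A₂ (pairLetter k u) = unitalMk k A₁ A₂ (TensorAlgebra.ι k u) := rfl

/-- A letter, i.e. an element of `A₁` or of `A₂`, as an element of `A₁ ⋆ A₂`. -/
def letter : A₁ ⊕ A₂ → FreeProduct k A₁ A₂ :=
  Sum.elim (fun a => pairLetter k (a, 0)) (fun b => pairLetter k (0, b))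

variable {k}

/-- The homomorphism on `k ⊕ A₁ ⋆ A₂` induced by a linear map on `A₁ ⊕ A₂` that respects the
relations. -/
def unitalLift {C : Type*} [Ring C] [Algebra k C] (f : A₁ × A₂ →ₗ[k] C)
    (hf : ∀ ⦃x y⦄, FreeProductRel k A₁ A₂ x y → TensorAlgebra.lift k f x = TensorAlgebra.lift k f y) :
    UnitalFreeProduct k A₁ A₂ →ₐ[k] C :=
  RingQuot.liftAlgHom k ⟨TensorAlgebra.lift k f, hf⟩

theorem unitalLift_mk {C : Type*} [Ring C] [Algebra k C] (f : A₁ × A₂ →ₗ[k] C)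
    (hf : ∀ ⦃x y⦄, FreeProductRel k A₁ A₂ x y → TensorAlgebra.lift k f x = TensorAlgebra.lift k f y)
    (u : A₁ × A₂) : unitalLift f hf (unitalMk k A₁ A₂ (TensorAlgebra.ι k u)) = f u := by
  refine (RingQuot.liftAlgHom_mkAlgHom_apply k (TensorAlgebra.lift k f) hf _).trans ?_
  simp

/-- The homomorphism on `k ⊕ A₁ ⋆ A₂` that is induced by homomorphisms on `A₁` and `A₂`. -/
def unitalFreeProductLift {C : Type*} [Ring C] [Algebra k C] (f : A₁ →ₙₐ[k] C) (g : A₂ →ₙₐ[k] C) :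
    UnitalFreeProduct k A₁ A₂ →ₐ[k] C :=
  unitalLift ((f : A₁ →ₗ[k] C).coprod (g : A₂ →ₗ[k] C)) fun x y h => by
    cases h <;> simp [map_mul]

variable (k A₁ A₂)

/-- The projection `A₁ ⋆ A₂ → A₁` that is the identity on `A₁` and zero on all words that contain a
letter from `A₂`. -/
def projLeft : FreeProduct k A₁ A₂ →ₗ[k] A₁ :=
  Unitization.sndHom k k A₁ ∘ₗ
    (unitalFreeProductLift (Unitization.inrNonUnitalAlgHom k A₁)
      (0 : A₂ →ₙₐ[k] Unitization k A₁)).toLinearMap ∘ₗ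
    (inclusion k A₁ A₂ : FreeProduct k A₁ A₂ →ₗ[k] UnitalFreeProduct k A₁ A₂)

/-- The projection `A₁ ⋆ A₂ → A₂` that is the identity on `A₂` and zero on all words that contain a
letter from `A₁`. -/
def projRight : FreeProduct k A₁ A₂ →ₗ[k] A₂ :=
  Unitization.sndHom k k A₂ ∘ₗ
    (unitalFreeProductLift (0 : A₁ →ₙₐ[k] Unitization k A₂)
      (Unitization.inrNonUnitalAlgHom k A₂)).toLinearMap ∘ₗ
    (inclusion k A₁ A₂ : FreeProduct k A₁ A₂ →ₗ[k] UnitalFreeProduct k A₁ A₂)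

variable {A₁ A₂}

/-- A list of letters is alternating if no two consecutive letters come from the same algebra. -/
def Alternating (l : List (A₁ ⊕ A₂)) : Prop :=
  l.IsChain fun x y => x.isLeft ≠ y.isLeft

/-! ### The embedding of the free product into the double tensor algebra

The product `x₁ ⋯ xₙ` of an alternating word is mapped to the word `x₁ ⊗ ⋯ ⊗ xₙ` of letters. To
this end `k ⊕ A₁ ⋆ A₂` acts on `T̄(A₁ ⊕ A₂)` from the left, by multiplying a letter into the first
letter of a word if both belong to the same algebra, and by concatenation otherwise. -/

/-- The auxiliary map `v ↦ ((t, x) ↦ (v t, v ⊗ t))`. -/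
def splitStep (V : Type*) [AddCommGroup V] [Module k V] :
    V →ₗ[k] Module.End k (TensorAlgebra k V × V ⊗[k] TensorAlgebra k V) :=
  LinearMap.mk₂ k (fun v p => (TensorAlgebra.ι k v * p.1, v ⊗ₜ[k] p.1))
    (fun v w p => by simp [add_mul, TensorProduct.add_tmul])
    (fun c v p => by simp [TensorProduct.smul_tmul'])
    (fun v p q => by simp [mul_add, TensorProduct.tmul_add])
    (fun c v p => by simp)

/-- The linear map `T̄(V) → V ⊗ T̄(V)` with `1 ↦ 0` and `v w ↦ v ⊗ w` for letters `v` and words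
`w`. -/
def splitFirst (V : Type*) [AddCommGroup V] [Module k V] :
    TensorAlgebra k V →ₗ[k] V ⊗[k] TensorAlgebra k V :=
  LinearMap.snd k _ _ ∘ₗ
    LinearMap.applyₗ ((1, 0) : TensorAlgebra k V × V ⊗[k] TensorAlgebra k V) ∘ₗ
    (TensorAlgebra.lift k (splitStep k V)).toLinearMap

section Split

variable {V : Type*} [AddCommGroup V] [Module k V]

theorem lift_splitStep_fst (t : TensorAlgebra k V)
    (p : TensorAlgebra k V × V ⊗[k] TensorAlgebra k V) :
    (TensorAlgebra.lift k (splitStep k V) t p).1 = t * p.1 := by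
  induction t using TensorAlgebra.induction generalizing p with
  | algebraMap r => simp [Algebra.smul_def, Module.algebraMap_end_apply]
  | ι v => rw [TensorAlgebra.lift_ι_apply]; rfl
  | mul a b ha hb => simp [ha, hb, mul_assoc]
  | add a b ha hb => simp [ha, hb, add_mul]

@[simp]
theorem splitFirst_one : splitFirst k V 1 = 0 := by
  simp [splitFirst]

@[simp]
theorem splitFirst_ι_mul (v : V) (t : TensorAlgebra k V) :
    splitFirst k V (TensorAlgebra.ι k v * t) = v ⊗ₜ[k] t := by
  have h := lift_splitStep_fst k t (1, 0)
  simp only [mul_one] at h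
  have h2 : splitFirst k V (TensorAlgebra.ι k v * t) =
      v ⊗ₜ[k] (TensorAlgebra.lift k (splitStep k V) t (1, 0)).1 := by
    simp only [splitFirst, LinearMap.comp_apply, AlgHom.toLinearMap_apply, map_mul,
      TensorAlgebra.lift_ι_apply]
    rfl
  rw [h2, h]

theorem tensor_ext {M : Type*} [AddCommGroup M] [Module k M] {f g : TensorAlgebra k V →ₗ[k] M}
    (h1 : f 1 = g 1) (h2 : ∀ v t, f (TensorAlgebra.ι k v * t) = g (TensorAlgebra.ι k v * t)) :
    f = g := by
  have key : ∀ t s : TensorAlgebra k V, f s = g s → f (t * s) = g (t * s) := by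
    intro t
    induction t using TensorAlgebra.induction with
    | algebraMap r => intro s hs; simp [← Algebra.smul_def, hs]
    | ι v => intro s _; exact h2 v s
    | mul a b ha hb => intro s hs; rw [mul_assoc]; exact ha _ (hb _ hs)
    | add a b ha hb => intro s hs; rw [add_mul, map_add, map_add, ha _ hs, hb _ hs]
  ext t
  simpa using key t 1 h1

end Split

/-- The product of the letters `u` and `v`: in `A₁` or in `A₂` if both come from the same algebra,
and the word `u v` otherwise. -/
def letterMul : A₁ × A₂ →ₗ[k] A₁ × A₂ →ₗ[k] TensorAlgebra k (A₁ × A₂) :=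
  LinearMap.mk₂ k
    (fun u v => TensorAlgebra.ι k (u.1 * v.1, u.2 * v.2) +
      TensorAlgebra.ι k (u.1, (0 : A₂)) * TensorAlgebra.ι k ((0 : A₁), v.2) +
      TensorAlgebra.ι k ((0 : A₁), u.2) * TensorAlgebra.ι k (v.1, (0 : A₂)))
    (fun u u' v => by
      have e1 : (((u + u').1, 0) : A₁ × A₂) = (u.1, 0) + (u'.1, 0) := by simp
      have e2 : ((0, (u + u').2) : A₁ × A₂) = (0, u.2) + (0, u'.2) := by simp
      have e3 : (((u + u').1 * v.1, (u + u').2 * v.2) : A₁ × A₂) =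
        (u.1 * v.1, u.2 * v.2) + (u'.1 * v.1, u'.2 * v.2) := by simp [add_mul]
      rw [e1, e2, e3]
      simp only [map_add, add_mul]
      abel)
    (fun c u v => by
      have e1 : (((c • u).1, 0) : A₁ × A₂) = c • (u.1, 0) := by simp
      have e2 : ((0, (c • u).2) : A₁ × A₂) = c • (0, u.2) := by simp
      have e3 : (((c • u).1 * v.1, (c • u).2 * v.2) : A₁ × A₂) =
        c • (u.1 * v.1, u.2 * v.2) := by
        simp [smul_mul_assoc]
      rw [e1, e2, e3]
      simp only [map_smul, smul_mul_assoc, smul_add])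
    (fun u v v' => by
      have e1 : (((v + v').1, 0) : A₁ × A₂) = (v.1, 0) + (v'.1, 0) := by simp
      have e2 : ((0, (v + v').2) : A₁ × A₂) = (0, v.2) + (0, v'.2) := by simp
      have e3 : ((u.1 * (v + v').1, u.2 * (v + v').2) : A₁ × A₂) =
        (u.1 * v.1, u.2 * v.2) + (u.1 * v'.1, u.2 * v'.2) := by simp [mul_add]
      rw [e1, e2, e3]
      simp only [map_add, mul_add]
      abel)
    (fun c u v => by
      have e1 : (((c • v).1, 0) : A₁ × A₂) = c • (v.1, 0) := by simp
      have e2 : ((0, (c • v).2) : A₁ × A₂) = c • (0, v.2) := by simp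
      have e3 : ((u.1 * (c • v).1, u.2 * (c • v).2) : A₁ × A₂) =
        c • (u.1 * v.1, u.2 * v.2) := by
        simp [mul_smul_comm]
      rw [e1, e2, e3]
      simp only [map_smul, mul_smul_comm, smul_add])

/-- The action of letters on `T̄(A₁ ⊕ A₂)`: `u · 1 = u` and `u · (v w) = letterMul u v * w` for
letters `v` and words `w`. -/
def letterAction : A₁ × A₂ →ₗ[k] Module.End k (TensorAlgebra k (A₁ × A₂)) :=
  LinearMap.mk₂ k
    (fun u t => TensorAlgebra.algebraMapInv (R := k) t • TensorAlgebra.ι k u +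
      LinearMap.mul' k _ (LinearMap.rTensor _ (letterMul k u) (splitFirst k _ t)))
    (fun u u' t => by
      simp only [map_add, smul_add, LinearMap.rTensor_add, LinearMap.add_apply]
      abel)
    (fun c u t => by
      simp only [map_smul, LinearMap.rTensor_smul, LinearMap.smul_apply, smul_add,
        smul_comm c (TensorAlgebra.algebraMapInv (R := k) t)])
    (fun u t t' => by
      simp only [map_add, add_smul]
      abel)
    (fun c u t => by
      simp only [map_smul, smul_add, smul_assoc])

@[simp]
theorem letterAction_one (u : A₁ × A₂) : letterAction k u 1 = TensorAlgebra.ι k u := by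
  simp [letterAction]

@[simp]
theorem letterAction_ι_mul (u v : A₁ × A₂) (t : TensorAlgebra k (A₁ × A₂)) :
    letterAction k u (TensorAlgebra.ι k v * t) = letterMul k u v * t := by
  simp [letterAction, TensorAlgebra.algebraMapInv]

variable (A₁ A₂) in
/-- The action of `k ⊕ A₁ ⋆ A₂` on `T̄(A₁ ⊕ A₂)`. -/
def action : UnitalFreeProduct k A₁ A₂ →ₐ[k] Module.End k (TensorAlgebra k (A₁ × A₂)) :=
  unitalLift (letterAction k) fun x y h => by
    have z1 : TensorAlgebra.ι k ((0 : A₁), (0 : A₂)) = 0 := by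
      rw [Prod.mk_zero_zero, map_zero]
    have hone : ∀ u : A₁ × A₂, letterAction k u 1 = TensorAlgebra.ι k u := letterAction_one k
    have hι : ∀ u v : A₁ × A₂, letterAction k u (TensorAlgebra.ι k v) = letterMul k u v := by
      intro u v
      simpa using letterAction_ι_mul k u v 1
    cases h with
    | left a b =>
      rw [map_mul, TensorAlgebra.lift_ι_apply, TensorAlgebra.lift_ι_apply,
        TensorAlgebra.lift_ι_apply]
      refine tensor_ext k ?_ fun v t => ?_
      · simp [hι, letterMul, z1]
      · simp [letterMul, z1, add_mul, mul_assoc]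
    | right a b =>
      rw [map_mul, TensorAlgebra.lift_ι_apply, TensorAlgebra.lift_ι_apply,
        TensorAlgebra.lift_ι_apply]
      refine tensor_ext k ?_ fun v t => ?_
      · simp [hι, letterMul, z1]
      · simp [letterMul, z1, add_mul, mul_assoc]

variable (A₁ A₂) in
/-- The embedding of the free product `A = A₁ ⋆ A₂` into `T(A)`: the product `x₁ ⋯ xₙ` of an
alternating word is mapped to the word `x₁ ⊗ ⋯ ⊗ xₙ`. -/
def alternatingWord : FreeProduct k A₁ A₂ →ₗ[k] TensorAlgebra k (FreeProduct k A₁ A₂) :=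
  (TensorAlgebra.lift k (TensorAlgebra.ι k ∘ₗ pairLetter k)).toLinearMap ∘ₗ
    LinearMap.applyₗ (1 : TensorAlgebra k (A₁ × A₂)) ∘ₗ
    (action k A₁ A₂).toLinearMap ∘ₗ
    (inclusion k A₁ A₂ : FreeProduct k A₁ A₂ →ₗ[k] UnitalFreeProduct k A₁ A₂)

/-- The product `a * b₁ * ⋯ * bₙ` in a non-unital algebra. -/
def listProd {A : Type*} [Mul A] : A → List A → A
  | a, [] => a
  | a, b :: l => a * listProd b l

theorem action_listProd (x : A₁ ⊕ A₂) (l : List (A₁ ⊕ A₂)) (h : Alternating (x :: l)) :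
    action k A₁ A₂ (inclusion k A₁ A₂ (listProd (letter k x) (l.map (letter k)))) 1 =
      ((x :: l).map fun y => TensorAlgebra.ι k
        (Sum.elim (fun a => ((a, 0) : A₁ × A₂)) (fun b => (0, b)) y)).prod := by
  have hact : ∀ u : A₁ × A₂, action k A₁ A₂ (inclusion k A₁ A₂ (pairLetter k u)) =
      letterAction k u := by
    intro u
    rw [inclusion_pairLetter, action, unitalLift_mk]
  have hl : ∀ y : A₁ ⊕ A₂, letter k y =
      pairLetter k (Sum.elim (fun a => ((a, 0) : A₁ × A₂)) (fun b => (0, b)) y) := by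
    rintro (a | b) <;> rfl
  have z1 : TensorAlgebra.ι k ((0 : A₁), (0 : A₂)) = 0 := by
    rw [Prod.mk_zero_zero, map_zero]
  induction l generalizing x with
  | nil => simp [listProd, hl, hact]
  | cons y l ih =>
    rw [Alternating, List.isChain_cons_cons] at h
    have ih := ih y h.2
    rw [List.map_cons, listProd, map_mul, map_mul, Module.End.mul_apply, ih,
      hl, hact, List.map_cons, List.prod_cons, letterAction_ι_mul]
    rcases x with a | a <;> rcases y with b | b <;> simp [letterMul, z1, mul_assoc] at h ⊢

/-- The image of the product of an alternating word in `A₁ ⋆ A₂` is the word of its letters. -/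
theorem alternatingWord_listProd (x : A₁ ⊕ A₂) (l : List (A₁ ⊕ A₂)) (h : Alternating (x :: l)) :
    alternatingWord k A₁ A₂ (listProd (letter k x) (l.map (letter k))) =
      ((x :: l).map fun y => TensorAlgebra.ι k (letter k y)).prod := by
  have e : alternatingWord k A₁ A₂ (listProd (letter k x) (l.map (letter k))) =
      TensorAlgebra.lift k (TensorAlgebra.ι k ∘ₗ pairLetter k)
        (action k A₁ A₂ (inclusion k A₁ A₂ (listProd (letter k x) (l.map (letter k)))) 1) := rfl
  rw [e, action_listProd k x l h, map_list_prod, List.map_map]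
  congr 1
  refine List.map_congr_left fun y _ => ?_
  rcases y with a | b <;> simp [letter]

variable {k}

/-- The restriction to `A = A₁ ⋆ A₂` of a character of `T̄(T(A))`, along the embeddings
`A ⊆ T(A) ⊆ T̄(T(A))`. -/
def restriction (Φ : DoubleTensor k (FreeProduct k A₁ A₂) →ₐ[k] k) :
    FreeProduct k A₁ A₂ →ₗ[k] k :=
  Φ.toLinearMap ∘ₗ bar ∘ₗ alternatingWord k A₁ A₂

/-! ### The products of Speicher and Muraki -/

/-- The value of a linear form on the product of a list of elements, with value `1` for the empty
list. -/
def moment {A : Type*} [NonUnitalRing A] [Module k A] (ψ : A →ₗ[k] k) : List A → k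
  | [] => 1
  | a :: l => ψ (listProd a l)

/-- The monotone product:
`ψ(x₁ ⋯ xₙ) = φ₁(∏_{xᵢ ∈ A₁} xᵢ) ∏_{xⱼ ∈ A₂} φ₂(xⱼ)` for every alternating word. -/
def IsMonotoneProduct (φ₁ : A₁ →ₗ[k] k) (φ₂ : A₂ →ₗ[k] k) (ψ : FreeProduct k A₁ A₂ →ₗ[k] k) :
    Prop :=
  ∀ l : List (A₁ ⊕ A₂), l ≠ [] → Alternating l →
    moment ψ (l.map (letter k)) =
      moment φ₁ (l.filterMap Sum.getLeft?) * ((l.filterMap Sum.getRight?).map φ₂).prod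

/-- The antimonotone product:
`ψ(x₁ ⋯ xₙ) = φ₂(∏_{xᵢ ∈ A₂} xᵢ) ∏_{xⱼ ∈ A₁} φ₁(xⱼ)` for every alternating word. -/
def IsAntimonotoneProduct (φ₁ : A₁ →ₗ[k] k) (φ₂ : A₂ →ₗ[k] k)
    (ψ : FreeProduct k A₁ A₂ →ₗ[k] k) : Prop :=
  ∀ l : List (A₁ ⊕ A₂), l ≠ [] → Alternating l →
    moment ψ (l.map (letter k)) =
      moment φ₂ (l.filterMap Sum.getRight?) * ((l.filterMap Sum.getLeft?).map φ₁).prod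

/-- The boolean product: `ψ(x₁ ⋯ xₙ) = ∏_{xᵢ ∈ A₁} φ₁(xᵢ) ∏_{xⱼ ∈ A₂} φ₂(xⱼ)` for every
alternating word. -/
def IsBooleanProduct (φ₁ : A₁ →ₗ[k] k) (φ₂ : A₂ →ₗ[k] k) (ψ : FreeProduct k A₁ A₂ →ₗ[k] k) :
    Prop :=
  ∀ l : List (A₁ ⊕ A₂), l ≠ [] → Alternating l →
    moment ψ (l.map (letter k)) = (l.map (Sum.elim φ₁ φ₂)).prod

/-- The free product: for every alternating word,
`ψ(x₁ ⋯ xₙ) = ∑_{S ⊊ [n]} (-1)^{n - |S| + 1} ψ(∏_{i ∈ S} xᵢ) ∏_{i ∉ S, xᵢ ∈ A₁} φ₁(xᵢ)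
∏_{j ∉ S, xⱼ ∈ A₂} φ₂(xⱼ)`, where the products over `S` are taken in increasing order and
`ψ(∏_{i ∈ ∅} xᵢ) = 1`. Equivalently, `ψ` extends `φ₁` and `φ₂`, and its extension to the
unitization vanishes on the products `(x₁ - φ(x₁) 1) ⋯ (xₙ - φ(xₙ) 1)`. -/
def IsFreeProduct (φ₁ : A₁ →ₗ[k] k) (φ₂ : A₂ →ₗ[k] k) (ψ : FreeProduct k A₁ A₂ →ₗ[k] k) :
    Prop :=
  ∀ l : List (A₁ ⊕ A₂), l ≠ [] → Alternating l →
    moment ψ (l.map (letter k)) =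
      ∑ S ∈ (Finset.univ : Finset (Fin l.length)).ssubsets,
        (-1) ^ (l.length - S.card + 1) *
          moment ψ ((increasing S).map fun i => letter k (l.get i)) *
          ∏ i ∈ Sᶜ, Sum.elim φ₁ φ₂ (l.get i)

end FreeProduct

end UniversalProducts

end

open UniversalProducts

namespace UniversalProducts

/-! ### Functions on words

A linear form on a tensor algebra is handled through its values on words, that is, through a
function on lists of letters. -/

section Words

variable {k X : Type*} [CommRing k]

/-! Characters and infinitesimal characters of the double tensor algebra are determined by their
values on words, so everything is translated into functions on lists of letters. Convolution of
characters becomes `gapSum`. For a character with values F and an infinitesimal character with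
values κ, the equation Ψ = e + κ ≺ Ψ becomes F(x l) = ∑_S κ(x l_S) ∏ F(gaps), the free
moment-cumulant relation (`IsLeftCumulant`); the equation Ψ = e + Ψ ≻ β becomes F(x l) = ∑_{l = u v}
β(x u) F(v), the boolean one (`IsRightCumulant`). Half-shuffle multiplication by an infinitesimal
character lowers the degree, so these fixed point equations have unique solutions, the half-shuffle
exponentials, and the solutions are multiplicative (`exists_character`). Logarithms exist by
triangularity (`exists_leftLog`, `exists_rightLog`). Additive convolution is therefore addition of
cumulants.

The moments of Φ₁ on words of letters do not change if letters from A₂ are replaced by 0. By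
uniqueness neither do its cumulants, which hence vanish on words with a letter from A₂; likewise for
Φ₂. In each additive convolution the mixed cumulants thus vanish.

Monotone and antimonotone products: on an alternating word the only subset S that contributes to the
convolution is the set of all letters of the first factor's algebra, and its gaps have at most one
letter (`gapSum_alternating`). Boolean product: on an alternating word only u = ∅ contributes to the
recursion (`IsRightCumulant.apply_alternating`).

Free product: let T_x f = ∂ₓ f + (∂ₓκ) f, a sum of an annihilation and creation operators on
functions on words. The moment F(x₁ ⋯ xₙ) is the value at the empty word of T_{xₙ} ⋯ T_{x₁} applied
to the indicator of the empty word (`IsLeftCumulant.apply_eq_foldl`). If mixed cumulants vanish, the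
centred operators T_x - F(x) along an alternating word give 0 (`IsLeftCumulant.subwordSum_eq_zero`),
and expanding the product gives a relation between the F(x_S). These are values of the character on
words x_S, whereas the free product formula asks for ψ of the products in A, and x_S need not be
alternating. So F must also be shown to be unchanged when adjacent letters a, b of one algebra are
replaced by ab. This is equivalent to the formula for free cumulants with products as entries
(`IsLeftCumulant.merge`, `IsLeftCumulant.cumulantDefect_eq_zero`). That formula holds for each Φᵢ.
Every cumulant in it contains a, b or ab, so adding cumulants of the other colour does not affect it
(`IsLeftCumulant.merge_add`).

Uniqueness holds because products of alternating words span A (`ext_of_moment`); the free formula is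
recursive and needs an induction on length (`IsFreeProduct.unique`). -/

/-- The left derivative `(∂ₓ f)(s) = f(x s)` of a function on words. -/
abbrev derivative (x : X) (f : List X → k) : List X → k := fun s => f (x :: s)

/-- The Cauchy product `l ↦ ∑_{l = u v} g(u) f(v)` of functions on words. -/
def cauchy : (List X → k) → (List X → k) → List X → k
  | g, f, [] => g [] * f []
  | g, f, x :: l => g [] * f (x :: l) + cauchy (derivative x g) f l

/-- The sum `∑_S f(l_S) A(l_{J₀}) g(l_{J₁}) ⋯ g(l_{Jₚ})` over the subwords `l_S` of `l`, where
`J₀, …, Jₚ` are the (possibly empty) gaps of `S`. -/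
def gapSum : (List X → k) → (List X → k) → (List X → k) → List X → k
  | f, _, A, [] => f [] * A []
  | f, g, A, x :: l => A [] * gapSum (derivative x f) g g l + gapSum f g (derivative x A) l

/-- The indicator function of the empty word. -/
def emptyIndicator : List X → k
  | [] => 1
  | _ :: _ => 0

@[simp]
theorem cauchy_nil (g f : List X → k) : cauchy g f [] = g [] * f [] := rfl

theorem cauchy_cons (g f : List X → k) (x : X) (l : List X) :
    cauchy g f (x :: l) = g [] * f (x :: l) + cauchy (derivative x g) f l := rfl

@[simp]
theorem gapSum_nil (f g A : List X → k) : gapSum f g A [] = f [] * A [] := rfl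

theorem gapSum_cons (f g A : List X → k) (x : X) (l : List X) :
    gapSum f g A (x :: l) =
      A [] * gapSum (derivative x f) g g l + gapSum f g (derivative x A) l := rfl

theorem derivative_cauchy (g f : List X → k) (x : X) :
    derivative x (cauchy g f) = g [] • derivative x f + cauchy (derivative x g) f := rfl

theorem cauchy_add_left (g g' f : List X → k) : cauchy (g + g') f = cauchy g f + cauchy g' f := by
  funext l
  induction l generalizing g g' with
  | nil => simp [add_mul]
  | cons x l ih =>
    have := ih (derivative x g) (derivative x g')
    simp only [Pi.add_apply, cauchy_cons] at this ⊢
    rw [show derivative x (g + g') = derivative x g + derivative x g' from rfl, this]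
    ring

theorem cauchy_add_right (g f f' : List X → k) : cauchy g (f + f') = cauchy g f + cauchy g f' := by
  funext l
  induction l generalizing g with
  | nil => simp [mul_add]
  | cons x l ih =>
    have := ih (derivative x g)
    simp only [Pi.add_apply, cauchy_cons] at this ⊢
    rw [this]
    ring

theorem cauchy_smul_left (c : k) (g f : List X → k) : cauchy (c • g) f = c • cauchy g f := by
  funext l
  induction l generalizing g with
  | nil => simp [mul_assoc]
  | cons x l ih =>
    have := ih (derivative x g)
    simp only [Pi.smul_apply, smul_eq_mul, cauchy_cons] at this ⊢
    rw [show derivative x (c • g) = c • derivative x g from rfl, this]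
    ring

theorem cauchy_smul_right (c : k) (g f : List X → k) : cauchy g (c • f) = c • cauchy g f := by
  funext l
  induction l generalizing g with
  | nil => simp [mul_left_comm]
  | cons x l ih =>
    have := ih (derivative x g)
    simp only [Pi.smul_apply, smul_eq_mul, cauchy_cons] at this ⊢
    rw [this]
    ring

theorem cauchy_assoc (h g f : List X → k) : cauchy (cauchy h g) f = cauchy h (cauchy g f) := by
  funext l
  induction l generalizing h with
  | nil => simp [mul_assoc]
  | cons x l ih =>
    rw [cauchy_cons, cauchy_cons, derivative_cauchy, cauchy_add_left, cauchy_smul_left,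
      Pi.add_apply, ih, cauchy_cons]
    simp only [cauchy_nil, Pi.smul_apply, smul_eq_mul]
    ring

theorem cauchy_eq_zero_of_left (g f : List X → k) (l : List X)
    (hg : ∀ s, s.length ≤ l.length → g s = 0) : cauchy g f l = 0 := by
  induction l generalizing g with
  | nil => simp [hg]
  | cons x l ih =>
    rw [cauchy_cons, hg [] (by simp), ih, zero_mul, add_zero]
    exact fun s hs => hg _ (by simpa using hs)

theorem cauchy_eq_zero_of_right (g f : List X → k) (l : List X)
    (hf : ∀ s, s.length ≤ l.length → f s = 0) : cauchy g f l = 0 := by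
  induction l generalizing g with
  | nil => simp [hf]
  | cons x l ih =>
    rw [cauchy_cons, hf _ le_rfl, ih, mul_zero, add_zero]
    exact fun s hs => hf _ (hs.trans (by simp))

@[simp]
theorem cauchy_zero_left (f : List X → k) : cauchy 0 f = 0 :=
  funext fun l => cauchy_eq_zero_of_left _ _ l fun _ _ => rfl

/-- If `g` vanishes on all words shorter than `l`, then only one term of `cauchy g f l` is left. -/
theorem cauchy_eq_of_left (g f : List X → k) (l : List X)
    (hg : ∀ s, s.length < l.length → g s = 0) : cauchy g f l = g l * f [] := by
  induction l generalizing g with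
  | nil => rfl
  | cons x l ih =>
    rw [cauchy_cons, hg [] (by simp), ih, zero_mul, zero_add]
    exact fun s hs => hg _ (by simpa using hs)

@[simp]
theorem cauchy_emptyIndicator (g : List X → k) : cauchy g emptyIndicator = g := by
  funext l
  induction l generalizing g with
  | nil => simp [emptyIndicator]
  | cons x l ih => rw [cauchy_cons, ih]; simp [emptyIndicator]

theorem derivative_emptyIndicator (x : X) :
    derivative x (emptyIndicator : List X → k) = 0 := rfl

/-- By induction on length the difference of `g` and `g'` vanishes on all words shorter than `l`;
then its Cauchy product with `f` has only the term at `l` left, with coefficient `f [] = 1`. -/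
theorem cauchy_left_cancel {g g' f : List X → k} (hf : f [] = 1) (h : cauchy g f = cauchy g' f) :
    g = g' := by
  suffices H : ∀ n, ∀ l : List X, l.length = n → (g + (-1 : k) • g') l = 0 by
    funext l
    have := H _ l rfl
    simp only [Pi.add_apply, Pi.smul_apply, smul_eq_mul] at this
    linear_combination this
  intro n
  induction n using Nat.strong_induction_on with
  | _ n ih =>
    rintro l rfl
    have h1 := cauchy_eq_of_left (g + (-1 : k) • g') f l fun s hs => ih _ hs s rfl
    rw [cauchy_add_left, cauchy_smul_left, h, hf] at h1
    rw [← mul_one ((g + (-1 : k) • g') l), ← h1]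
    simp

theorem gapSum_add_left (f f' g A : List X → k) :
    gapSum (f + f') g A = gapSum f g A + gapSum f' g A := by
  funext l
  induction l generalizing f f' A with
  | nil => simp [add_mul]
  | cons x l ih =>
    rw [Pi.add_apply, gapSum_cons, gapSum_cons, gapSum_cons,
      show derivative x (f + f') = derivative x f + derivative x f' from rfl, ih, ih]
    simp only [Pi.add_apply]
    ring

theorem gapSum_smul_left (c : k) (f g A : List X → k) :
    gapSum (c • f) g A = c • gapSum f g A := by
  funext l
  induction l generalizing f A with
  | nil => simp [mul_assoc]
  | cons x l ih =>
    rw [Pi.smul_apply, gapSum_cons, gapSum_cons,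
      show derivative x (c • f) = c • derivative x f from rfl, ih, ih]
    simp only [Pi.smul_apply, smul_eq_mul]
    ring

theorem gapSum_add_right (f g A A' : List X → k) :
    gapSum f g (A + A') = gapSum f g A + gapSum f g A' := by
  funext l
  induction l generalizing A A' with
  | nil => simp [mul_add]
  | cons x l ih =>
    rw [Pi.add_apply, gapSum_cons, gapSum_cons, gapSum_cons,
      show derivative x (A + A') = derivative x A + derivative x A' from rfl, ih]
    simp only [Pi.add_apply]
    ring

theorem gapSum_smul_right (c : k) (f g A : List X → k) :
    gapSum f g (c • A) = c • gapSum f g A := by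
  funext l
  induction l generalizing A with
  | nil => simp [mul_left_comm]
  | cons x l ih =>
    rw [Pi.smul_apply, gapSum_cons, gapSum_cons,
      show derivative x (c • A) = c • derivative x A from rfl, ih]
    simp only [Pi.smul_apply, smul_eq_mul]
    ring

theorem derivative_gapSum (f g A : List X → k) (x : X) :
    derivative x (gapSum f g A) =
      A [] • gapSum (derivative x f) g g + gapSum f g (derivative x A) := rfl

/-- On the left a subword is cut into an initial part, seen by `h`, and a final part, seen by `f`.
If the final part is chosen first, the initial part is a subword of its first gap, and the gaps of
the whole are the gaps inside that first gap followed by the remaining ones. -/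
theorem gapSum_cauchy (h f g A : List X → k) :
    gapSum (cauchy h f) g A = gapSum f g (gapSum h g A) := by
  funext l
  induction l generalizing h f A with
  | nil => simp only [gapSum_nil, cauchy_nil]; ring
  | cons x l ih =>
    rw [gapSum_cons, gapSum_cons, derivative_cauchy, gapSum_add_left, gapSum_smul_left,
      derivative_gapSum, gapSum_add_right, gapSum_smul_right]
    simp only [Pi.add_apply, Pi.smul_apply, smul_eq_mul, ih, gapSum_nil]
    ring

theorem gapSum_zero_left (g A : List X → k) : gapSum 0 g A = 0 := by
  simpa using gapSum_smul_left (0 : k) 0 g A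

theorem gapSum_emptyIndicator (g A : List X → k) : gapSum emptyIndicator g A = A := by
  funext l
  induction l generalizing A with
  | nil => simp [emptyIndicator]
  | cons x l ih => rw [gapSum_cons, derivative_emptyIndicator, gapSum_zero_left, ih]; simp

/-- If `f` vanishes on all words shorter than `l`, then only one term of `gapSum f g A l` is
left. -/
theorem gapSum_eq_of_left (f g A : List X → k) (hg : g [] = 1) (l : List X)
    (hf : ∀ s, s.length < l.length → f s = 0) : gapSum f g A l = f l * A [] := by
  induction l generalizing f A with
  | nil => rfl
  | cons x l ih =>
    rw [gapSum_cons, ih, ih, hg, hf l (by simp)]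
    · ring
    · exact fun s hs => hf _ (by simp only [List.length_cons]; omega)
    · exact fun s hs => hf _ (by simpa using hs)

/-- Convolution with `g` is unitriangular with respect to length: once `f - f'` vanishes on shorter
words, only the term of the full subword is left, and all its gaps are empty. -/
theorem gapSum_left_cancel {f f' g : List X → k} (hg : g [] = 1)
    (h : gapSum f g g = gapSum f' g g) : f = f' := by
  suffices H : ∀ n, ∀ l : List X, l.length = n → (f + (-1 : k) • f') l = 0 by
    funext l
    have := H _ l rfl
    simp only [Pi.add_apply, Pi.smul_apply, smul_eq_mul] at this
    linear_combination this
  intro n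
  induction n using Nat.strong_induction_on with
  | _ n ih =>
    rintro l rfl
    have h1 := gapSum_eq_of_left (f + (-1 : k) • f') g g hg l fun s hs => ih _ hs s rfl
    rw [gapSum_add_left, gapSum_smul_left, h, hg] at h1
    rw [← mul_one ((f + (-1 : k) • f') l), ← h1]
    simp

theorem gapSum_map {Y : Type*} (π : Y → X) (f g A : List X → k) (l : List Y) :
    gapSum f g A (l.map π) =
      gapSum (fun s => f (s.map π)) (fun s => g (s.map π)) (fun s => A (s.map π)) l := by
  induction l generalizing f A with
  | nil => rfl
  | cons y l ih => rw [List.map_cons, gapSum_cons, gapSum_cons, ih, ih]; rfl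

theorem cauchy_map {Y : Type*} (π : Y → X) (g f : List X → k) (l : List Y) :
    cauchy g f (l.map π) = cauchy (fun s => g (s.map π)) (fun s => f (s.map π)) l := by
  induction l generalizing g with
  | nil => rfl
  | cons y l ih => rw [List.map_cons, cauchy_cons, cauchy_cons, ih]; rfl

/-! ### Left cumulants -/

/-- `κ` is the family of (free) cumulants of the family `F` of moments. -/
def IsLeftCumulant (κ F : List X → k) : Prop :=
  F [] = 1 ∧ κ [] = 0 ∧ ∀ x, derivative x F = gapSum (derivative x κ) F F

/-- `β` is the family of (boolean) cumulants of the family `F` of moments. -/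
def IsRightCumulant (β F : List X → k) : Prop :=
  F [] = 1 ∧ β [] = 0 ∧ ∀ x, derivative x F = cauchy (derivative x β) F

theorem eq_of_derivative_eq {f g : List X → k} (h0 : f [] = g [])
    (h : ∀ x, derivative x f = derivative x g) : f = g := by
  funext l
  cases l with
  | nil => exact h0
  | cons x l => exact congrFun (h x) l

/-- The defining relation exhibits each derivative of `F` as an injective function of the
corresponding derivative of the cumulants. -/
theorem IsLeftCumulant.unique {κ κ' F : List X → k} (h : IsLeftCumulant κ F)
    (h' : IsLeftCumulant κ' F) : κ = κ' :=
  eq_of_derivative_eq (h.2.1.trans h'.2.1.symm) fun x =>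
    gapSum_left_cancel h.1 ((h.2.2 x).symm.trans (h'.2.2 x))

theorem IsRightCumulant.unique {β β' F : List X → k} (h : IsRightCumulant β F)
    (h' : IsRightCumulant β' F) : β = β' :=
  eq_of_derivative_eq (h.2.1.trans h'.2.1.symm) fun x =>
    cauchy_left_cancel h.1 ((h.2.2 x).symm.trans (h'.2.2 x))

theorem IsLeftCumulant.apply_singleton {κ F : List X → k} (h : IsLeftCumulant κ F) (x : X) :
    F [x] = κ [x] := by
  have := congrFun (h.2.2 x) []
  simpa [derivative, h.1] using this

theorem IsLeftCumulant.comp_map {Y : Type*} {κ F : List X → k} (h : IsLeftCumulant κ F)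
    (π : Y → X) : IsLeftCumulant (fun s => κ (s.map π)) (fun s => F (s.map π)) :=
  ⟨h.1, h.2.1, fun y => funext fun l =>
    (congrFun (h.2.2 (π y)) (l.map π)).trans (gapSum_map π _ F F l)⟩

theorem IsRightCumulant.apply_singleton {κ F : List X → k} (h : IsRightCumulant κ F) (x : X) :
    F [x] = κ [x] := by
  have := congrFun (h.2.2 x) []
  simpa [derivative, h.1] using this

theorem IsRightCumulant.comp_map {Y : Type*} {β F : List X → k} (h : IsRightCumulant β F)
    (π : Y → X) : IsRightCumulant (fun s => β (s.map π)) (fun s => F (s.map π)) :=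
  ⟨h.1, h.2.1, fun y => funext fun l =>
    (congrFun (h.2.2 (π y)) (l.map π)).trans (cauchy_map π _ F l)⟩

/-! ### The Fock space model of moments with given free cumulants -/

/-- The operator `f ↦ ∂ₓ f + (∂ₓ κ) f` on functions on words. -/
def fockStep (κ : List X → k) (f : List X → k) (x : X) : List X → k :=
  derivative x f + cauchy (derivative x κ) f

/-- The injective map f ↦ `gapSum f F F` intertwines left derivatives with the operators `fockStep`.
Either the letter `x` is taken by `f`, or it opens the first gap; in the second case the recursion
for `F` on that gap inserts a cumulant in front of `f`. -/
theorem IsLeftCumulant.derivative_gapSum {κ F : List X → k} (h : IsLeftCumulant κ F)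
    (f : List X → k) (x : X) :
    derivative x (gapSum f F F) = gapSum (fockStep κ f x) F F := by
  rw [UniversalProducts.derivative_gapSum, h.1, h.2.2 x, fockStep, gapSum_add_left, gapSum_cauchy,
    one_smul]

theorem IsLeftCumulant.gapSum_append {κ F : List X → k} (h : IsLeftCumulant κ F)
    (f : List X → k) (u v : List X) :
    gapSum f F F (u ++ v) = gapSum (u.foldl (fockStep κ) f) F F v := by
  induction u generalizing f with
  | nil => rfl
  | cons x u ih =>
    rw [List.cons_append, List.foldl_cons, ← ih, ← h.derivative_gapSum]

theorem IsLeftCumulant.apply_append {κ F : List X → k} (h : IsLeftCumulant κ F) (u v : List X) :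
    F (u ++ v) = gapSum (u.foldl (fockStep κ) emptyIndicator) F F v := by
  rw [← h.gapSum_append, gapSum_emptyIndicator]

/-- Moments are vacuum expectations: the letters act one after the other on the indicator of the
empty word, and the result is evaluated at the empty word. -/
theorem IsLeftCumulant.apply_eq_foldl {κ F : List X → k} (h : IsLeftCumulant κ F) (l : List X) :
    F l = l.foldl (fockStep κ) emptyIndicator [] := by
  have := h.apply_append l []
  rwa [List.append_nil, gapSum_nil, h.1, mul_one] at this

/-! ### Cumulants with products as entries -/

/-- The defect of the formula for cumulants with products as entries, for two letters `a`, `b` and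
their product `c`. -/
def mergeDefect (κ : List X → k) (a b c : X) (f : List X → k) (u v : List X) : k :=
  f (u ++ a :: b :: v) + cauchy (derivative b κ) (fun w => f (u ++ a :: w)) v +
    cauchy (fun w => f (w ++ b :: v)) (fun w => κ (w ++ [a])) u - f (u ++ c :: v)

section Merge

variable (κ : List X → k) (a b c : X)

/-- A prefixed letter creates just one new term: the one in which the factor with `a` takes all of
the prefix. -/
theorem mergeDefect_cons (f : List X → k) (x : X) (u v : List X) :
    mergeDefect κ a b c f (x :: u) v =
      mergeDefect κ a b c (derivative x f) u v + f (b :: v) * κ (x :: u ++ [a]) := by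
  have h : cauchy (derivative x fun w => f (w ++ b :: v)) (fun w => κ (w ++ [a])) u =
      cauchy (fun w => derivative x f (w ++ b :: v)) (fun w => κ (w ++ [a])) u := rfl
  rw [mergeDefect, mergeDefect, cauchy_cons, h]
  simp only [List.nil_append, List.cons_append, derivative]
  ring

theorem mergeDefect_add (f f' : List X → k) (u v : List X) :
    mergeDefect κ a b c (f + f') u v =
      mergeDefect κ a b c f u v + mergeDefect κ a b c f' u v := by
  have h1 := congrFun (cauchy_add_right (derivative b κ) (fun w => f (u ++ a :: w))
    (fun w => f' (u ++ a :: w))) v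
  have h2 := congrFun (cauchy_add_left (fun w => f (w ++ b :: v)) (fun w => f' (w ++ b :: v))
    (fun w => κ (w ++ [a]))) u
  simp only [mergeDefect, Pi.add_apply] at h1 h2 ⊢
  rw [show (fun w => f (u ++ a :: w) + f' (u ++ a :: w)) =
    (fun w => f (u ++ a :: w)) + fun w => f' (u ++ a :: w) from rfl, h1,
    show (fun w => f (w ++ b :: v) + f' (w ++ b :: v)) =
    (fun w => f (w ++ b :: v)) + fun w => f' (w ++ b :: v) from rfl, h2]
  ring

theorem mergeDefect_smul (r : k) (f : List X → k) (u v : List X) :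
    mergeDefect κ a b c (r • f) u v = r * mergeDefect κ a b c f u v := by
  have h1 := congrFun (cauchy_smul_right r (derivative b κ) (fun w => f (u ++ a :: w))) v
  have h2 := congrFun (cauchy_smul_left r (fun w => f (w ++ b :: v)) (fun w => κ (w ++ [a]))) u
  simp only [mergeDefect, Pi.smul_apply, smul_eq_mul] at h1 h2 ⊢
  rw [show (fun w => r * f (u ++ a :: w)) = r • fun w => f (u ++ a :: w) from rfl, h1,
    show (fun w => r * f (w ++ b :: v)) = r • fun w => f (w ++ b :: v) from rfl, h2]
  ring

theorem mergeDefect_nil (f : List X → k) :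
    mergeDefect κ a b c f [] = derivative b (derivative a f) +
      cauchy (derivative b κ) (derivative a f) + κ [a] • derivative b f - derivative c f := by
  funext v
  simp [mergeDefect, derivative, mul_comm]

theorem mergeDefect_emptyIndicator (u v : List X) :
    mergeDefect κ a b c emptyIndicator u v = 0 := by
  have h : ∀ (w : List X) (x : X) (w' : List X), (emptyIndicator (w ++ x :: w') : k) = 0 := by
    intro w x w'
    cases w <;> rfl
  simp only [mergeDefect, h]
  rw [cauchy_eq_zero_of_left _ _ _ fun _ _ => rfl, cauchy_eq_zero_of_right _ _ _ fun _ _ => rfl]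
  ring

/-- A Leibniz rule. In every term a cut on one side of the merged place puts the whole defect into
one factor; the exceptional term is the cut of `u a b v` between `a` and `b`. -/
theorem mergeDefect_cauchy (g f : List X → k) (u v : List X) :
    mergeDefect κ a b c (cauchy g f) u v =
      cauchy g (fun w => mergeDefect κ a b c f w v) u +
        cauchy (mergeDefect κ a b c g u) f v + g (u ++ [a]) * f (b :: v) := by
  induction u generalizing g with
  | nil =>
    rw [mergeDefect_nil, mergeDefect_nil, cauchy_nil, mergeDefect_nil]
    simp only [derivative_cauchy, sub_eq_add_neg, ← neg_one_smul k (derivative c _),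
      cauchy_add_left, cauchy_add_right, cauchy_smul_left, cauchy_smul_right, cauchy_assoc,
      Pi.add_apply, Pi.smul_apply, smul_eq_mul, smul_add, List.nil_append, Pi.neg_apply,
      show derivative b (g [] • derivative a f + cauchy (derivative a g) f) =
        g [] • derivative b (derivative a f) + derivative b (cauchy (derivative a g) f) from rfl]
    ring
  | cons x u ih =>
    have h0 : cauchy g (fun w => mergeDefect κ a b c f w v) (x :: u) =
        g [] * (mergeDefect κ a b c (derivative x f) u v + f (b :: v) * κ (x :: u ++ [a])) +
          cauchy (derivative x g) (fun w => mergeDefect κ a b c f w v) u := by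
      rw [cauchy_cons, mergeDefect_cons]
    rw [mergeDefect_cons, derivative_cauchy, mergeDefect_add, mergeDefect_smul, ih, cauchy_cons,
      h0]
    have h1 : mergeDefect κ a b c g (x :: u) =
        mergeDefect κ a b c (derivative x g) u + κ (x :: u ++ [a]) • derivative b g := by
      funext w
      rw [mergeDefect_cons]
      simp [mul_comm]
    rw [h1, cauchy_add_left, cauchy_smul_left]
    simp only [Pi.add_apply, Pi.smul_apply, smul_eq_mul, List.cons_append]
    ring

/-- The defect of the formula for `κ` with the product of `a` and `b` as an entry. -/
def cumulantDefect (u v : List X) : k :=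
  mergeDefect κ a b c κ u v - κ (u ++ [a]) * κ (b :: v)

/-- This propagates the defect along the Fock space operators. The exceptional term of the Leibniz
rule is what turns the merge defect of `derivative x κ` into `cumulantDefect` at a word starting
with `x`. -/
theorem mergeDefect_fockStep (f : List X → k) (x : X) (u v : List X) :
    mergeDefect κ a b c (fockStep κ f x) u v =
      mergeDefect κ a b c f (x :: u) v +
        cauchy (derivative x κ) (fun w => mergeDefect κ a b c f w v) u +
        cauchy (cumulantDefect κ a b c (x :: u)) f v := by
  have h1 : mergeDefect κ a b c (derivative x κ) u = cumulantDefect κ a b c (x :: u) := by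
    funext w
    rw [cumulantDefect, mergeDefect_cons]
    ring
  rw [fockStep, mergeDefect_add, mergeDefect_cauchy, h1, mergeDefect_cons]
  simp only [derivative, List.cons_append]
  ring

/-- The last two terms measure the failure of the operator of `c` to be the composite of those of
`a` and `b`. On the states that arise from the empty word, both vanish once the cumulant formula
holds. -/
theorem fockStep_fockStep (f : List X → k) :
    fockStep κ (fockStep κ f a) b = fockStep κ f c + mergeDefect κ a b c f [] +
      cauchy (cumulantDefect κ a b c []) f := by
  have h1 : cumulantDefect κ a b c [] =
      derivative b (derivative a κ) + cauchy (derivative b κ) (derivative a κ) +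
        (-1 : k) • derivative c κ := by
    funext v
    rw [cumulantDefect, mergeDefect_nil]
    simp [derivative]
    ring
  funext v
  rw [h1, mergeDefect_nil]
  simp only [fockStep, cauchy_add_left, cauchy_add_right, cauchy_smul_left, cauchy_assoc,
    Pi.add_apply, Pi.smul_apply, Pi.sub_apply, smul_eq_mul,
    show derivative b (derivative a f + cauchy (derivative a κ) f) =
      derivative b (derivative a f) + derivative b (cauchy (derivative a κ) f) from rfl,
    derivative_cauchy]
  ring

variable {κ a b c} {F : List X → k}

/-- If the formula for cumulants with products as entries holds, then `F` respects the product of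
`a` and `b`. -/
theorem IsLeftCumulant.merge (h : IsLeftCumulant κ F)
    (hκ : ∀ u v, cumulantDefect κ a b c u v = 0) (u v : List X) :
    F (u ++ a :: b :: v) = F (u ++ c :: v) := by
  have hc : ∀ u, cumulantDefect κ a b c u = 0 := fun u => funext (hκ u)
  -- The defect vanishes on the vacuum, and with zero cumulant defects each operator preserves its
  -- vanishing.
  have key : ∀ w s t, mergeDefect κ a b c (List.foldl (fockStep κ) emptyIndicator w) s t = 0 := by
    intro w
    induction w using List.reverseRecOn with
    | nil => exact mergeDefect_emptyIndicator κ a b c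
    | append_singleton w x ih =>
      intro s t
      rw [List.foldl_append, List.foldl_cons, List.foldl_nil, mergeDefect_fockStep, ih, hc, cauchy_zero_left,
        cauchy_eq_zero_of_right _ _ _ fun w _ => ih w t]
      simp
  have e1 : u ++ a :: b :: v = (u ++ [a, b]) ++ v := by simp
  have e2 : u ++ c :: v = (u ++ [c]) ++ v := by simp
  rw [e1, e2, h.apply_append, h.apply_append (u ++ [c]), List.foldl_append, List.foldl_append]
  simp only [List.foldl_cons, List.foldl_nil]
  rw [fockStep_fockStep κ a b c, hc, funext (key u [])]
  congr 1
  funext w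
  simp

/-- If `F` respects the product of `a` and `b`, then the formula for cumulants with products as
entries holds. -/
theorem IsLeftCumulant.cumulantDefect_eq_zero (h : IsLeftCumulant κ F)
    (hF : ∀ u v, F (u ++ a :: b :: v) = F (u ++ c :: v)) (u v : List X) :
    cumulantDefect κ a b c u v = 0 := by
  -- By injectivity of f ↦ `gapSum f F F`, invariance of the moments gives equality of the two
  -- operators on every state, so the error terms of `fockStep_fockStep` cancel there.
  have step : ∀ w : List X, mergeDefect κ a b c (w.foldl (fockStep κ) emptyIndicator) [] +
      cauchy (cumulantDefect κ a b c []) (w.foldl (fockStep κ) emptyIndicator) = 0 := by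
    intro w
    have h1 : fockStep κ (fockStep κ (w.foldl (fockStep κ) emptyIndicator) a) b =
        fockStep κ (w.foldl (fockStep κ) emptyIndicator) c := by
      refine gapSum_left_cancel h.1 (funext fun t => ?_)
      have := hF w t
      rwa [show w ++ a :: b :: t = (w ++ [a, b]) ++ t by simp,
        show w ++ c :: t = (w ++ [c]) ++ t by simp, h.apply_append, h.apply_append (w ++ [c]),
        List.foldl_append, List.foldl_append] at this
    rw [fockStep_fockStep κ a b c, add_assoc] at h1
    exact add_eq_left.1 h1
  have h0 : cumulantDefect κ a b c [] = 0 := by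
    have := step []
    rwa [List.foldl_nil, cauchy_emptyIndicator, funext (mergeDefect_emptyIndicator κ a b c []),
      show (fun _ : List X => (0 : k)) = 0 from rfl, zero_add] at this
  have step' : ∀ w t, mergeDefect κ a b c (List.foldl (fockStep κ) emptyIndicator w) [] t = 0 := by
    intro w t
    have := congrFun (step w) t
    rwa [h0, cauchy_zero_left, add_zero] at this
  suffices H : ∀ n, ∀ u : List X, u.length = n → cumulantDefect κ a b c u = 0 from
    congrFun (H _ u rfl) v
  intro n
  induction n using Nat.strong_induction_on with
  | _ n ih =>
    -- Assuming the cumulant defects vanish for all prefixes shorter than `n`, moving the letters of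
    -- `w` from the state into the prefix costs nothing. With `s = []` and `w = u` the left side is
    -- zero by `step'`.
    have key : ∀ w : List X, w ≠ [] → ∀ s t, w.length + s.length ≤ n →
        mergeDefect κ a b c (w.foldl (fockStep κ) emptyIndicator) s t =
          cumulantDefect κ a b c (w ++ s) t := by
      intro w
      induction w using List.reverseRecOn with
      | nil => intro h; exact absurd rfl h
      | append_singleton w x ihw =>
        intro _ s t hn
        rw [List.length_append, List.length_singleton] at hn
        rw [List.foldl_append, List.foldl_cons, List.foldl_nil, mergeDefect_fockStep]
        -- The first letter acts on the vacuum and produces the cumulant defect itself. For every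
        -- later letter, the additional terms involve only prefixes shorter than `n`.
        by_cases hw : w = []
        · subst hw
          rw [List.foldl_nil, mergeDefect_emptyIndicator, cauchy_emptyIndicator,
            cauchy_eq_zero_of_right _ _ _ fun w _ => mergeDefect_emptyIndicator κ a b c w t]
          simp
        · have hpos := List.length_pos_iff.2 hw
          rw [ihw hw _ _ (by simp only [List.length_cons]; omega), cauchy_eq_zero_of_right,
            ih (x :: s).length (by simp only [List.length_cons]; omega) _ rfl,
            cauchy_zero_left]
          · simp
          · intro s' hs'
            rw [ihw hw _ _ (by omega),
              ih (w ++ s').length (by simp only [List.length_append]; omega) _ rfl]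
            rfl
    rintro u rfl
    by_cases hu : u = []
    · rw [hu, h0]
    · funext t
      have := key u hu [] t (by simp)
      rw [List.append_nil, step'] at this
      exact this.symm

end Merge

/-! ### Words in two colours -/

/-- `κ` vanishes on the words that contain a letter whose colour is not `i`. -/
def IsColored (color : X → Bool) (i : Bool) (κ : List X → k) : Prop :=
  ∀ l x, x ∈ l → color x ≠ i → κ l = 0

section Color

variable {color : X → Bool} {κ κ' F F' G : List X → k} {i : Bool}

/-- Every factor κ in the defect has `a`, `b` or `c` among its arguments, and `κ'` vanishes on such
words. -/
theorem cumulantDefect_add {a b c : X} (hκ' : IsColored color (!i) κ') (ha : color a = i)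
    (hb : color b = i) (hc : color c = i) (u v : List X) :
    cumulantDefect (κ + κ') a b c u v = cumulantDefect κ a b c u v := by
  have key : ∀ x, color x = i → ∀ s t, (κ + κ') (s ++ x :: t) = κ (s ++ x :: t) := by
    intro x hx s t
    rw [Pi.add_apply, hκ' _ x (by simp) (by simp [hx]), add_zero]
  have key' : ∀ x, color x = i → ∀ t, (κ + κ') (x :: t) = κ (x :: t) :=
    fun x hx t => key x hx [] t
  simp only [cumulantDefect, mergeDefect, key _ ha, key _ hb, key _ hc, key' _ hb,
    show derivative b (κ + κ') = derivative b κ from funext (key' b hb)]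

/-- A family of moments with cumulants `κ + κ'` respects the products that the family with
cumulants `κ` respects. -/
theorem IsLeftCumulant.merge_add {a b c : X} (h : IsLeftCumulant κ F)
    (hG : IsLeftCumulant (κ + κ') G) (hκ' : IsColored color (!i) κ') (ha : color a = i)
    (hb : color b = i) (hc : color c = i) (hF : ∀ u v, F (u ++ a :: b :: v) = F (u ++ c :: v))
    (u v : List X) : G (u ++ a :: b :: v) = G (u ++ c :: v) :=
  hG.merge (fun s t => (cumulantDefect_add hκ' ha hb hc s t).trans
    (h.cumulantDefect_eq_zero hF s t)) u v

/-- Since the derivative of `f` at `x` vanishes, `x` acts only by creation. The summand that creates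
no letter is κ(x) f and is removed by the centring; every other summand prepends a word in the
colour of `x`. So the result starts with a letter of that colour, which is the hypothesis needed for
a next letter of another colour. -/
theorem fockStep_centered (x : X) (f : List X → k)
    (hκ : ∀ s y, y ∈ s → color y ≠ color x → κ (x :: s) = 0) (hf : derivative x f = 0) :
    (fockStep κ f x + (-κ [x]) • f) [] = 0 ∧
      ∀ y, color y ≠ color x → derivative y (fockStep κ f x + (-κ [x]) • f) = 0 := by
  rw [fockStep, hf, zero_add]
  refine ⟨by simp [derivative], fun y hy => funext fun l => ?_⟩
  have : cauchy (derivative y (derivative x κ)) f l = 0 :=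
    cauchy_eq_zero_of_left _ _ _ fun s _ => hκ (y :: s) y (by simp) hy
  simp only [derivative, Pi.add_apply, cauchy_cons, Pi.smul_apply, smul_eq_mul, Pi.zero_apply]
  rw [show cauchy (fun s => κ (x :: y :: s)) f l = 0 from this]
  ring

theorem foldl_fockStep_centered (l : List X) (hl : l.IsChain fun x y => color x ≠ color y)
    (f : List X → k) (hκ : ∀ x ∈ l, ∀ s y, y ∈ s → color y ≠ color x → κ (x :: s) = 0)
    (hf : ∀ x ∈ l.head?, derivative x f = 0) (hne : l ≠ []) :
    l.foldl (fun f x => fockStep κ f x + (-κ [x]) • f) f [] = 0 := by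
  induction l generalizing f with
  | nil => exact absurd rfl hne
  | cons x l ih =>
    have h := fockStep_centered x f (hκ x (by simp)) (hf x (by simp))
    rw [List.foldl_cons]
    cases l with
    | nil => exact h.1
    | cons y l =>
      rw [List.isChain_cons_cons] at hl
      refine ih hl.2 _ (fun z hz => hκ z (List.mem_cons_of_mem _ hz)) (fun z hz => ?_) (by simp)
      obtain rfl : y = z := by simpa using hz
      exact h.2 _ hl.1.symm

/-- The sum `∑_S G(l_S) ∏_{i ∉ S} c(lᵢ)` over all subwords `l_S` of `l`. -/
def subwordSum (c : X → k) : (List X → k) → List X → k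
  | G, [] => G []
  | G, x :: l => subwordSum c (derivative x G) l + c x * subwordSum c G l

theorem foldl_add_smul {M : Type*} [AddCommGroup M] [Module k M] (T : M → X → M)
    (hT : ∀ x (f : M) (r : k) (g : M), T (f + r • g) x = T f x + r • T g x) (l : List X) (f : M) (r : k) (g : M) :
    l.foldl T (f + r • g) = l.foldl T f + r • l.foldl T g := by
  induction l generalizing f g with
  | nil => rfl
  | cons x l ih => rw [List.foldl_cons, hT, ih, List.foldl_cons, List.foldl_cons]

theorem fockStep_add_smul (x : X) (f : List X → k) (r : k) (g : List X → k) :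
    fockStep κ (f + r • g) x = fockStep κ f x + r • fockStep κ g x := by
  rw [fockStep, cauchy_add_right, cauchy_smul_right, fockStep, fockStep,
    show derivative x (f + r • g) = derivative x f + r • derivative x g from rfl]
  module

/-- Expansion of the product of the operators T_x + c(x): for each letter either the operator or the
scalar is chosen. -/
theorem subwordSum_foldl (c : X → k) (f : List X → k) (l : List X) :
    subwordSum c (fun s => s.foldl (fockStep κ) f []) l =
      l.foldl (fun f x => fockStep κ f x + c x • f) f [] := by
  induction l generalizing f with
  | nil => rfl
  | cons x l ih =>
    rw [subwordSum, show derivative x (fun s => s.foldl (fockStep κ) f []) =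
      fun s => s.foldl (fockStep κ) (fockStep κ f x) [] from rfl, ih, ih, List.foldl_cons,
      foldl_add_smul]
    · rfl
    · intro x f r g
      rw [fockStep_add_smul]
      module

/-- Vanishing of the centred moments of alternating words, if the mixed cumulants vanish. -/
theorem IsLeftCumulant.subwordSum_eq_zero (h : IsLeftCumulant κ F)
    (hκ : ∀ x s y, y ∈ s → color y ≠ color x → κ (x :: s) = 0) (l : List X)
    (hl : l.IsChain fun x y => color x ≠ color y) (hne : l ≠ []) :
    subwordSum (fun x => -F [x]) F l = 0 := by
  simp only [h.apply_singleton]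
  rw [show F = fun s => s.foldl (fockStep κ) emptyIndicator [] from funext h.apply_eq_foldl,
    subwordSum_foldl]
  exact foldl_fockStep_centered l hl _ (fun x _ => hκ x) (fun x _ => rfl) hne

/-- Moments of alternating words, if the mixed boolean cumulants vanish. -/
theorem IsRightCumulant.apply_alternating (h : IsRightCumulant κ F)
    (hκ : ∀ x s y, y ∈ s → color y ≠ color x → κ (x :: s) = 0) (l : List X)
    (hl : l.IsChain fun x y => color x ≠ color y) : F l = (l.map fun x => F [x]).prod := by
  induction l with
  | nil => exact h.1
  | cons x l ih =>
    have e := congrFun (h.2.2 x) l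
    rw [List.map_cons, List.prod_cons, h.apply_singleton, ← ih hl.tail]
    cases l with
    | nil => simpa [derivative] using e
    | cons y l =>
      rw [List.isChain_cons_cons] at hl
      rw [cauchy_cons, cauchy_eq_zero_of_left, add_zero] at e
      · exact e
      · exact fun s _ => hκ x (y :: s) y (by simp) hl.1.symm

/-! ### Convolution of two families in different colours -/

theorem IsColored.derivative (hF : IsColored color i F) (x : X) :
    IsColored color i (derivative x F) :=
  fun l y hy hi => hF (x :: l) y (List.mem_cons_of_mem _ hy) hi

theorem IsColored.derivative_eq_zero (hF : IsColored color i F) {x : X} (hx : color x ≠ i) :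
    UniversalProducts.derivative x F = 0 :=
  funext fun l => hF (x :: l) x (by simp) hx

/-- The convolution of two families of moments in different colours on alternating words. -/
theorem gapSum_alternating (hF : IsColored color i F) (hG : IsColored color (!i) G)
    (hG0 : G [] = 1) (l : List X) (hl : l.IsChain fun x y => color x ≠ color y) :
    gapSum F G G l = F (l.filter fun x => color x = i) *
      ((l.filter fun x => color x = !i).map fun x => G [x]).prod := by
  suffices H : ∀ n, ∀ F : List X → k, IsColored color i F → ∀ l : List X, l.length = n →
      (l.IsChain fun x y => color x ≠ color y) →
      gapSum F G G l = F (l.filter fun x => color x = i) *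
        ((l.filter fun x => color x = !i).map fun x => G [x]).prod from H _ F hF l rfl hl
  intro n
  induction n using Nat.strong_induction_on with
  | _ n ih =>
    rintro F hF l rfl hl
    cases l with
    | nil => simp [hG0]
    | cons x l =>
      by_cases hx : color x = i
      · rw [gapSum_cons, hG.derivative_eq_zero (by simp [hx]), hG0,
          ih l.length (by simp) _ (hF.derivative x) l rfl hl.tail,
          ← zero_smul k (0 : List X → k), gapSum_smul_right]
        simp [hx]
      -- A letter of the other colour must lie in a gap. The next letter has colour `i`, hence lies
      -- in the subword and closes this gap, so two letters are consumed at once.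
      · have hx' : color x = !i := by rwa [Bool.eq_not_iff]
        rw [gapSum_cons, hF.derivative_eq_zero hx, gapSum_zero_left]
        cases l with
        | nil => simp [hx']
        | cons y l =>
          rw [List.isChain_cons_cons] at hl
          have hy : color y = i := by
            have := hl.1
            rw [hx'] at this
            cases hc : color y <;> cases i <;> simp_all
          have h0 : UniversalProducts.derivative y (UniversalProducts.derivative x G) = 0 :=
            (hG.derivative x).derivative_eq_zero (by simp [hy])
          rw [gapSum_cons, h0,
            ih l.length (by simp only [List.length_cons]; omega) _ (hF.derivative y) l rfl
              hl.2.tail, ← zero_smul k (0 : List X → k), gapSum_smul_right]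
          simp [hx', hy]
          ring

end Color

end Words

end UniversalProducts

noncomputable section

namespace UniversalProducts

open scoped TensorProduct

/-! ### Sums over subsets as sums over splittings of lists -/

section Splits

variable {X : Type*}

/-- The list of the pairs `(l_S, [u J₀, J₁, …, Jₚ])`, where `l_S` runs through the subwords of `l`
and `J₀, …, Jₚ` are the (possibly empty) gaps of `S`. -/
def splits : List X → List X → List (List X × List (List X))
  | u, [] => [([], [u])]
  | u, x :: l => (splits [] l).map (fun p => (x :: p.1, u :: p.2)) ++ splits (u ++ [x]) l

/-- Splitting preserves the number of letters; this is what makes half-shuffle multiplication lower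
the degree. -/
theorem splits_length (u l : List X) :
    ∀ p ∈ splits u l, p.1.length + p.2.flatten.length = u.length + l.length := by
  induction l generalizing u with
  | nil => simp [splits]
  | cons x l ih =>
    intro p hp
    rw [splits, List.mem_append, List.mem_map] at hp
    rcases hp with ⟨q, hq, rfl⟩ | hp
    · have := ih _ q hq
      simp only [List.flatten_cons, List.length_append, List.length_cons, List.length_nil] at this ⊢
      omega
    · have := ih _ p hp
      simp only [List.length_append, List.length_cons, List.length_nil] at this ⊢
      omega

theorem sum_finset_fin_succ {M : Type*} [AddCommMonoid M] {n : ℕ} (G : Finset (Fin (n + 1)) → M) :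
    ∑ S, G S = ∑ T : Finset (Fin n), G (insert 0 (T.map (Fin.succEmb n))) +
      ∑ T : Finset (Fin n), G (T.map (Fin.succEmb n)) := by
  have h : (0 : Fin (n + 1)) ∉ Finset.univ.map (Fin.succEmb n) := by simp
  have h2 : (Finset.univ : Finset (Fin (n + 1))) = insert 0 (Finset.univ.map (Fin.succEmb n)) := by
    ext i; cases i using Fin.cases <;> simp
  have h3 : (Finset.univ.map (Fin.succEmb n)).powerset =
      (Finset.univ : Finset (Finset (Fin n))).map (Finset.mapEmbedding (Fin.succEmb n)).toEmbedding := by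
    ext S
    simp only [Finset.mem_powerset, Finset.subset_map_iff, Finset.mem_map]
    simp [eq_comm]
  rw [← Finset.powerset_univ, h2, Finset.sum_powerset_insert h, add_comm, h3]
  simp [Finset.sum_map]

theorem increasing_map_succ {n : ℕ} (T : Finset (Fin n)) :
    increasing (T.map (Fin.succEmb n)) = (increasing T).map Fin.succ := by
  simp [increasing, List.finRange_succ, List.filter_map, Function.comp_def]

theorem increasing_insert_zero {n : ℕ} (T : Finset (Fin n)) :
    increasing (insert 0 (T.map (Fin.succEmb n))) = 0 :: (increasing T).map Fin.succ := by
  simp [increasing, List.finRange_succ, List.filter_map, Function.comp_def]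

theorem splitOnP_map {α β : Type*} (f : α → β) (p : β → Bool) (l : List α) :
    (l.map f).splitOnP p = (l.splitOnP (p ∘ f)).map (List.map f) := by
  induction l with
  | nil => simp
  | cons x l ih =>
    rw [List.map_cons, List.splitOnP_cons_eq_if_modifyHead, List.splitOnP_cons_eq_if_modifyHead, ih]
    by_cases hx : p (f x)
    · simp [hx]
    · obtain ⟨y, L, hL⟩ := List.exists_cons_of_ne_nil (List.splitOnP_ne_nil (p ∘ f) l)
      simp [hx, hL]

theorem components_map_succ {n : ℕ} (T : Finset (Fin n)) :
    components (T.map (Fin.succEmb n)) =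
      ((components T).map (List.map Fin.succ)).modifyHead (List.cons 0) := by
  rw [components, List.finRange_succ, List.splitOnP_cons_eq_if_modifyHead, splitOnP_map]
  simp [components, Function.comp_def]

theorem components_insert_zero {n : ℕ} (T : Finset (Fin n)) :
    components (insert 0 (T.map (Fin.succEmb n))) =
      [] :: (components T).map (List.map Fin.succ) := by
  rw [components, List.finRange_succ, List.splitOnP_cons_eq_if_modifyHead, splitOnP_map]
  simp [components, Function.comp_def]

/-- Bridge from subsets to the recursion on lists. The prefix `u` is the part of the first gap
already read; it must be general, because an omitted letter extends this gap. -/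
theorem sum_splits {M : Type*} [AddCommMonoid M] {n : ℕ} (a : Fin n → X) (u : List X)
    (F : List X → List (List X) → M) :
    ∑ S, F ((increasing S).map a) (((components S).map (List.map a)).modifyHead (u ++ ·)) =
      ((splits u (List.ofFn a)).map fun p => F p.1 p.2).sum := by
  induction n generalizing u F with
  | zero =>
    simp [increasing, components, splits, Finset.univ_unique]
  | succ n ih =>
    rw [sum_finset_fin_succ, List.ofFn_succ, splits, List.map_append, List.sum_append]
    simp only [increasing_insert_zero, components_insert_zero, increasing_map_succ,
      components_map_succ]
    congr 1
    · have := ih (fun i => a i.succ) [] fun s J => F (a 0 :: s) (u :: J)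
      rw [List.map_map]
      simp only [Function.comp_def] at this ⊢
      rw [← this]
      refine Finset.sum_congr rfl fun T _ => ?_
      obtain ⟨y, L, hL⟩ := List.exists_cons_of_ne_nil
        (List.splitOnP_ne_nil (fun i => decide (i ∈ T)) (List.finRange n))
      simp [components, hL, Function.comp_def]
    · rw [← ih (fun i => a i.succ) (u ++ [a 0]) F]
      refine Finset.sum_congr rfl fun T _ => ?_
      obtain ⟨y, L, hL⟩ := List.exists_cons_of_ne_nil
        (List.splitOnP_ne_nil (fun i => decide (i ∈ T)) (List.finRange n))
      simp [components, hL, Function.comp_def]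

theorem sum_splits_nil {M : Type*} [AddCommMonoid M] {n : ℕ} (a : Fin n → X)
    (F : List X → List (List X) → M) :
    ∑ S, F ((increasing S).map a) ((components S).map (List.map a)) =
      ((splits [] (List.ofFn a)).map fun p => F p.1 p.2).sum := by
  rw [← sum_splits a [] F]
  have h : ∀ L : List (List X), L.modifyHead (fun x => x) = L := by rintro (_ | _) <;> rfl
  simp [h]

theorem sum_splits_left {M : Type*} [AddCommMonoid M] {n : ℕ} (a : Fin (n + 1) → X)
    (F : List X → List (List X) → M) :
    ∑ S with ∃ i ∈ S, i.val = 0, F ((increasing S).map a) ((components S).map (List.map a)) =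
      ((splits [] (List.ofFn fun i : Fin n => a i.succ)).map fun p =>
        F (a 0 :: p.1) ([] :: p.2)).sum := by
  rw [Finset.sum_filter, sum_finset_fin_succ]
  have h1 : ∀ T : Finset (Fin n), ∃ i ∈ insert 0 (T.map (Fin.succEmb n)), i.val = 0 :=
    fun T => ⟨0, by simp, rfl⟩
  have h2 : ∀ T : Finset (Fin n), ¬ ∃ i ∈ T.map (Fin.succEmb n), i.val = 0 := by
    rintro T ⟨i, hi, h⟩
    obtain ⟨j, -, rfl⟩ := Finset.mem_map.1 hi
    simp at h
  simp only [h1, h2, if_true, if_false, Finset.sum_const_zero, add_zero, increasing_insert_zero,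
    components_insert_zero, List.map_cons, List.map_map, List.map_nil]
  rw [← sum_splits_nil _ fun s J => F (a 0 :: s) ([] :: J)]
  simp [Function.comp_def]

theorem sum_splits_right {M : Type*} [AddCommMonoid M] {n : ℕ} (a : Fin (n + 1) → X)
    (F : List X → List (List X) → M) :
    ∑ S with ¬ ∃ i ∈ S, i.val = 0, F ((increasing S).map a) ((components S).map (List.map a)) =
      ((splits [a 0] (List.ofFn fun i : Fin n => a i.succ)).map fun p => F p.1 p.2).sum := by
  rw [Finset.sum_filter, sum_finset_fin_succ]
  have h1 : ∀ T : Finset (Fin n), ∃ i ∈ insert 0 (T.map (Fin.succEmb n)), i.val = 0 :=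
    fun T => ⟨0, by simp, rfl⟩
  have h2 : ∀ T : Finset (Fin n), ¬ ∃ i ∈ T.map (Fin.succEmb n), i.val = 0 := by
    rintro T ⟨i, hi, h⟩
    obtain ⟨j, -, rfl⟩ := Finset.mem_map.1 hi
    simp at h
  simp only [h1, h2, not_true, not_false_eq_true, if_true, if_false, Finset.sum_const_zero,
    zero_add, increasing_map_succ, components_map_succ]
  rw [← sum_splits]
  refine Finset.sum_congr rfl fun T _ => ?_
  obtain ⟨y, L, hL⟩ := List.exists_cons_of_ne_nil
    (List.splitOnP_ne_nil (fun i => decide (i ∈ T)) (List.finRange n))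
  simp [components, hL, Function.comp_def]

theorem sum_splits_gapSum {k : Type*} [CommRing k] (f g : List X → k) (u l : List X) :
    ((splits u l).map fun p => f p.1 * (p.2.map g).prod).sum =
      gapSum f g (fun s => g (u ++ s)) l := by
  induction l generalizing f u with
  | nil => simp [splits]
  | cons x l ih =>
    have h1 := ih (derivative x f) []
    have h2 := ih f (u ++ [x])
    simp only [derivative, List.nil_append] at h1
    rw [splits, List.map_append, List.sum_append, h2, List.map_map, gapSum_cons, ← h1,
      ← List.sum_map_mul_left]
    simp [Function.comp_def, mul_left_comm]

theorem subwordSum_eq_sum {k : Type*} [CommRing k] (c : X → k) (G : List X → k) (l : List X) :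
    subwordSum c G l = ∑ S : Finset (Fin l.length),
      G ((increasing S).map l.get) * ∏ i ∈ Sᶜ, c (l.get i) := by
  induction l generalizing G with
  | nil => simp [subwordSum, increasing, Finset.univ_unique, Finset.eq_empty_of_isEmpty]
  | cons x l ih =>
    have e : ∑ S : Finset (Fin (x :: l).length),
        G ((increasing S).map (x :: l).get) * ∏ i ∈ Sᶜ, c ((x :: l).get i) = _ :=
      sum_finset_fin_succ (n := l.length) _
    rw [e, subwordSum, ih, ih, Finset.mul_sum]
    congr 1
    · refine Finset.sum_congr rfl fun T _ => ?_
      have h : (insert 0 (T.map (Fin.succEmb l.length)))ᶜ = Tᶜ.map (Fin.succEmb l.length) := by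
        ext i; cases i using Fin.cases <;> simp
      rw [increasing_insert_zero, h, Finset.prod_map]
      simp [Function.comp_def, derivative]
      rfl
    · refine Finset.sum_congr rfl fun T _ => ?_
      have h : (T.map (Fin.succEmb l.length))ᶜ = insert 0 (Tᶜ.map (Fin.succEmb l.length)) := by
        ext i; cases i using Fin.cases <;> simp
      rw [increasing_map_succ, h, Finset.prod_insert (by simp), Finset.prod_map]
      simp [Function.comp_def, mul_left_comm]
      rfl

end Splits


/-! ### Locally nilpotent operators on linear forms -/

section Neumann

variable {k M J : Type*} [Field k] [AddCommGroup M] [Module k M]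

/-- The value of `P f` at `b j` depends only on the values of `f` at the elements `b j'` of smaller
degree. -/
def IsLowering (b : J → M) (deg : J → ℕ) (P : (M →ₗ[k] k) →ₗ[k] (M →ₗ[k] k)) : Prop :=
  ∀ f j, (∀ j', deg j' < deg j → f (b j') = 0) → P f (b j) = 0

variable {b : J → M} {deg : J → ℕ} {P : (M →ₗ[k] k) →ₗ[k] (M →ₗ[k] k)}

theorem IsLowering.pow_apply_eq_zero (hP : IsLowering b deg P) (g : M →ₗ[k] k) {n : ℕ} {j : J}
    (h : deg j < n) : (P ^ n) g (b j) = 0 := by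
  induction n generalizing j with
  | zero => omega
  | succ n ih =>
    rw [pow_succ', Module.End.mul_apply]
    exact hP _ _ fun j' hj' => ih (by omega)

theorem IsLowering.finite_support (hP : IsLowering b deg P)
    (hb : Submodule.span k (Set.range b) = ⊤) (g : M →ₗ[k] k) (h : M) :
    (Function.support fun n : ℕ => (P ^ n) g h).Finite := by
  have hh : h ∈ Submodule.span k (Set.range b) := hb ▸ Submodule.mem_top
  induction hh using Submodule.span_induction with
  | mem x hx =>
    obtain ⟨j, rfl⟩ := hx
    refine (Set.finite_Iic (deg j)).subset fun n hn => ?_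
    by_contra h
    exact hn (hP.pow_apply_eq_zero g (not_le.1 h))
  | zero => simp
  | add x y _ _ hx hy =>
    refine (hx.union hy).subset fun n hn => ?_
    by_contra h
    simp only [Set.mem_union, Function.mem_support, not_or, not_not] at h
    exact hn (by simp [h])
  | smul c x _ hx =>
    refine hx.subset fun n hn => ?_
    simp only [Function.mem_support, map_smul, smul_eq_mul] at hn ⊢
    exact right_ne_zero_of_mul hn

/-- The Neumann series `∑ Pⁿ g` of a locally nilpotent operator. -/
def IsLowering.neumann (hP : IsLowering b deg P) (hb : Submodule.span k (Set.range b) = ⊤)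
    (g : M →ₗ[k] k) : M →ₗ[k] k where
  toFun h := ∑ᶠ n : ℕ, (P ^ n) g h
  map_add' x y := by
    simp only [map_add]
    exact finsum_add_distrib (hP.finite_support hb g x) (hP.finite_support hb g y)
  map_smul' c x := by
    simp only [map_smul, RingHom.id_apply]
    exact (smul_finsum c _).symm

theorem IsLowering.neumann_apply (hP : IsLowering b deg P)
    (hb : Submodule.span k (Set.range b) = ⊤) (g : M →ₗ[k] k) {j : J} {N : ℕ} (h : deg j < N) :
    hP.neumann hb g (b j) = ∑ n ∈ Finset.range N, (P ^ n) g (b j) := by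
  refine finsum_eq_sum_of_support_subset _ fun n hn => ?_
  simp only [Finset.coe_range, Set.mem_Iio]
  by_contra h'
  exact hn (hP.pow_apply_eq_zero g (by omega))

theorem IsLowering.neumann_eq (hP : IsLowering b deg P)
    (hb : Submodule.span k (Set.range b) = ⊤) (g : M →ₗ[k] k) :
    hP.neumann hb g = g + P (hP.neumann hb g) := by
  refine LinearMap.ext_on_range hb fun j => ?_
  -- A partial sum agrees with the series in all degrees below that of `b j`, and `P` at `b j` sees
  -- only those.
  have h1 : P (hP.neumann hb g - ∑ n ∈ Finset.range (deg j + 1), (P ^ n) g) (b j) = 0 := by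
    refine hP _ _ fun j' hj' => ?_
    rw [LinearMap.sub_apply, hP.neumann_apply hb g (hj'.trans (Nat.lt_succ_self _)),
      LinearMap.sum_apply, sub_self]
  rw [map_sub, LinearMap.sub_apply, sub_eq_zero, map_sum, LinearMap.sum_apply] at h1
  rw [LinearMap.add_apply, h1, hP.neumann_apply hb g (show deg j < deg j + 1 + 1 by omega),
    Finset.sum_range_succ', add_comm]
  simp [pow_succ']

/-- The difference of two solutions is fixed by `P`, so it vanishes by induction on the degree. -/
theorem IsLowering.eq_of_eq_add (hP : IsLowering b deg P)
    (hb : Submodule.span k (Set.range b) = ⊤) {f f' g : M →ₗ[k] k} (h : f = g + P f)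
    (h' : f' = g + P f') : f = f' := by
  suffices H : ∀ n, ∀ j, deg j = n → (f - f') (b j) = 0 from
    LinearMap.ext_on_range hb fun j => sub_eq_zero.1 (H _ j rfl)
  intro n
  induction n using Nat.strong_induction_on with
  | _ n ih =>
    rintro j rfl
    have e : f - f' = P (f - f') := by
      rw [map_sub]
      nth_rw 1 [h, h']
      abel
    rw [e]
    exact hP _ _ fun j' hj' => ih _ hj' j' rfl

end Neumann

/-! ### Words in tensor algebras -/

section Tensor

variable (k : Type*) [Field k] {V : Type*} [AddCommGroup V] [Module k V]

/-- Such an `S` is a left ideal that contains 1. -/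
theorem tensor_eq_top {J : Type*} (b : J → V) (hb : Submodule.span k (Set.range b) = ⊤)
    (S : Submodule k (TensorAlgebra k V)) (h1 : 1 ∈ S)
    (h2 : ∀ j, ∀ s ∈ S, TensorAlgebra.ι k (b j) * s ∈ S) : S = ⊤ := by
  have h3 : ∀ v, ∀ s ∈ S, TensorAlgebra.ι k v * s ∈ S := by
    intro v s hs
    have hv : v ∈ Submodule.span k (Set.range b) := hb ▸ Submodule.mem_top
    induction hv using Submodule.span_induction with
    | mem x hx => obtain ⟨j, rfl⟩ := hx; exact h2 j s hs
    | zero => simp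
    | add x y _ _ hx hy => rw [map_add, add_mul]; exact S.add_mem hx hy
    | smul c x _ hx => rw [map_smul, smul_mul_assoc]; exact S.smul_mem c hx
  have h4 : ∀ t : TensorAlgebra k V, ∀ s ∈ S, t * s ∈ S := by
    intro t
    induction t using TensorAlgebra.induction with
    | algebraMap r => intro s hs; rw [← Algebra.smul_def]; exact S.smul_mem r hs
    | ι v => exact h3 v
    | mul x y hx hy => intro s hs; rw [mul_assoc]; exact hx _ (hy _ hs)
    | add x y hx hy => intro s hs; rw [add_mul]; exact S.add_mem (hx _ hs) (hy _ hs)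
  exact (Submodule.eq_top_iff'.2 fun t => by simpa using h4 t 1 h1)

/-- The word of a list of letters. -/
def listWord (l : List V) : TensorAlgebra k V := (l.map (TensorAlgebra.ι k)).prod

/-- The element `w₁ | ⋯ | wₘ` of the double tensor algebra for a list of words; empty words are
identified with the unit. -/
def barProd (L : List (List V)) : DoubleTensor k V := (L.map fun l => bar (listWord k l)).prod

@[simp]
theorem listWord_nil : listWord k ([] : List V) = 1 := rfl

@[simp]
theorem listWord_cons (x : V) (l : List V) :
    listWord k (x :: l) = TensorAlgebra.ι k x * listWord k l := by
  simp [listWord]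

theorem coe_toPosTensor (t : TensorAlgebra k V) : (toPosTensor t : TensorAlgebra k V) =
    t - algebraMap k _ (TensorAlgebra.algebraMapInv (R := k) t) := rfl

@[simp]
theorem toPosTensor_one : toPosTensor (1 : TensorAlgebra k V) = 0 :=
  Subtype.ext (by simp [coe_toPosTensor])

@[simp]
theorem bar_one : bar (1 : TensorAlgebra k V) = 1 := by
  simp [bar]

@[simp]
theorem barProd_nil : barProd k ([] : List (List V)) = 1 := rfl

@[simp]
theorem barProd_cons (l : List V) (L : List (List V)) :
    barProd k (l :: L) = bar (listWord k l) * barProd k L := by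
  simp [barProd]

theorem barProd_append (L L' : List (List V)) :
    barProd k (L ++ L') = barProd k L * barProd k L' := by
  simp [barProd]

theorem bar_listWord_cons (x : V) (l : List V) :
    bar (listWord k (x :: l)) = TensorAlgebra.ι k (toPosTensor (listWord k (x :: l))) := by
  simp [bar, TensorAlgebra.algebraMapInv]

theorem coe_toPosTensor_listWord_cons (x : V) (l : List V) :
    (toPosTensor (listWord k (x :: l)) : TensorAlgebra k V) = listWord k (x :: l) := by
  simp [coe_toPosTensor, TensorAlgebra.algebraMapInv]

theorem span_listWord : Submodule.span k (Set.range (listWord k (V := V))) = ⊤ := by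
  refine tensor_eq_top k (id : V → V) (by simp) _ (Submodule.subset_span ⟨[], rfl⟩) fun v s hs => ?_
  induction hs using Submodule.span_induction with
  | mem x hx =>
    obtain ⟨l, rfl⟩ := hx
    exact Submodule.subset_span ⟨v :: l, listWord_cons k v l⟩
  | zero => simp
  | add x y _ _ hx hy => rw [mul_add]; exact Submodule.add_mem _ hx hy
  | smul c x _ hx => rw [mul_smul_comm]; exact Submodule.smul_mem _ c hx

theorem span_toPosTensor :
    Submodule.span k (Set.range fun l : List V => toPosTensor (listWord k l)) = ⊤ := by
  have h : Function.Surjective (toPosTensor (k := k) (V := V)) := fun w =>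
    ⟨w, Subtype.ext (by
      have : TensorAlgebra.algebraMapInv (R := k) (w : TensorAlgebra k V) = 0 := w.2
      simp [coe_toPosTensor, this])⟩
  rw [show (fun l : List V => toPosTensor (listWord k l)) = toPosTensor ∘ listWord k from rfl,
    Set.range_comp, Submodule.span_image, span_listWord, Submodule.map_top,
    LinearMap.range_eq_top.2 h]

theorem span_barProd : Submodule.span k (Set.range (barProd k (V := V))) = ⊤ := by
  refine tensor_eq_top k _ (span_toPosTensor k (V := V)) _ (Submodule.subset_span ⟨[], rfl⟩)
    fun l s hs => ?_
  induction hs using Submodule.span_induction with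
  | mem x hx =>
    obtain ⟨L, rfl⟩ := hx
    cases l with
    | nil => simp
    | cons x l =>
      refine Submodule.subset_span ⟨(x :: l) :: L, ?_⟩
      rw [barProd_cons, bar_listWord_cons]
  | zero => simp
  | add x y _ _ hx hy => rw [mul_add]; exact Submodule.add_mem _ hx hy
  | smul c x _ hx => rw [mul_smul_comm]; exact Submodule.smul_mem _ c hx

variable {k}

theorem algHom_ext_words {C : Type*} [Ring C] [Algebra k C] {f g : DoubleTensor k V →ₐ[k] C}
    (h : ∀ l, f (bar (listWord k l)) = g (bar (listWord k l))) : f = g := by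
  have : f.toLinearMap = g.toLinearMap :=
    LinearMap.ext_on_range (span_barProd k) fun L => by
      simp only [AlgHom.toLinearMap_apply, barProd, map_list_prod, List.map_map]
      congr 1
      exact List.map_congr_left fun l _ => h l
  exact AlgHom.toLinearMap_injective this

/-! ### The coproducts on words -/

theorem word_eq_listWord {n : ℕ} (a : Fin n → V) (l : List (Fin n)) :
    word k a l = listWord k (l.map a) := by
  simp [word, listWord, Function.comp_def]

theorem barWord_eq_barProd {n : ℕ} (a : Fin n → V) (L : List (List (Fin n))) :
    barWord k a L = barProd k (L.map (List.map a)) := by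
  simp [barWord, barProd, Function.comp_def, word_eq_listWord]

theorem listWord_ofFn {n : ℕ} (a : Fin n → V) :
    listWord k (List.ofFn a) = TensorAlgebra.tprod k V n a := by
  rw [TensorAlgebra.tprod_apply, listWord, List.map_ofFn]
  rfl

/-- The tensor `w ⊗ (w₁ | ⋯ | wₘ)` associated with a splitting of a list. -/
abbrev splitTensor (p : List V × List (List V)) : DoubleTensor k V ⊗[k] DoubleTensor k V :=
  bar (listWord k p.1) ⊗ₜ[k] barProd k p.2

theorem splitTerm_apply {n : ℕ} (S : Finset (Fin n)) (a : Fin n → V) :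
    splitTerm (k := k) S a =
      splitTensor ((increasing S).map a, (components S).map (List.map a)) := by
  rw [splitTensor, ← word_eq_listWord, ← barWord_eq_barProd]
  rfl

theorem coproductWord_listWord (l : List V) :
    coproductWord (listWord k l) = ((splits [] l).map (splitTensor (k := k))).sum := by
  obtain ⟨n, a, rfl⟩ : ∃ n, ∃ a : Fin n → V, l = List.ofFn a := ⟨_, l.get, (List.ofFn_get l).symm⟩
  rw [← sum_splits_nil a fun s J => splitTensor (k := k) (s, J), listWord_ofFn, coproductWord,
    ofMultilinear_tprod, sum_apply]
  exact Finset.sum_congr rfl fun S _ => splitTerm_apply S a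

theorem leftCoproductWord_listWord (x : V) (l : List V) :
    leftCoproductWord (listWord k (x :: l)) =
      ((splits [] l).map fun p => splitTensor (k := k) (x :: p.1, p.2)).sum := by
  obtain ⟨n, a, rfl⟩ : ∃ n, ∃ a : Fin n → V, l = List.ofFn a := ⟨_, l.get, (List.ofFn_get l).symm⟩
  have h := sum_splits_left (Fin.cons x a : Fin (n + 1) → V)
    fun s J => splitTensor (k := k) (s, J)
  simp only [Fin.cons_zero, Fin.cons_succ] at h
  have e : ∀ s J, splitTensor (k := k) (s, ([] : List V) :: J) = splitTensor (s, J) := by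
    simp [splitTensor]
  simp only [e] at h
  rw [← h, show x :: List.ofFn a = List.ofFn (Fin.cons x a : Fin (n + 1) → V) by
    rw [List.ofFn_succ]; simp, listWord_ofFn, leftCoproductWord, ofMultilinear_tprod, sum_apply]
  exact Finset.sum_congr rfl fun S _ => splitTerm_apply S _

theorem rightCoproductWord_listWord (x : V) (l : List V) :
    rightCoproductWord (listWord k (x :: l)) = ((splits [x] l).map (splitTensor (k := k))).sum := by
  obtain ⟨n, a, rfl⟩ : ∃ n, ∃ a : Fin n → V, l = List.ofFn a := ⟨_, l.get, (List.ofFn_get l).symm⟩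
  have h := sum_splits_right (Fin.cons x a : Fin (n + 1) → V)
    fun s J => splitTensor (k := k) (s, J)
  simp only [Fin.cons_zero, Fin.cons_succ] at h
  rw [← h, show x :: List.ofFn a = List.ofFn (Fin.cons x a : Fin (n + 1) → V) by
    rw [List.ofFn_succ]; simp, listWord_ofFn, rightCoproductWord, ofMultilinear_tprod, sum_apply]
  exact Finset.sum_congr rfl fun S _ => splitTerm_apply S _

theorem coproduct_bar (l : List V) :
    coproduct k V (bar (listWord k l)) = ((splits [] l).map (splitTensor (k := k))).sum := by
  cases l with
  | nil => simp [splits, splitTensor, Algebra.TensorProduct.one_def]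
  | cons x l =>
    rw [bar_listWord_cons, coproduct, TensorAlgebra.lift_ι_apply, LinearMap.comp_apply,
      Submodule.subtype_apply, coe_toPosTensor_listWord_cons, coproductWord_listWord]

theorem halfExtend_one (D : TensorAlgebra k V →ₗ[k] DoubleTensor k V ⊗[k] DoubleTensor k V) :
    halfExtend k V D 1 = 0 := by
  have h : (1 : DoubleTensor k V) = TensorAlgebra.tprod k (PosTensor k V) 0 Fin.elim0 := by
    rw [TensorAlgebra.tprod_apply]; simp
  rw [h, halfExtend, ofMultilinear_tprod]
  simp

/-- This recursion on the first bar factor replaces the multilinear definition of the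
half-coproducts from here on. -/
theorem halfExtend_ι_mul (D : TensorAlgebra k V →ₗ[k] DoubleTensor k V ⊗[k] DoubleTensor k V)
    (w : PosTensor k V) (h : DoubleTensor k V) :
    halfExtend k V D (TensorAlgebra.ι k w * h) = D w * coproduct k V h := by
  have : halfExtend k V D ∘ₗ LinearMap.mulLeft k (TensorAlgebra.ι k w) =
      LinearMap.mulLeft k (D w) ∘ₗ (coproduct k V).toLinearMap := by
    refine LinearMap.ext_on_range (span_listWord k) fun L => ?_
    have h1 : TensorAlgebra.ι k w * listWord k L =
        TensorAlgebra.tprod k (PosTensor k V) (L.length + 1) (Fin.cons w L.get) := by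
      rw [← listWord_ofFn, List.ofFn_succ]
      simp
    simp only [LinearMap.comp_apply, LinearMap.mulLeft_apply, AlgHom.toLinearMap_apply]
    rw [h1, halfExtend, ofMultilinear_tprod, if_neg (Nat.succ_ne_zero _),
      MultilinearMap.compLinearMap_apply, MultilinearMap.mkPiAlgebraFin_apply, List.ofFn_succ,
      List.prod_cons]
    congr 1
    rw [listWord, map_list_prod, List.map_map, coproduct]
    congr 1
    conv_rhs => rw [← List.ofFn_get L, List.map_ofFn]
    congr 1
    funext i
    simp
  exact LinearMap.congr_fun this h

theorem leftCoproduct_bar_mul (x : V) (l : List V) (h : DoubleTensor k V) :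
    leftCoproduct k V (bar (listWord k (x :: l)) * h) =
      ((splits [] l).map fun p => splitTensor (k := k) (x :: p.1, p.2)).sum * coproduct k V h := by
  rw [bar_listWord_cons, leftCoproduct, halfExtend_ι_mul, coe_toPosTensor_listWord_cons,
    leftCoproductWord_listWord]

theorem rightCoproduct_bar_mul (x : V) (l : List V) (h : DoubleTensor k V) :
    rightCoproduct k V (bar (listWord k (x :: l)) * h) =
      ((splits [x] l).map (splitTensor (k := k))).sum * coproduct k V h := by
  rw [bar_listWord_cons, rightCoproduct, halfExtend_ι_mul, coe_toPosTensor_listWord_cons,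
    rightCoproductWord_listWord]

end Tensor


/-! ### Half-shuffle exponentials and cumulants -/

section Exponential

variable {k : Type*} [Field k] {V : Type*} [AddCommGroup V] [Module k V]

variable (k V) in
/-- The augmentation as a homomorphism of algebras. -/
abbrev augmentationHom : DoubleTensor k V →ₐ[k] k :=
  TensorAlgebra.algebraMapInv (R := k) (M := PosTensor k V)

@[simp]
theorem augmentation_one : augmentation k V 1 = 1 := map_one (augmentationHom k V)

@[simp]
theorem augmentation_mul (a b : DoubleTensor k V) :
    augmentation k V (a * b) = augmentation k V a * augmentation k V b :=
  map_mul (augmentationHom k V) a b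

@[simp]
theorem augmentation_bar_cons (x : V) (l : List V) :
    augmentation k V (bar (listWord k (x :: l))) = 0 := by
  rw [bar_listWord_cons, augmentation]
  simp [TensorAlgebra.algebraMapInv]

variable (k V) in
/-- The map `a ⊗ b ↦ e(a) b`. -/
def leftContraction : DoubleTensor k V ⊗[k] DoubleTensor k V →ₐ[k] DoubleTensor k V :=
  (Algebra.TensorProduct.lid k _).toAlgHom.comp
    (Algebra.TensorProduct.map (augmentationHom k V) (AlgHom.id k _))

variable (k V) in
/-- The map `a ⊗ b ↦ e(b) a`. -/
def rightContraction : DoubleTensor k V ⊗[k] DoubleTensor k V →ₐ[k] DoubleTensor k V :=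
  (Algebra.TensorProduct.rid k k _).toAlgHom.comp
    (Algebra.TensorProduct.map (AlgHom.id k _) (augmentationHom k V))

@[simp]
theorem leftContraction_tmul (a b : DoubleTensor k V) :
    leftContraction k V (a ⊗ₜ b) = augmentation k V a • b := by
  simp [leftContraction, augmentation]

@[simp]
theorem rightContraction_tmul (a b : DoubleTensor k V) :
    rightContraction k V (a ⊗ₜ b) = augmentation k V b • a := by
  simp [rightContraction, augmentation]

/-- Only the empty subword survives the augmentation, and its single gap is the whole word. -/
theorem sum_splits_augmentation_left (u l : List V) :
    ((splits u l).map fun p => augmentation k V (bar (listWord k p.1)) • barProd k p.2).sum =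
      bar (listWord k (u ++ l)) := by
  induction l generalizing u with
  | nil => simp [splits]
  | cons x l ih =>
    rw [splits, List.map_append, List.sum_append, ih, List.map_map]
    simp only [Function.comp_def, augmentation_bar_cons, zero_smul]
    simp

theorem augmentation_barProd_of_mem_splits (x : V) (u l : List V) :
    ∀ p ∈ splits (x :: u) l, augmentation k V (barProd k p.2) = 0 := by
  induction l generalizing u with
  | nil =>
    intro p hp
    obtain rfl := List.mem_singleton.1 hp
    rw [barProd_cons, augmentation_mul, augmentation_bar_cons, zero_mul]
  | cons y l ih =>
    intro p hp
    rw [splits, List.mem_append, List.mem_map] at hp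
    rcases hp with ⟨q, -, rfl⟩ | hp
    · rw [barProd_cons, augmentation_mul, augmentation_bar_cons, zero_mul]
    · exact ih _ p hp

/-- Any nonempty gap is killed by the augmentation, so only the full subword remains. -/
theorem sum_splits_augmentation_right {M : Type*} [AddCommGroup M] [Module k M]
    (G : List V → M) (l : List V) :
    ((splits [] l).map fun p => augmentation k V (barProd k p.2) • G p.1).sum = G l := by
  induction l generalizing G with
  | nil => simp [splits]
  | cons x l ih =>
    have h : ((splits [x] l).map fun p => augmentation k V (barProd k p.2) • G p.1).sum = 0 := by
      refine List.sum_eq_zero fun y hy => ?_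
      obtain ⟨p, hp, rfl⟩ := List.mem_map.1 hy
      rw [augmentation_barProd_of_mem_splits x [] l p hp, zero_smul]
    rw [splits, List.map_append, List.sum_append, List.nil_append, h, add_zero, List.map_map,
      ← ih fun s => G (x :: s)]
    simp [Function.comp_def]

theorem leftContraction_coproduct (h : DoubleTensor k V) :
    leftContraction k V (coproduct k V h) = h := by
  have : (leftContraction k V).comp (coproduct k V) = AlgHom.id k _ :=
    algHom_ext_words fun l => by
      simp only [AlgHom.comp_apply, coproduct_bar, map_list_sum, List.map_map, Function.comp_def,
        splitTensor, leftContraction_tmul, AlgHom.id_apply]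
      exact sum_splits_augmentation_left [] l
  exact DFunLike.congr_fun this h

theorem rightContraction_coproduct (h : DoubleTensor k V) :
    rightContraction k V (coproduct k V h) = h := by
  have : (rightContraction k V).comp (coproduct k V) = AlgHom.id k _ :=
    algHom_ext_words fun l => by
      simp only [AlgHom.comp_apply, coproduct_bar, map_list_sum, List.map_map, Function.comp_def,
        splitTensor, rightContraction_tmul, AlgHom.id_apply]
      exact sum_splits_augmentation_right (fun s => bar (listWord k s)) l
  exact DFunLike.congr_fun this h

/-- Apply the definition to a - e(a) and b - e(b), which lie in the augmentation ideal. -/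
theorem IsInfinitesimal.mul_apply {α : DoubleTensor k V →ₗ[k] k} (hα : IsInfinitesimal α)
    (a b : DoubleTensor k V) :
    α (a * b) = augmentation k V b * α a + augmentation k V a * α b := by
  have h : ∀ c : DoubleTensor k V, augmentation k V (c - augmentation k V c • 1) = 0 := by
    intro c; simp
  have := hα.2 _ _ (h a) (h b)
  simp only [sub_mul, mul_sub, map_sub, smul_mul_assoc, mul_smul_comm, one_mul, mul_one, map_smul,
    hα.1, smul_eq_mul, mul_zero] at this
  linear_combination this

theorem IsInfinitesimal.add {α β : DoubleTensor k V →ₗ[k] k} (hα : IsInfinitesimal α)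
    (hβ : IsInfinitesimal β) : IsInfinitesimal (α + β) :=
  ⟨by simp [hα.1, hβ.1], fun a b ha hb => by simp [hα.2 a b ha hb, hβ.2 a b ha hb]⟩

/-- As `α` is a derivation along the augmentation and `t` is already in the augmentation ideal, `α`
sees the left factors of `T` only through their augmentation. For `T` a coproduct, the counit
property then collapses `T`. -/
theorem mul'_map_left {α g : DoubleTensor k V →ₗ[k] k} (hα : IsInfinitesimal α)
    {t : DoubleTensor k V} (ht : augmentation k V t = 0) (b : DoubleTensor k V)
    (T : DoubleTensor k V ⊗[k] DoubleTensor k V) :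
    LinearMap.mul' k k (TensorProduct.map α g ((t ⊗ₜ b) * T)) =
      α t * g (b * leftContraction k V T) := by
  induction T using TensorProduct.induction_on with
  | zero => simp
  | add x y hx hy => simp only [mul_add, map_add, hx, hy]
  | tmul x y => simp [hα.mul_apply, ht]; ring

theorem mul'_map_right {α g : DoubleTensor k V →ₗ[k] k} (hα : IsInfinitesimal α)
    {t : DoubleTensor k V} (ht : augmentation k V t = 0) (b : DoubleTensor k V)
    (T : DoubleTensor k V ⊗[k] DoubleTensor k V) :
    LinearMap.mul' k k (TensorProduct.map g α ((b ⊗ₜ t) * T)) =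
      g (b * rightContraction k V T) * α t := by
  induction T using TensorProduct.induction_on with
  | zero => simp
  | add x y hx hy => simp only [mul_add, add_mul, map_add, hx, hy]
  | tmul x y => simp [hα.mul_apply, ht]; ring

theorem leftShuffle_one (f g : DoubleTensor k V →ₗ[k] k) : leftShuffle f g 1 = 0 := by
  simp [leftShuffle, leftCoproduct, halfExtend_one]

theorem rightShuffle_one (f g : DoubleTensor k V →ₗ[k] k) : rightShuffle f g 1 = 0 := by
  simp [rightShuffle, rightCoproduct, halfExtend_one]

theorem leftShuffle_bar_mul {α : DoubleTensor k V →ₗ[k] k} (hα : IsInfinitesimal α)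
    (g : DoubleTensor k V →ₗ[k] k) (x : V) (l : List V) (h : DoubleTensor k V) :
    leftShuffle α g (bar (listWord k (x :: l)) * h) =
      ((splits [] l).map fun p =>
        α (bar (listWord k (x :: p.1))) * g (barProd k p.2 * h)).sum := by
  simp only [leftShuffle, LinearMap.comp_apply]
  rw [leftCoproduct_bar_mul, ← List.sum_map_mul_right, map_list_sum, map_list_sum, List.map_map,
    List.map_map]
  congr 1
  refine List.map_congr_left fun p _ => ?_
  simp only [Function.comp_apply, splitTensor]
  rw [mul'_map_left hα (augmentation_bar_cons _ _), leftContraction_coproduct]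

/-- The values of a linear form on words. -/
def onWords (f : DoubleTensor k V →ₗ[k] k) (l : List V) : k := f (bar (listWord k l))

theorem IsInfinitesimal.barProd_cons {β : DoubleTensor k V →ₗ[k] k} (hβ : IsInfinitesimal β)
    (x : V) (u : List V) (L : List (List V)) :
    β (barProd k ((x :: u) :: L)) = augmentation k V (barProd k L) * onWords β (x :: u) := by
  rw [UniversalProducts.barProd_cons, hβ.mul_apply, augmentation_bar_cons, zero_mul, add_zero]
  rfl

/-- An infinitesimal character vanishes on bar products of two nonempty words. The first gap is
nonempty already, so it must be the only nonempty one: it is an initial segment and the subword is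
the complementary final segment. -/
theorem sum_splits_infinitesimal {β : DoubleTensor k V →ₗ[k] k} (hβ : IsInfinitesimal β)
    (G : List V → k) (x : V) (u l : List V) :
    ((splits (x :: u) l).map fun p => G p.1 * β (barProd k p.2)).sum =
      cauchy (fun s => onWords β (x :: u ++ s)) G l := by
  induction l generalizing u with
  | nil =>
    simp [splits, onWords, mul_comm]
  | cons y l ih =>
    rw [splits, List.map_append, List.sum_append, List.cons_append, ih, List.map_map, cauchy_cons]
    congr 1
    · simp only [Function.comp_def, hβ.barProd_cons]
      rw [← sum_splits_augmentation_right (k := k) (fun s => G (y :: s)) l,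
        ← List.sum_map_mul_left]
      congr 1
      refine List.map_congr_left fun p _ => ?_
      simp only [List.append_nil, smul_eq_mul]
      ring
    · congr 1
      funext s
      simp [derivative]

theorem rightShuffle_bar_mul {β : DoubleTensor k V →ₗ[k] k} (hβ : IsInfinitesimal β)
    (g : DoubleTensor k V →ₗ[k] k) (x : V) (l : List V) (h : DoubleTensor k V) :
    rightShuffle g β (bar (listWord k (x :: l)) * h) =
      cauchy (derivative x (onWords β)) (fun s => g (bar (listWord k s) * h)) l := by
  have e := sum_splits_infinitesimal hβ (fun s => g (bar (listWord k s) * h)) x [] l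
  rw [show derivative x (onWords β) = fun s => onWords β ([x] ++ s) from rfl, ← e]
  simp only [rightShuffle, LinearMap.comp_apply]
  rw [rightCoproduct_bar_mul, ← List.sum_map_mul_right, map_list_sum, map_list_sum, List.map_map,
    List.map_map]
  congr 1
  refine List.map_congr_left fun p hp => ?_
  simp only [Function.comp_apply, splitTensor]
  rw [mul'_map_right hβ (augmentation_barProd_of_mem_splits x [] l p hp), rightContraction_coproduct]

/-! ### Half-shuffle operators and their fixed points -/

/-- The total degree of a product of words. -/
def totalLength (L : List (List V)) : ℕ := L.flatten.length

/-- Left half-shuffle multiplication by `α`, as an operator on linear forms. -/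
def leftOperator (α : DoubleTensor k V →ₗ[k] k) :
    (DoubleTensor k V →ₗ[k] k) →ₗ[k] (DoubleTensor k V →ₗ[k] k) where
  toFun g := leftShuffle α g
  map_add' g g' := by
    simp [leftShuffle, TensorProduct.map_add_right, LinearMap.add_comp, LinearMap.comp_add]
  map_smul' c g := by
    simp [leftShuffle, TensorProduct.map_smul_right, LinearMap.smul_comp, LinearMap.comp_smul]

/-- Right half-shuffle multiplication by `β`, as an operator on linear forms. -/
def rightOperator (β : DoubleTensor k V →ₗ[k] k) :
    (DoubleTensor k V →ₗ[k] k) →ₗ[k] (DoubleTensor k V →ₗ[k] k) where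
  toFun g := rightShuffle g β
  map_add' g g' := by
    simp [rightShuffle, TensorProduct.map_add_left, LinearMap.add_comp, LinearMap.comp_add]
  map_smul' c g := by
    simp [rightShuffle, TensorProduct.map_smul_left, LinearMap.smul_comp, LinearMap.comp_smul]

@[simp]
theorem leftOperator_apply (α g : DoubleTensor k V →ₗ[k] k) :
    leftOperator α g = leftShuffle α g := rfl

@[simp]
theorem rightOperator_apply (β g : DoubleTensor k V →ₗ[k] k) :
    rightOperator β g = rightShuffle g β := rfl

theorem leftPow_eq (α : DoubleTensor k V →ₗ[k] k) (n : ℕ) :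
    leftPow α n = (leftOperator α ^ n) (augmentation k V) := by
  induction n with
  | zero => rfl
  | succ n ih => rw [leftPow, ih, pow_succ']; rfl

theorem rightPow_eq (β : DoubleTensor k V →ₗ[k] k) (n : ℕ) :
    rightPow β n = (rightOperator β ^ n) (augmentation k V) := by
  induction n with
  | zero => rfl
  | succ n ih => rw [rightPow, ih, pow_succ']; rfl

theorem barProd_induction {p : List (List V) → Prop} (h0 : p [])
    (h1 : ∀ L, p L → p ([] :: L)) (h2 : ∀ x l L, p ((x :: l) :: L)) (L : List (List V)) : p L := by
  induction L with
  | nil => exact h0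
  | cons l L ih =>
    cases l with
    | nil => exact h1 L ih
    | cons x l => exact h2 x l L

theorem isLowering_leftOperator {α : DoubleTensor k V →ₗ[k] k} (hα : IsInfinitesimal α) :
    IsLowering (barProd k) totalLength (leftOperator α) := by
  intro f L hL
  induction L using barProd_induction with
  | h0 => exact leftShuffle_one α f
  | h1 L ih =>
    rw [barProd_cons, listWord_nil, bar_one, one_mul]
    exact ih hL
  | h2 x l L =>
    rw [barProd_cons]
    refine (leftShuffle_bar_mul hα f x l _).trans (List.sum_eq_zero fun y hy => ?_)
    obtain ⟨p, hp, rfl⟩ := List.mem_map.1 hy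
    -- At least the letter `x` has gone to the factor seen by `α`, so `f` is evaluated in smaller
    -- degree.
    rw [← barProd_append, hL, mul_zero]
    have := splits_length _ _ p hp
    simp only [totalLength, List.flatten_append, List.flatten_cons, List.length_append,
      List.length_cons, List.length_nil] at this ⊢
    omega

theorem isLowering_rightOperator {β : DoubleTensor k V →ₗ[k] k} (hβ : IsInfinitesimal β) :
    IsLowering (barProd k) totalLength (rightOperator β) := by
  intro f L hL
  induction L using barProd_induction with
  | h0 => exact rightShuffle_one f β
  | h1 L ih =>
    rw [barProd_cons, listWord_nil, bar_one, one_mul]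
    exact ih hL
  | h2 x l L =>
    rw [barProd_cons]
    refine (rightShuffle_bar_mul hβ f x l _).trans (cauchy_eq_zero_of_right _ _ _ fun s hs => ?_)
    rw [← barProd_cons, hL]
    simp only [totalLength, List.flatten_cons, List.length_append, List.length_cons]
    omega

/-- The augmentation and `P` together fix the value 1 at the unit, and the augmentation vanishes on
everything that starts with a nonempty word. -/
theorem eq_of_onWords {P : (DoubleTensor k V →ₗ[k] k) →ₗ[k] (DoubleTensor k V →ₗ[k] k)}
    (hP1 : ∀ f, P f 1 = 0) {Ψ : DoubleTensor k V →ₐ[k] k} :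
    Ψ.toLinearMap = augmentation k V + P Ψ.toLinearMap ↔
      ∀ x l L, Ψ (bar (listWord k (x :: l)) * barProd k L) =
        P Ψ.toLinearMap (bar (listWord k (x :: l)) * barProd k L) := by
  constructor
  · intro h x l L
    rw [← AlgHom.toLinearMap_apply, h, LinearMap.add_apply, augmentation_mul,
      augmentation_bar_cons, zero_mul, zero_add, ← h]
  · intro h
    refine LinearMap.ext_on_range (span_barProd k) fun L => ?_
    induction L using barProd_induction with
    | h0 => simp [hP1]
    | h1 L ih => rwa [barProd_cons, listWord_nil, bar_one, one_mul]
    | h2 x l L =>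
      rw [barProd_cons, LinearMap.add_apply, ← h, augmentation_mul, augmentation_bar_cons, zero_mul,
        zero_add, AlgHom.toLinearMap_apply]

theorem map_barProd_mul (Ψ : DoubleTensor k V →ₐ[k] k) (L : List (List V))
    (h : DoubleTensor k V) :
    Ψ (barProd k L * h) = (L.map (onWords Ψ.toLinearMap)).prod * Ψ h := by
  rw [map_mul, barProd, map_list_prod, List.map_map]
  rfl

theorem leftShuffle_character {α : DoubleTensor k V →ₗ[k] k} (hα : IsInfinitesimal α)
    (Ψ : DoubleTensor k V →ₐ[k] k) (x : V) (l : List V) (h : DoubleTensor k V) :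
    leftShuffle α Ψ.toLinearMap (bar (listWord k (x :: l)) * h) =
      gapSum (derivative x (onWords α)) (onWords Ψ.toLinearMap) (onWords Ψ.toLinearMap) l * Ψ h := by
  rw [leftShuffle_bar_mul hα]
  have := sum_splits_gapSum (derivative x (onWords α)) (onWords Ψ.toLinearMap) [] l
  simp only [List.nil_append] at this
  rw [show onWords Ψ.toLinearMap = fun s => onWords Ψ.toLinearMap s from rfl, ← this,
    ← List.sum_map_mul_right]
  congr 1
  refine List.map_congr_left fun p _ => ?_
  rw [AlgHom.toLinearMap_apply, map_barProd_mul, ← mul_assoc]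
  rfl

theorem rightShuffle_character {β : DoubleTensor k V →ₗ[k] k} (hβ : IsInfinitesimal β)
    (Ψ : DoubleTensor k V →ₐ[k] k) (x : V) (l : List V) (h : DoubleTensor k V) :
    rightShuffle Ψ.toLinearMap β (bar (listWord k (x :: l)) * h) =
      cauchy (derivative x (onWords β)) (onWords Ψ.toLinearMap) l * Ψ h := by
  rw [rightShuffle_bar_mul hβ]
  have : (fun s => Ψ.toLinearMap (bar (listWord k s) * h)) = Ψ h • onWords Ψ.toLinearMap := by
    funext s
    simp [onWords, mul_comm]
  rw [this, cauchy_smul_right, Pi.smul_apply, smul_eq_mul, mul_comm]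

@[simp]
theorem onWords_nil (f : DoubleTensor k V →ₗ[k] k) : onWords f [] = f 1 := by
  simp [onWords]

/-- By multiplicativity of `Ψ`, both sides of the equation at w₁ | h carry the factor Ψ(h). What
remains is the equation on the single word w₁, which is the free moment-cumulant recursion. -/
theorem eq_add_leftOperator_iff {α : DoubleTensor k V →ₗ[k] k} (hα : IsInfinitesimal α)
    {Ψ : DoubleTensor k V →ₐ[k] k} :
    Ψ.toLinearMap = augmentation k V + leftOperator α Ψ.toLinearMap ↔
      IsLeftCumulant (onWords α) (onWords Ψ.toLinearMap) := by
  rw [eq_of_onWords (leftShuffle_one α)]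
  simp only [leftOperator_apply, leftShuffle_character hα, map_mul]
  refine ⟨fun h => ⟨by simp, by simp [hα.1], fun x => funext fun l => ?_⟩, fun h x l L => ?_⟩
  · simpa [derivative, onWords] using h x l []
  · rw [← h.2.2 x]; rfl

theorem eq_add_rightOperator_iff {β : DoubleTensor k V →ₗ[k] k} (hβ : IsInfinitesimal β)
    {Ψ : DoubleTensor k V →ₐ[k] k} :
    Ψ.toLinearMap = augmentation k V + rightOperator β Ψ.toLinearMap ↔
      IsRightCumulant (onWords β) (onWords Ψ.toLinearMap) := by
  rw [eq_of_onWords fun f => rightShuffle_one f β]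
  simp only [rightOperator_apply, rightShuffle_character hβ, map_mul]
  refine ⟨fun h => ⟨by simp, by simp [hβ.1], fun x => funext fun l => ?_⟩, fun h x l L => ?_⟩
  · simpa [derivative, onWords] using h x l []
  · rw [← h.2.2 x]; rfl

/-- The solution of a fixed point equation that is compatible with multiplication from the right is
a character. -/
theorem exists_character {P : (DoubleTensor k V →ₗ[k] k) →ₗ[k] (DoubleTensor k V →ₗ[k] k)}
    (hP : IsLowering (barProd k) totalLength P) (hP1 : ∀ f, P f 1 = 0)
    (hmul : ∀ f h x l L, P f (bar (listWord k (x :: l)) * barProd k L * h) =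
      P (f ∘ₗ LinearMap.mulRight k h) (bar (listWord k (x :: l)) * barProd k L)) :
    ∃ Ψ : DoubleTensor k V →ₐ[k] k,
      Ψ.toLinearMap = hP.neumann (span_barProd k) (augmentation k V) := by
  set E := hP.neumann (span_barProd k) (augmentation k V) with hE
  have h0 : E = augmentation k V + P E := hP.neumann_eq _ _
  have h1 : E 1 = 1 := by rw [h0]; simp [hP1]
  refine ⟨AlgHom.ofLinearMap E h1 fun a b => ?_, by ext; rfl⟩
  -- Both E(· b) and E(b) E satisfy the fixed point equation away from 1 and agree at 1. Their
  -- difference is therefore fixed by `P` and vanishes by uniqueness.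
  have key : E ∘ₗ LinearMap.mulRight k b - E b • E = 0 := by
    refine hP.eq_of_eq_add (span_barProd k) (g := 0) ?_ (by simp)
    refine LinearMap.ext_on_range (span_barProd k) fun L => ?_
    induction L using barProd_induction with
    | h0 => simp [h1, hP1]
    | h1 L ih => rwa [barProd_cons, listWord_nil, bar_one, one_mul]
    | h2 x l L =>
      have e : ∀ h, E (bar (listWord k (x :: l)) * h) = P E (bar (listWord k (x :: l)) * h) := by
        intro h
        nth_rw 1 [h0]
        simp only [LinearMap.add_apply, augmentation_mul, augmentation_bar_cons, zero_mul, zero_add]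
      simp only [barProd_cons, LinearMap.sub_apply, LinearMap.comp_apply, LinearMap.mulRight_apply,
        LinearMap.smul_apply, map_sub, map_smul, zero_add]
      rw [← hmul, ← e, mul_assoc, e]
  have := LinearMap.congr_fun key a
  simp only [LinearMap.sub_apply, LinearMap.comp_apply, LinearMap.mulRight_apply,
    LinearMap.smul_apply, smul_eq_mul, LinearMap.zero_apply] at this
  rw [sub_eq_zero.1 this, mul_comm]

theorem coe_neumann_leftOperator {α : DoubleTensor k V →ₗ[k] k} (hα : IsInfinitesimal α) :
    ⇑((isLowering_leftOperator hα).neumann (span_barProd k) (augmentation k V)) = leftExp α := by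
  funext h
  simp only [leftExp, leftPow_eq]
  rfl

theorem coe_neumann_rightOperator {β : DoubleTensor k V →ₗ[k] k} (hβ : IsInfinitesimal β) :
    ⇑((isLowering_rightOperator hβ).neumann (span_barProd k) (augmentation k V)) = rightExp β := by
  funext h
  simp only [rightExp, rightPow_eq]
  rfl

theorem exists_eq_leftExp {α : DoubleTensor k V →ₗ[k] k} (hα : IsInfinitesimal α) :
    ∃ Ψ : DoubleTensor k V →ₐ[k] k, ⇑Ψ = leftExp α := by
  obtain ⟨Ψ, hΨ⟩ := exists_character (isLowering_leftOperator hα) (leftShuffle_one α)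
    fun f h x l L => by
      rw [leftOperator_apply, leftOperator_apply, mul_assoc, leftShuffle_bar_mul hα, leftShuffle_bar_mul hα]
      simp [mul_assoc]
  exact ⟨Ψ, by rw [← coe_neumann_leftOperator hα, ← hΨ]; rfl⟩

theorem exists_eq_rightExp {β : DoubleTensor k V →ₗ[k] k} (hβ : IsInfinitesimal β) :
    ∃ Ψ : DoubleTensor k V →ₐ[k] k, ⇑Ψ = rightExp β := by
  obtain ⟨Ψ, hΨ⟩ := exists_character (isLowering_rightOperator hβ)
    (fun f => rightShuffle_one f β) fun f h x l L => by
      rw [rightOperator_apply, rightOperator_apply, mul_assoc, rightShuffle_bar_mul hβ, rightShuffle_bar_mul hβ]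
      simp [mul_assoc]
  exact ⟨Ψ, by rw [← coe_neumann_rightOperator hβ, ← hΨ]; rfl⟩

theorem eq_leftExp_iff {α : DoubleTensor k V →ₗ[k] k} (hα : IsInfinitesimal α)
    {Ψ : DoubleTensor k V →ₐ[k] k} :
    ⇑Ψ = leftExp α ↔ IsLeftCumulant (onWords α) (onWords Ψ.toLinearMap) := by
  rw [← eq_add_leftOperator_iff hα, ← coe_neumann_leftOperator hα]
  have h := (isLowering_leftOperator hα).neumann_eq (span_barProd k) (augmentation k V)
  refine ⟨fun e => ?_, fun e => ?_⟩
  · have e' : Ψ.toLinearMap = (isLowering_leftOperator hα).neumann (span_barProd k)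
        (augmentation k V) := DFunLike.coe_injective e
    rwa [e']
  · exact congrArg DFunLike.coe ((isLowering_leftOperator hα).eq_of_eq_add (span_barProd k) e h)

theorem eq_rightExp_iff {β : DoubleTensor k V →ₗ[k] k} (hβ : IsInfinitesimal β)
    {Ψ : DoubleTensor k V →ₐ[k] k} :
    ⇑Ψ = rightExp β ↔ IsRightCumulant (onWords β) (onWords Ψ.toLinearMap) := by
  rw [← eq_add_rightOperator_iff hβ, ← coe_neumann_rightOperator hβ]
  have h := (isLowering_rightOperator hβ).neumann_eq (span_barProd k) (augmentation k V)
  refine ⟨fun e => ?_, fun e => ?_⟩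
  · have e' : Ψ.toLinearMap = (isLowering_rightOperator hβ).neumann (span_barProd k)
        (augmentation k V) := DFunLike.coe_injective e
    rwa [e']
  · exact congrArg DFunLike.coe ((isLowering_rightOperator hβ).eq_of_eq_add (span_barProd k) e h)

/-! ### Half-shuffle logarithms -/

/-- The inverse of `ι` is the second component of an algebra map to the trivial square-zero
extension of `k` by `M` whose first component is the augmentation; hence it is a derivation along
the augmentation. -/
theorem ιInv_mul (M : Type*) [AddCommGroup M] [Module k M] (a b : TensorAlgebra k M) :
    TensorAlgebra.ιInv (R := k) (a * b) =
      TensorAlgebra.algebraMapInv (R := k) a • TensorAlgebra.ιInv (R := k) b +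
        TensorAlgebra.algebraMapInv (R := k) b • TensorAlgebra.ιInv (R := k) a := by
  let _ : Module kᵐᵒᵖ M := Module.compHom _ ((RingHom.id k).fromOpposite mul_comm)
  have : IsCentralScalar k M := ⟨fun r m => rfl⟩
  have h : (TrivSqZeroExt.fstHom k k M).comp TensorAlgebra.toTrivSqZeroExt =
      TensorAlgebra.algebraMapInv := by
    ext; simp [TensorAlgebra.algebraMapInv]
  rw [← h]
  simp [TensorAlgebra.ιInv]

variable (k V) in
/-- The infinitesimal character with given values on `T(V)`. -/
def infinitesimal : (PosTensor k V →ₗ[k] k) →ₗ[k] (DoubleTensor k V →ₗ[k] k) :=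
  LinearMap.lcomp k k TensorAlgebra.ιInv

theorem isInfinitesimal_infinitesimal (f : PosTensor k V →ₗ[k] k) :
    IsInfinitesimal (infinitesimal k V f) := by
  constructor
  · have h := ιInv_mul (k := k) (PosTensor k V) 1 1
    rw [mul_one, map_one TensorAlgebra.algebraMapInv, one_smul] at h
    change f (TensorAlgebra.ιInv 1) = 0
    rw [left_eq_add.1 h, map_zero]
  · intro a b ha hb
    change TensorAlgebra.algebraMapInv (R := k) a = 0 at ha
    change TensorAlgebra.algebraMapInv (R := k) b = 0 at hb
    change f (TensorAlgebra.ιInv (a * b)) = 0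
    rw [ιInv_mul, ha, hb, zero_smul, zero_smul, add_zero, map_zero]

theorem onWords_infinitesimal_cons (f : PosTensor k V →ₗ[k] k) (x : V) (l : List V) :
    onWords (infinitesimal k V f) (x :: l) = f (toPosTensor (listWord k (x :: l))) := by
  rw [onWords, bar_listWord_cons]
  exact congrArg f (TensorAlgebra.ι_leftInverse _)

theorem onWords_infinitesimal (f : PosTensor k V →ₗ[k] k) (l : List V) :
    onWords (infinitesimal k V f) l = f (toPosTensor (listWord k l)) := by
  cases l with
  | nil => simp [(isInfinitesimal_infinitesimal f).1]
  | cons x l => exact onWords_infinitesimal_cons f x l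

theorem IsInfinitesimal.ext {α β : DoubleTensor k V →ₗ[k] k} (hα : IsInfinitesimal α)
    (hβ : IsInfinitesimal β) (h : onWords α = onWords β) : α = β := by
  refine LinearMap.ext_on_range (span_barProd k) fun L => ?_
  induction L using barProd_induction with
  | h0 => rw [barProd_nil, hα.1, hβ.1]
  | h1 L ih => rwa [UniversalProducts.barProd_cons, listWord_nil, bar_one, one_mul]
  | h2 x l L => rw [hα.barProd_cons, hβ.barProd_cons, h]

/-- The leading term of the half-shuffle product with a character, where all gaps are empty, is the
value of `f` at the word itself. After subtracting it, only values of `f` at shorter words are left.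
-/
theorem isLowering_leftLog (Ψ : DoubleTensor k V →ₐ[k] k)
    {P : (PosTensor k V →ₗ[k] k) →ₗ[k] (PosTensor k V →ₗ[k] k)}
    (hP : ∀ f x l, P f (toPosTensor (listWord k (x :: l))) =
      f (toPosTensor (listWord k (x :: l))) -
        leftShuffle (infinitesimal k V f) Ψ.toLinearMap (bar (listWord k (x :: l)))) :
    IsLowering (fun l : List V => toPosTensor (listWord k l)) List.length P := by
  intro f l hl
  cases l with
  | nil => simp
  | cons x l =>
    have h := leftShuffle_character (isInfinitesimal_infinitesimal f) Ψ x l 1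
    rw [gapSum_eq_of_left] at h
    · simp only [mul_one, map_one, onWords_nil, AlgHom.toLinearMap_apply, derivative,
        onWords_infinitesimal] at h
      rw [hP, h, sub_self]
    · simp
    · intro s hs
      rw [derivative, onWords_infinitesimal]
      exact hl _ (by simpa using hs)

theorem isLowering_rightLog (Ψ : DoubleTensor k V →ₐ[k] k)
    {P : (PosTensor k V →ₗ[k] k) →ₗ[k] (PosTensor k V →ₗ[k] k)}
    (hP : ∀ f x l, P f (toPosTensor (listWord k (x :: l))) =
      f (toPosTensor (listWord k (x :: l))) -
        rightShuffle Ψ.toLinearMap (infinitesimal k V f) (bar (listWord k (x :: l)))) :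
    IsLowering (fun l : List V => toPosTensor (listWord k l)) List.length P := by
  intro f l hl
  cases l with
  | nil => simp
  | cons x l =>
    have h := rightShuffle_character (isInfinitesimal_infinitesimal f) Ψ x l 1
    rw [cauchy_eq_of_left] at h
    · simp only [mul_one, map_one, onWords_nil, AlgHom.toLinearMap_apply, derivative,
        onWords_infinitesimal] at h
      rw [hP, h, sub_self]
    · intro s hs
      rw [derivative, onWords_infinitesimal]
      exact hl _ (by simpa using hs)

theorem exists_leftLog (Ψ : DoubleTensor k V →ₐ[k] k) :
    ∃ α : DoubleTensor k V →ₗ[k] k, IsInfinitesimal α ∧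
      IsLeftCumulant (onWords α) (onWords Ψ.toLinearMap) := by
  -- The equation Ψ = f ≺ Ψ on words is linear in `f`; it is rewritten as f = Ψ + P f with `P`
  -- lowering, so that its solution is a Neumann series.
  let P : (PosTensor k V →ₗ[k] k) →ₗ[k] (PosTensor k V →ₗ[k] k) :=
    { toFun := fun f =>
        f - leftShuffle (infinitesimal k V f) Ψ.toLinearMap ∘ₗ TensorAlgebra.ι k
      map_add' := fun f g => by
        simp only [leftShuffle, map_add, TensorProduct.map_add_left, LinearMap.add_comp,
          LinearMap.comp_add]
        abel
      map_smul' := fun c f => by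
        simp only [leftShuffle, map_smul, TensorProduct.map_smul_left, LinearMap.smul_comp,
          LinearMap.comp_smul, smul_sub, RingHom.id_apply] }
  have hP := isLowering_leftLog Ψ (P := P) fun f x l => by
    rw [bar_listWord_cons]; rfl
  obtain ⟨f, hf⟩ : ∃ f, f = Ψ.toLinearMap ∘ₗ TensorAlgebra.ι k + P f :=
    ⟨_, hP.neumann_eq (span_toPosTensor k) _⟩
  have hi := isInfinitesimal_infinitesimal f
  refine ⟨_, hi, by simp, by simp [hi.1], fun x => funext fun l => ?_⟩
  have h1 : Ψ.toLinearMap ∘ₗ TensorAlgebra.ι k =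
      leftShuffle (infinitesimal k V f) Ψ.toLinearMap ∘ₗ TensorAlgebra.ι k := by
    have h2 : P f = f - leftShuffle (infinitesimal k V f) Ψ.toLinearMap ∘ₗ TensorAlgebra.ι k := rfl
    rw [h2, add_sub, eq_sub_iff_add_eq] at hf
    rw [add_comm] at hf
    exact (add_right_cancel hf).symm
  have h3 := leftShuffle_character hi Ψ x l 1
  rw [map_one, mul_one, mul_one] at h3
  rw [← h3, bar_listWord_cons]
  refine Eq.trans ?_ (LinearMap.congr_fun h1 _)
  rw [derivative, onWords, bar_listWord_cons]
  rfl

theorem exists_rightLog (Ψ : DoubleTensor k V →ₐ[k] k) :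
    ∃ α : DoubleTensor k V →ₗ[k] k, IsInfinitesimal α ∧
      IsRightCumulant (onWords α) (onWords Ψ.toLinearMap) := by
  -- The same device for the right half-shuffle; here the leading term is the one whose first gap is
  -- the whole word.
  let P : (PosTensor k V →ₗ[k] k) →ₗ[k] (PosTensor k V →ₗ[k] k) :=
    { toFun := fun f =>
        f - rightShuffle Ψ.toLinearMap (infinitesimal k V f) ∘ₗ TensorAlgebra.ι k
      map_add' := fun f g => by
        simp only [rightShuffle, map_add, TensorProduct.map_add_right, LinearMap.add_comp,
          LinearMap.comp_add]
        abel
      map_smul' := fun c f => by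
        simp only [rightShuffle, map_smul, TensorProduct.map_smul_right, LinearMap.smul_comp,
          LinearMap.comp_smul, smul_sub, RingHom.id_apply] }
  have hP := isLowering_rightLog Ψ (P := P) fun f x l => by
    rw [bar_listWord_cons]; rfl
  obtain ⟨f, hf⟩ : ∃ f, f = Ψ.toLinearMap ∘ₗ TensorAlgebra.ι k + P f :=
    ⟨_, hP.neumann_eq (span_toPosTensor k) _⟩
  have hi := isInfinitesimal_infinitesimal f
  refine ⟨_, hi, by simp, by simp [hi.1], fun x => funext fun l => ?_⟩
  have h1 : Ψ.toLinearMap ∘ₗ TensorAlgebra.ι k =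
      rightShuffle Ψ.toLinearMap (infinitesimal k V f) ∘ₗ TensorAlgebra.ι k := by
    have h2 : P f = f - rightShuffle Ψ.toLinearMap (infinitesimal k V f) ∘ₗ TensorAlgebra.ι k := rfl
    rw [h2, add_sub, eq_sub_iff_add_eq] at hf
    rw [add_comm] at hf
    exact (add_right_cancel hf).symm
  have h3 := rightShuffle_character hi Ψ x l 1
  rw [map_one, mul_one, mul_one] at h3
  rw [← h3, bar_listWord_cons]
  refine Eq.trans ?_ (LinearMap.congr_fun h1 _)
  rw [derivative, onWords, bar_listWord_cons]
  rfl

/-! ### Additive convolutions as addition of cumulants -/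

/-- The left additive convolution of two characters exists, is unique and is a character. -/
theorem exists_leftAdditiveConvolution (Φ₁ Φ₂ : DoubleTensor k V →ₐ[k] k) :
    ∃ (Φ : DoubleTensor k V →ₐ[k] k) (κ₁ κ₂ : DoubleTensor k V →ₗ[k] k),
      (∀ Ψ, IsLeftAdditiveConvolution Φ₁ Φ₂ Ψ ↔ Ψ = Φ) ∧
      IsLeftCumulant (onWords κ₁) (onWords Φ₁.toLinearMap) ∧
      IsLeftCumulant (onWords κ₂) (onWords Φ₂.toLinearMap) ∧
      IsLeftCumulant (onWords κ₁ + onWords κ₂) (onWords Φ.toLinearMap) := by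
  obtain ⟨κ₁, h1, h1'⟩ := exists_leftLog Φ₁
  obtain ⟨κ₂, h2, h2'⟩ := exists_leftLog Φ₂
  obtain ⟨Φ, hΦ⟩ := exists_eq_leftExp (h1.add h2)
  refine ⟨Φ, κ₁, κ₂, fun Ψ => ⟨?_, ?_⟩, h1', h2', (eq_leftExp_iff (h1.add h2)).1 hΦ⟩
  -- Cumulants are determined by moments, and an infinitesimal character by its values on words, so
  -- there is no choice for `γ₁` and `γ₂`.
  · rintro ⟨γ₁, γ₂, g1, g2, e1, e2, rfl⟩
    rw [g1.ext h1 (((eq_leftExp_iff g1).1 e1).unique h1'),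
      g2.ext h2 (((eq_leftExp_iff g2).1 e2).unique h2'), hΦ]
  · rintro rfl
    exact ⟨κ₁, κ₂, h1, h2, (eq_leftExp_iff h1).2 h1', (eq_leftExp_iff h2).2 h2', hΦ⟩

/-- The right additive convolution of two characters exists, is unique and is a character. -/
theorem exists_rightAdditiveConvolution (Φ₁ Φ₂ : DoubleTensor k V →ₐ[k] k) :
    ∃ (Φ : DoubleTensor k V →ₐ[k] k) (β₁ β₂ : DoubleTensor k V →ₗ[k] k),
      (∀ Ψ, IsRightAdditiveConvolution Φ₁ Φ₂ Ψ ↔ Ψ = Φ) ∧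
      IsRightCumulant (onWords β₁) (onWords Φ₁.toLinearMap) ∧
      IsRightCumulant (onWords β₂) (onWords Φ₂.toLinearMap) ∧
      IsRightCumulant (onWords β₁ + onWords β₂) (onWords Φ.toLinearMap) := by
  obtain ⟨β₁, h1, h1'⟩ := exists_rightLog Φ₁
  obtain ⟨β₂, h2, h2'⟩ := exists_rightLog Φ₂
  obtain ⟨Φ, hΦ⟩ := exists_eq_rightExp (h1.add h2)
  refine ⟨Φ, β₁, β₂, fun Ψ => ⟨?_, ?_⟩, h1', h2', (eq_rightExp_iff (h1.add h2)).1 hΦ⟩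
  · rintro ⟨γ₁, γ₂, g1, g2, e1, e2, rfl⟩
    rw [g1.ext h1 (((eq_rightExp_iff g1).1 e1).unique h1'),
      g2.ext h2 (((eq_rightExp_iff g2).1 e2).unique h2'), hΦ]
  · rintro rfl
    exact ⟨β₁, β₂, h1, h2, (eq_rightExp_iff h1).2 h1', (eq_rightExp_iff h2).2 h2', hΦ⟩

theorem convolution_bar (Φ Ψ : DoubleTensor k V →ₐ[k] k) (l : List V) :
    convolution Φ Ψ (bar (listWord k l)) =
      gapSum (onWords Φ.toLinearMap) (onWords Ψ.toLinearMap) (onWords Ψ.toLinearMap) l := by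
  have := sum_splits_gapSum (onWords Φ.toLinearMap) (onWords Ψ.toLinearMap) [] l
  simp only [List.nil_append] at this
  rw [show onWords Ψ.toLinearMap = fun s => onWords Ψ.toLinearMap s from rfl, ← this]
  simp only [convolution, AlgHom.comp_apply, coproduct_bar, map_list_sum, List.map_map]
  congr 1
  refine List.map_congr_left fun p _ => ?_
  have h := map_barProd_mul Ψ p.2 1
  rw [mul_one, map_one, mul_one] at h
  simp [splitTensor, h, onWords]

end Exponential


/-! ### Alternating words in the free product -/

section FreeProductWords

variable {k : Type*} [Field k]
  {A₁ : Type*} [NonUnitalRing A₁] [Module k A₁] [IsScalarTower k A₁ A₁] [SMulCommClass k A₁ A₁]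
  {A₂ : Type*} [NonUnitalRing A₂] [Module k A₂] [IsScalarTower k A₂ A₂] [SMulCommClass k A₂ A₂]

theorem listProd_append_cons {A : Type*} [Semigroup A] (a : A) (l : List A) (b : A) (l' : List A) :
    listProd a (l ++ b :: l') = listProd a l * listProd b l' := by
  induction l generalizing a with
  | nil => rfl
  | cons c l ih => rw [List.cons_append, listProd, ih, listProd, mul_assoc]

theorem listProd_eq_zero {A : Type*} [NonUnitalRing A] (a : A) (l : List A) (h : 0 ∈ a :: l) :
    listProd a l = 0 := by
  induction l generalizing a with
  | nil => simpa [listProd, eq_comm] using h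
  | cons b l ih =>
    rw [listProd]
    rcases List.mem_cons.1 h with rfl | h
    · rw [zero_mul]
    · rw [ih b h, mul_zero]

theorem letter_inl_mul (a b : A₁) :
    letter k (Sum.inl a : A₁ ⊕ A₂) * letter k (Sum.inl b) = letter k (Sum.inl (a * b)) :=
  Subtype.ext ((map_mul (unitalMk k A₁ A₂) _ _).symm.trans
    (RingQuot.mkAlgHom_rel k (FreeProductRel.left a b)))

theorem letter_inr_mul (a b : A₂) :
    letter k (Sum.inr a : A₁ ⊕ A₂) * letter k (Sum.inr b) = letter k (Sum.inr (a * b)) :=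
  Subtype.ext ((map_mul (unitalMk k A₁ A₂) _ _).symm.trans
    (RingQuot.mkAlgHom_rel k (FreeProductRel.right a b)))

variable (k) in
theorem letter_inl_zero : letter k (Sum.inl 0 : A₁ ⊕ A₂) = 0 := map_zero (pairLetter k)

variable (k) in
theorem letter_inr_zero : letter k (Sum.inr 0 : A₁ ⊕ A₂) = 0 := map_zero (pairLetter k)

/-- `F` depends only on the products of adjacent letters of the same algebra. -/
def IsMergeInvariant (F : List (A₁ ⊕ A₂) → k) : Prop :=
  (∀ a b u v, F (u ++ Sum.inl a :: Sum.inl b :: v) = F (u ++ Sum.inl (a * b) :: v)) ∧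
    ∀ a b u v, F (u ++ Sum.inr a :: Sum.inr b :: v) = F (u ++ Sum.inr (a * b) :: v)

/-- Adjacent letters of the same algebra are multiplied until the word alternates. One reduction
serves both the product in the free product and every merge invariant function; the length bound is
for inductions on length. -/
theorem exists_alternating (x : A₁ ⊕ A₂) (l : List (A₁ ⊕ A₂)) :
    ∃ x' l', Alternating (x' :: l') ∧ l'.length ≤ l.length ∧ x'.isLeft = x.isLeft ∧
      listProd (letter k x) (l.map (letter k)) = listProd (letter k x') (l'.map (letter k)) ∧
      ∀ F : List (A₁ ⊕ A₂) → k, IsMergeInvariant F → ∀ u, F (u ++ x :: l) = F (u ++ x' :: l') := by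
  induction l generalizing x with
  | nil => exact ⟨x, [], by simp [Alternating], le_rfl, rfl, rfl, fun _ _ _ => rfl⟩
  | cons y l ih =>
    obtain ⟨y', l', h1, h2, h3, h4, h5⟩ := ih y
    have h6 : listProd (letter k x) ((y :: l).map (letter k)) =
        letter k x * listProd (letter k y') (l'.map (letter k)) := by
      rw [List.map_cons, listProd, h4]
    have h7 : ∀ F : List (A₁ ⊕ A₂) → k, IsMergeInvariant F → ∀ u,
        F (u ++ x :: y :: l) = F (u ++ x :: y' :: l') := by
      intro F hF u
      simpa using h5 F hF (u ++ [x])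
    by_cases hxy : x.isLeft = y'.isLeft
    · obtain ⟨z, hz, hz2, hz3⟩ : ∃ z : A₁ ⊕ A₂, z.isLeft = y'.isLeft ∧
          letter k x * letter k y' = letter k z ∧ ∀ F : List (A₁ ⊕ A₂) → k, IsMergeInvariant F →
            ∀ u v, F (u ++ x :: y' :: v) = F (u ++ z :: v) := by
        rcases x with a | a <;> rcases y' with b | b
        · exact ⟨Sum.inl (a * b), rfl, letter_inl_mul a b, fun F hF u v => hF.1 a b u v⟩
        · simp at hxy
        · simp at hxy
        · exact ⟨Sum.inr (a * b), rfl, letter_inr_mul a b, fun F hF u v => hF.2 a b u v⟩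
      refine ⟨z, l', ?_, h2.trans (Nat.le_succ _), hz.trans hxy.symm, ?_, fun F hF u => ?_⟩
      · cases l' with
        | nil => simp [Alternating]
        | cons w l' =>
          rw [Alternating, List.isChain_cons_cons] at h1 ⊢
          exact ⟨hz ▸ h1.1, h1.2⟩
      · rw [h6]
        cases l' with
        | nil => exact hz2
        | cons w l' => simp only [List.map_cons, listProd]; rw [← mul_assoc, hz2]
      · rw [h7 F hF, hz3 F hF]
    · refine ⟨x, y' :: l', List.isChain_cons_cons.2 ⟨hxy, h1⟩, Nat.succ_le_succ h2, rfl, ?_, h7⟩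
      rw [h6, List.map_cons, listProd]

/-- Every linear form on the free product is determined by its moments of alternating words. -/
theorem ext_of_moment {ψ ψ' : FreeProduct k A₁ A₂ →ₗ[k] k}
    (h : ∀ l : List (A₁ ⊕ A₂), l ≠ [] → Alternating l →
      moment ψ (l.map (letter k)) = moment ψ' (l.map (letter k))) : ψ = ψ' := by
  let W : Submodule k (FreeProduct k A₁ A₂) := LinearMap.eqLocus ψ ψ'
  have hW : ∀ x (l : List (A₁ ⊕ A₂)), listProd (letter k x) (l.map (letter k)) ∈ W := by
    intro x l
    obtain ⟨x', l', h1, -, -, h4, -⟩ := exists_alternating (k := k) x l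
    rw [h4]
    exact h (x' :: l') (by simp) h1
  let W' : Submodule k (FreeProduct k A₁ A₂) := Submodule.span k
    (Set.range fun p : (A₁ ⊕ A₂) × List (A₁ ⊕ A₂) => listProd (letter k p.1) (p.2.map (letter k)))
  have hpair : ∀ u : A₁ × A₂, pairLetter k u = letter k (Sum.inl u.1) + letter k (Sum.inr u.2) := by
    intro u
    simp only [letter, Sum.elim_inl, Sum.elim_inr, ← map_add]
    simp
  have hlet : ∀ x : A₁ ⊕ A₂, letter k x ∈ W' ∧ ∀ w ∈ W', letter k x * w ∈ W' := by
    intro x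
    refine ⟨Submodule.subset_span ⟨(x, []), rfl⟩, fun w hw => ?_⟩
    induction hw using Submodule.span_induction with
    | mem w hw =>
      obtain ⟨p, rfl⟩ := hw
      exact Submodule.subset_span ⟨(x, p.1 :: p.2), rfl⟩
    | zero => simp
    | add w w' _ _ hw hw' => rw [mul_add]; exact W'.add_mem hw hw'
    | smul c w _ hw => rw [mul_smul_comm]; exact W'.smul_mem c hw
  -- Closure under left multiplication is carried along, as membership in the span alone would not
  -- pass to products.
  have key : ∀ z (hz : z ∈ freeProductSubalgebra k A₁ A₂),
      (id ⟨z, hz⟩ : FreeProduct k A₁ A₂) ∈ W' ∧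
        ∀ w ∈ W', (id ⟨z, hz⟩ : FreeProduct k A₁ A₂) * w ∈ W' := by
    intro z hz
    induction hz using NonUnitalAlgebra.adjoin_induction with
    | mem z hz =>
      obtain ⟨u, rfl⟩ := hz
      change pairLetter k u ∈ W' ∧ ∀ w ∈ W', pairLetter k u * w ∈ W'
      rw [hpair]
      refine ⟨W'.add_mem (hlet _).1 (hlet _).1, fun w hw => ?_⟩
      rw [add_mul]
      exact W'.add_mem ((hlet _).2 w hw) ((hlet _).2 w hw)
    | add x y hx hy h1 h2 =>
      refine ⟨W'.add_mem h1.1 h2.1, fun w hw => ?_⟩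
      have := W'.add_mem (h1.2 w hw) (h2.2 w hw)
      rwa [← add_mul] at this
    | zero =>
      refine ⟨W'.zero_mem, fun w hw => ?_⟩
      change (0 : FreeProduct k A₁ A₂) * w ∈ W'
      rw [zero_mul]
      exact W'.zero_mem
    | mul x y hx hy h1 h2 =>
      refine ⟨h1.2 _ h2.1, fun w hw => ?_⟩
      have := h1.2 _ (h2.2 w hw)
      rwa [← mul_assoc] at this
    | smul r x hx h1 =>
      refine ⟨W'.smul_mem r h1.1, fun w hw => ?_⟩
      have := W'.smul_mem r (h1.2 w hw)
      rwa [← smul_mul_assoc] at this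
  have hle : W' ≤ W := Submodule.span_le.2 (by rintro _ ⟨p, rfl⟩; exact hW p.1 p.2)
  exact LinearMap.ext fun z => hle (key z.1 z.2).1

/-- The values of a linear form on words of letters. -/
def onLetters (f : DoubleTensor k (FreeProduct k A₁ A₂) →ₗ[k] k) (l : List (A₁ ⊕ A₂)) : k :=
  onWords f (l.map (letter k))

theorem moment_restriction (Φ : DoubleTensor k (FreeProduct k A₁ A₂) →ₐ[k] k)
    (l : List (A₁ ⊕ A₂)) (hne : l ≠ []) (hl : Alternating l) :
    moment (restriction Φ) (l.map (letter k)) = onLetters Φ.toLinearMap l := by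
  cases l with
  | nil => exact absurd rfl hne
  | cons x l =>
    rw [List.map_cons, moment, restriction, LinearMap.comp_apply, LinearMap.comp_apply,
      alternatingWord_listProd k x l hl, onLetters, onWords, listWord, List.map_map]
    rfl

/-- The embedding into words is explicit only on alternating words. Merge invariance extends the
formula to all words, in particular to the subwords in the free product formula, which need not
alternate. -/
theorem moment_restriction_of_merge (Φ : DoubleTensor k (FreeProduct k A₁ A₂) →ₐ[k] k)
    (hΦ : IsMergeInvariant (onLetters Φ.toLinearMap)) (l : List (A₁ ⊕ A₂)) :
    moment (restriction Φ) (l.map (letter k)) = onLetters Φ.toLinearMap l := by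
  cases l with
  | nil => simp [moment, onLetters]
  | cons x l =>
    obtain ⟨x', l', h1, -, -, h4, h5⟩ := exists_alternating (k := k) x l
    have := moment_restriction Φ (x' :: l') (by simp) h1
    rw [List.map_cons, moment] at this ⊢
    rw [h4, this]
    exact (h5 _ hΦ []).symm

/-! ### The characters of the two linear forms -/

theorem lift_inr_listWord {A : Type*} [NonUnitalRing A] [Module k A] [IsScalarTower k A A]
    [SMulCommClass k A A] (x : A) (l : List A) :
    TensorAlgebra.lift k (Unitization.inrHom k k A) (listWord k (x :: l)) =
      Unitization.inr (listProd x l) := by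
  induction l generalizing x with
  | nil => simp [listProd]
  | cons y l ih =>
    rw [listWord_cons, map_mul, ih, listProd, Unitization.inr_mul]
    simp

theorem onWords_character {A : Type*} [NonUnitalRing A] [Module k A] [IsScalarTower k A A]
    [SMulCommClass k A A] (φ : A →ₗ[k] k) (l : List A) :
    onWords (character φ).toLinearMap l = moment φ l := by
  cases l with
  | nil => simp [moment]
  | cons x l =>
    rw [onWords, bar_listWord_cons, AlgHom.toLinearMap_apply, character,
      TensorAlgebra.lift_ι_apply, LinearMap.comp_apply, multiplication, LinearMap.comp_apply,
      LinearMap.comp_apply, Submodule.subtype_apply, coe_toPosTensor_listWord_cons,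
      AlgHom.toLinearMap_apply, lift_inr_listWord]
    rfl

/-- The projection of letters to `A₁`. -/
def letterLeft : A₁ ⊕ A₂ → A₁ := Sum.elim id 0

/-- The projection of letters to `A₂`. -/
def letterRight : A₁ ⊕ A₂ → A₂ := Sum.elim 0 id

theorem projLeft_listProd (x : A₁ ⊕ A₂) (l : List (A₁ ⊕ A₂)) :
    projLeft k A₁ A₂ (listProd (letter k x) (l.map (letter k))) =
      listProd (letterLeft x) (l.map letterLeft) := by
  have h : ∀ x : A₁ ⊕ A₂, unitalFreeProductLift (Unitization.inrNonUnitalAlgHom k A₁)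
      (0 : A₂ →ₙₐ[k] Unitization k A₁) (inclusion k A₁ A₂ (letter k x)) =
        Unitization.inr (letterLeft x) := by
    intro x
    rcases x with a | b
    · refine (unitalLift_mk _ _ _).trans ?_
      simp [letterLeft]
    · refine (unitalLift_mk _ _ _).trans ?_
      simp [letterLeft]
  have h2 : unitalFreeProductLift (Unitization.inrNonUnitalAlgHom k A₁)
      (0 : A₂ →ₙₐ[k] Unitization k A₁)
        (inclusion k A₁ A₂ (listProd (letter k x) (l.map (letter k)))) =
        Unitization.inr (listProd (letterLeft x) (l.map letterLeft)) := by
    induction l generalizing x with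
    | nil => exact h x
    | cons y l ih =>
      rw [List.map_cons, listProd, map_mul, map_mul, h, ih, List.map_cons, listProd,
        Unitization.inr_mul]
  exact congrArg (Unitization.sndHom k k _) h2

theorem projRight_listProd (x : A₁ ⊕ A₂) (l : List (A₁ ⊕ A₂)) :
    projRight k A₁ A₂ (listProd (letter k x) (l.map (letter k))) =
      listProd (letterRight x) (l.map letterRight) := by
  have h : ∀ x : A₁ ⊕ A₂, unitalFreeProductLift (0 : A₁ →ₙₐ[k] Unitization k A₂)
      (Unitization.inrNonUnitalAlgHom k A₂) (inclusion k A₁ A₂ (letter k x)) =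
        Unitization.inr (letterRight x) := by
    intro x
    rcases x with a | b
    · refine (unitalLift_mk _ _ _).trans ?_
      simp [letterRight]
    · refine (unitalLift_mk _ _ _).trans ?_
      simp [letterRight]
  have h2 : unitalFreeProductLift (0 : A₁ →ₙₐ[k] Unitization k A₂)
      (Unitization.inrNonUnitalAlgHom k A₂)
        (inclusion k A₁ A₂ (listProd (letter k x) (l.map (letter k)))) =
        Unitization.inr (listProd (letterRight x) (l.map letterRight)) := by
    induction l generalizing x with
    | nil => exact h x
    | cons y l ih =>
      rw [List.map_cons, listProd, map_mul, map_mul, h, ih, List.map_cons, listProd,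
        Unitization.inr_mul]
  exact congrArg (Unitization.sndHom k k _) h2

theorem onLetters_character_left (φ₁ : A₁ →ₗ[k] k) (l : List (A₁ ⊕ A₂)) :
    onLetters (character (φ₁ ∘ₗ projLeft k A₁ A₂)).toLinearMap l =
      moment φ₁ (l.map letterLeft) := by
  rw [onLetters, onWords_character]
  cases l with
  | nil => rfl
  | cons x l =>
    rw [List.map_cons, List.map_cons, moment, moment, LinearMap.comp_apply, projLeft_listProd]

theorem onLetters_character_right (φ₂ : A₂ →ₗ[k] k) (l : List (A₁ ⊕ A₂)) :
    onLetters (character (φ₂ ∘ₗ projRight k A₁ A₂)).toLinearMap l =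
      moment φ₂ (l.map letterRight) := by
  rw [onLetters, onWords_character]
  cases l with
  | nil => rfl
  | cons x l =>
    rw [List.map_cons, List.map_cons, moment, moment, LinearMap.comp_apply, projRight_listProd]

theorem moment_eq_zero {A : Type*} [NonUnitalRing A] [Module k A] (φ : A →ₗ[k] k) (l : List A)
    (h : 0 ∈ l) : moment φ l = 0 := by
  cases l with
  | nil => simp at h
  | cons x l => rw [moment, listProd_eq_zero x l h, map_zero]

theorem moment_merge {A : Type*} [NonUnitalRing A] [Module k A] (φ : A →ₗ[k] k) (a b : A)
    (u v : List A) : moment φ (u ++ a :: b :: v) = moment φ (u ++ (a * b) :: v) := by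
  have h : listProd a (b :: v) = listProd (a * b) v := by
    cases v with
    | nil => rfl
    | cons c v => simp only [listProd, mul_assoc]
  cases u with
  | nil => exact congrArg φ h
  | cons x u =>
    rw [List.cons_append, List.cons_append, moment, moment, listProd_append_cons,
      listProd_append_cons, h]

theorem isColored_left (φ₁ : A₁ →ₗ[k] k) :
    IsColored Sum.isLeft true (fun l : List (A₁ ⊕ A₂) => moment φ₁ (l.map letterLeft)) := by
  intro l x hx hc
  refine moment_eq_zero _ _ (List.mem_map.2 ⟨x, hx, ?_⟩)
  rcases x with a | b
  · simp at hc
  · rfl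

theorem isColored_right (φ₂ : A₂ →ₗ[k] k) :
    IsColored Sum.isLeft false (fun l : List (A₁ ⊕ A₂) => moment φ₂ (l.map letterRight)) := by
  intro l x hx hc
  refine moment_eq_zero _ _ (List.mem_map.2 ⟨x, hx, ?_⟩)
  rcases x with a | b
  · rfl
  · simp at hc

theorem onLetters_eq_zero (f : DoubleTensor k (FreeProduct k A₁ A₂) →ₗ[k] k)
    (l : List (A₁ ⊕ A₂)) (h : 0 ∈ l.map (letter k)) : onLetters f l = 0 := by
  rw [onLetters, onWords, listWord, List.prod_eq_zero, map_zero, map_zero]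
  exact List.mem_map.2 ⟨0, h, map_zero _⟩

/-- A family of values on words of letters that does not change if the letters from `A₂` are
replaced by `0` vanishes on the words with a letter from `A₂`. -/
theorem isColored_of_map_left (f : DoubleTensor k (FreeProduct k A₁ A₂) →ₗ[k] k)
    (h : ∀ l : List (A₁ ⊕ A₂), onLetters f (l.map fun x => Sum.inl (letterLeft x)) =
      onLetters f l) : IsColored Sum.isLeft true (onLetters f) := by
  intro l x hx hc
  rw [← h]
  refine onLetters_eq_zero f _ ?_
  rw [List.map_map]
  refine List.mem_map.2 ⟨x, hx, ?_⟩
  rcases x with a | b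
  · simp at hc
  · exact letter_inl_zero k

theorem isColored_of_map_right (f : DoubleTensor k (FreeProduct k A₁ A₂) →ₗ[k] k)
    (h : ∀ l : List (A₁ ⊕ A₂), onLetters f (l.map fun x => Sum.inr (letterRight x)) =
      onLetters f l) : IsColored Sum.isLeft false (onLetters f) := by
  intro l x hx hc
  rw [← h]
  refine onLetters_eq_zero f _ ?_
  rw [List.map_map]
  refine List.mem_map.2 ⟨x, hx, ?_⟩
  rcases x with a | b
  · exact letter_inr_zero k
  · simp at hc

/-- A word with letters of both colours has, for each of the two families, a letter of the wrong
colour. -/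
theorem mixed_eq_zero {X : Type*} {color : X → Bool} {κ₁ κ₂ : List X → k}
    (h1 : IsColored color true κ₁) (h2 : IsColored color false κ₂) (x : X) (s : List X) (y : X)
    (hy : y ∈ s) (hxy : color y ≠ color x) : (κ₁ + κ₂) (x :: s) = 0 := by
  have key : ∀ i (κ : List X → k), IsColored color i κ → κ (x :: s) = 0 := by
    intro i κ hκ
    by_cases hx : color x = i
    · exact hκ _ y (List.mem_cons_of_mem _ hy) fun h => hxy (h.trans hx.symm)
    · exact hκ _ x (by simp) hx
  rw [Pi.add_apply, key _ _ h1, key _ _ h2, add_zero]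

/-! ### The four products -/

theorem isMonotoneProduct_restriction (φ₁ : A₁ →ₗ[k] k) (φ₂ : A₂ →ₗ[k] k) :
    IsMonotoneProduct φ₁ φ₂ (restriction (convolution (character (φ₁ ∘ₗ projLeft k A₁ A₂))
      (character (φ₂ ∘ₗ projRight k A₁ A₂)))) := by
  intro l hne hl
  rw [moment_restriction _ l hne hl, onLetters, onWords, AlgHom.toLinearMap_apply,
    convolution_bar, gapSum_map]
  change gapSum (onLetters (character (φ₁ ∘ₗ projLeft k A₁ A₂)).toLinearMap)
    (onLetters (character (φ₂ ∘ₗ projRight k A₁ A₂)).toLinearMap)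
    (onLetters (character (φ₂ ∘ₗ projRight k A₁ A₂)).toLinearMap) l = _
  rw [funext (onLetters_character_left φ₁), funext (onLetters_character_right φ₂),
    gapSum_alternating (isColored_left φ₁) (isColored_right φ₂) rfl l hl]
  congr 2
  · clear hne hl
    induction l with
    | nil => rfl
    | cons x l ih => rcases x with a | b <;> simp_all [List.filter_cons, List.filterMap_cons, letterLeft]
  · clear hne hl
    induction l with
    | nil => rfl
    | cons x l ih => rcases x with a | b <;> simp_all [List.filter_cons, List.filterMap_cons, letterRight, moment, listProd]

theorem isAntimonotoneProduct_restriction (φ₁ : A₁ →ₗ[k] k) (φ₂ : A₂ →ₗ[k] k) :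
    IsAntimonotoneProduct φ₁ φ₂ (restriction (convolution (character (φ₂ ∘ₗ projRight k A₁ A₂))
      (character (φ₁ ∘ₗ projLeft k A₁ A₂)))) := by
  intro l hne hl
  rw [moment_restriction _ l hne hl, onLetters, onWords, AlgHom.toLinearMap_apply,
    convolution_bar, gapSum_map]
  change gapSum (onLetters (character (φ₂ ∘ₗ projRight k A₁ A₂)).toLinearMap)
    (onLetters (character (φ₁ ∘ₗ projLeft k A₁ A₂)).toLinearMap)
    (onLetters (character (φ₁ ∘ₗ projLeft k A₁ A₂)).toLinearMap) l = _
  rw [funext (onLetters_character_left φ₁), funext (onLetters_character_right φ₂),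
    gapSum_alternating (isColored_right φ₂) (isColored_left φ₁) rfl l hl]
  congr 2
  · clear hne hl
    induction l with
    | nil => rfl
    | cons x l ih => rcases x with a | b <;> simp_all [List.filter_cons, List.filterMap_cons, letterRight]
  · clear hne hl
    induction l with
    | nil => rfl
    | cons x l ih => rcases x with a | b <;> simp_all [List.filter_cons, List.filterMap_cons, letterLeft, moment, listProd]

theorem exists_booleanProduct (φ₁ : A₁ →ₗ[k] k) (φ₂ : A₂ →ₗ[k] k)
    {Φ₁ Φ₂ : DoubleTensor k (FreeProduct k A₁ A₂) →ₐ[k] k}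
    (hΦ₁ : Φ₁ = character (φ₁ ∘ₗ projLeft k A₁ A₂))
    (hΦ₂ : Φ₂ = character (φ₂ ∘ₗ projRight k A₁ A₂)) :
    ∃ Φ : DoubleTensor k (FreeProduct k A₁ A₂) →ₐ[k] k,
      (∀ Ψ, IsRightAdditiveConvolution Φ₁ Φ₂ Ψ ↔ Ψ = Φ) ∧
      IsBooleanProduct φ₁ φ₂ (restriction Φ) := by
  obtain ⟨Φ, β₁, β₂, h, h1, h2, h3⟩ := exists_rightAdditiveConvolution Φ₁ Φ₂
  refine ⟨Φ, h, fun l hne hl => ?_⟩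
  have g1 : IsRightCumulant (onLetters (A₁ := A₁) (A₂ := A₂) β₁) (onLetters Φ₁.toLinearMap) :=
    h1.comp_map (letter k)
  have g2 : IsRightCumulant (onLetters (A₁ := A₁) (A₂ := A₂) β₂) (onLetters Φ₂.toLinearMap) :=
    h2.comp_map (letter k)
  have g3 : IsRightCumulant (onLetters (A₁ := A₁) (A₂ := A₂) β₁ + onLetters β₂)
    (onLetters Φ.toLinearMap) := h3.comp_map (letter k)
  have e1 : onLetters Φ₁.toLinearMap = fun l : List (A₁ ⊕ A₂) => moment φ₁ (l.map letterLeft) := by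
    rw [hΦ₁]; exact funext (onLetters_character_left φ₁)
  have e2 : onLetters Φ₂.toLinearMap = fun l : List (A₁ ⊕ A₂) => moment φ₂ (l.map letterRight) := by
    rw [hΦ₂]; exact funext (onLetters_character_right φ₂)
  -- The moments of `Φ₁` are unchanged when letters from `A₂` are replaced by 0, so by uniqueness
  -- the cumulants are unchanged too; and they vanish on words with a zero letter because they come
  -- from a linear form on the tensor algebra.
  have c1 : IsColored Sum.isLeft true (onLetters (A₁ := A₁) (A₂ := A₂) β₁) := by
    refine isColored_of_map_left _ (congrFun (IsRightCumulant.unique (F := onLetters Φ₁.toLinearMap)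
      ?_ g1))
    have := g1.comp_map fun x : A₁ ⊕ A₂ => (Sum.inl (letterLeft x) : A₁ ⊕ A₂)
    rw [e1] at this ⊢
    simpa [Function.comp_def, letterLeft] using this
  have c2 : IsColored Sum.isLeft false (onLetters (A₁ := A₁) (A₂ := A₂) β₂) := by
    refine isColored_of_map_right _ (congrFun (IsRightCumulant.unique (F := onLetters Φ₂.toLinearMap)
      ?_ g2))
    have := g2.comp_map fun x : A₁ ⊕ A₂ => (Sum.inr (letterRight x) : A₁ ⊕ A₂)
    rw [e2] at this ⊢
    simpa [Function.comp_def, letterRight] using this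
  rw [moment_restriction Φ l hne hl, g3.apply_alternating (mixed_eq_zero c1 c2) l hl]
  congr 1
  refine List.map_congr_left fun x _ => ?_
  rw [g3.apply_singleton, Pi.add_apply, ← g1.apply_singleton, ← g2.apply_singleton, e1, e2]
  rcases x with a | b <;> simp [letterLeft, letterRight, moment, listProd]

theorem isFreeProduct_of_subwordSum (φ₁ : A₁ →ₗ[k] k) (φ₂ : A₂ →ₗ[k] k)
    (Φ : DoubleTensor k (FreeProduct k A₁ A₂) →ₐ[k] k)
    (hm : IsMergeInvariant (onLetters Φ.toLinearMap))
    (h : ∀ l : List (A₁ ⊕ A₂), l ≠ [] → Alternating l →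
      subwordSum (fun x => -Sum.elim φ₁ φ₂ x) (onLetters Φ.toLinearMap) l = 0) :
    IsFreeProduct φ₁ φ₂ (restriction Φ) := by
  intro l hne hl
  have h0 := h l hne hl
  rw [subwordSum_eq_sum] at h0
  have h1 : ∀ S : Finset (Fin l.length), ((increasing S).map fun i => letter k (l.get i)) =
      ((increasing S).map l.get).map (letter k) := fun S => by rw [List.map_map]; rfl
  simp only [h1, moment_restriction_of_merge Φ hm]
  -- The term of the full set is F(l); moving all other terms to the other side gives the additional
  -- sign in the exponent.
  have h2 : (Finset.univ : Finset (Finset (Fin l.length))) =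
      insert Finset.univ (Finset.univ : Finset (Fin l.length)).ssubsets := by
    ext S
    simp only [Finset.mem_univ, Finset.mem_insert, Finset.mem_ssubsets, true_iff]
    exact (Finset.subset_univ S).eq_or_ssubset
  rw [h2, Finset.sum_insert (by simp)] at h0
  have h3 : (increasing (Finset.univ : Finset (Fin l.length))).map l.get = l := by
    simp [increasing]
  rw [h3, Finset.compl_univ, Finset.prod_empty, mul_one] at h0
  rw [eq_neg_of_add_eq_zero_left h0, ← Finset.sum_neg_distrib]
  refine Finset.sum_congr rfl fun S _ => ?_
  rw [Finset.prod_neg, Finset.card_compl, Fintype.card_fin, pow_succ]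
  ring

theorem exists_freeProduct (φ₁ : A₁ →ₗ[k] k) (φ₂ : A₂ →ₗ[k] k)
    {Φ₁ Φ₂ : DoubleTensor k (FreeProduct k A₁ A₂) →ₐ[k] k}
    (hΦ₁ : Φ₁ = character (φ₁ ∘ₗ projLeft k A₁ A₂))
    (hΦ₂ : Φ₂ = character (φ₂ ∘ₗ projRight k A₁ A₂)) :
    ∃ Φ : DoubleTensor k (FreeProduct k A₁ A₂) →ₐ[k] k,
      (∀ Ψ, IsLeftAdditiveConvolution Φ₁ Φ₂ Ψ ↔ Ψ = Φ) ∧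
      IsFreeProduct φ₁ φ₂ (restriction Φ) := by
  obtain ⟨Φ, κ₁, κ₂, h, h1, h2, h3⟩ := exists_leftAdditiveConvolution Φ₁ Φ₂
  refine ⟨Φ, h, ?_⟩
  have g1 : IsLeftCumulant (onLetters (A₁ := A₁) (A₂ := A₂) κ₁) (onLetters Φ₁.toLinearMap) :=
    h1.comp_map (letter k)
  have g2 : IsLeftCumulant (onLetters (A₁ := A₁) (A₂ := A₂) κ₂) (onLetters Φ₂.toLinearMap) :=
    h2.comp_map (letter k)
  have g3 : IsLeftCumulant (onLetters (A₁ := A₁) (A₂ := A₂) κ₁ + onLetters κ₂)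
    (onLetters Φ.toLinearMap) := h3.comp_map (letter k)
  have e1 : onLetters Φ₁.toLinearMap = fun l : List (A₁ ⊕ A₂) => moment φ₁ (l.map letterLeft) := by
    rw [hΦ₁]; exact funext (onLetters_character_left φ₁)
  have e2 : onLetters Φ₂.toLinearMap = fun l : List (A₁ ⊕ A₂) => moment φ₂ (l.map letterRight) := by
    rw [hΦ₂]; exact funext (onLetters_character_right φ₂)
  have c1 : IsColored Sum.isLeft true (onLetters (A₁ := A₁) (A₂ := A₂) κ₁) := by
    refine isColored_of_map_left _ (congrFun (IsLeftCumulant.unique (F := onLetters Φ₁.toLinearMap)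
      ?_ g1))
    have := g1.comp_map fun x : A₁ ⊕ A₂ => (Sum.inl (letterLeft x) : A₁ ⊕ A₂)
    rw [e1] at this ⊢
    simpa [Function.comp_def, letterLeft] using this
  have c2 : IsColored Sum.isLeft false (onLetters (A₁ := A₁) (A₂ := A₂) κ₂) := by
    refine isColored_of_map_right _ (congrFun (IsLeftCumulant.unique (F := onLetters Φ₂.toLinearMap)
      ?_ g2))
    have := g2.comp_map fun x : A₁ ⊕ A₂ => (Sum.inr (letterRight x) : A₁ ⊕ A₂)
    rw [e2] at this ⊢
    simpa [Function.comp_def, letterRight] using this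
  -- Each Φᵢ depends only on products in its algebra; adding the cumulants of the other colour
  -- preserves this.
  have hmerge : IsMergeInvariant (onLetters (A₁ := A₁) (A₂ := A₂) Φ.toLinearMap) := by
    constructor
    · intro a b
      refine g1.merge_add (i := true) g3 c2 rfl rfl rfl ?_
      intro u v
      simp only [e1, List.map_append, List.map_cons]
      exact moment_merge φ₁ a b _ _
    · intro a b
      rw [add_comm] at g3
      refine g2.merge_add (i := false) g3 c1 rfl rfl rfl ?_
      intro u v
      simp only [e2, List.map_append, List.map_cons]
      exact moment_merge φ₂ a b _ _
  refine isFreeProduct_of_subwordSum φ₁ φ₂ Φ hmerge fun l hne hl => ?_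
  rw [← g3.subwordSum_eq_zero (mixed_eq_zero c1 c2) l hl hne]
  congr 1
  funext x
  rw [g3.apply_singleton, Pi.add_apply, ← g1.apply_singleton, ← g2.apply_singleton, e1, e2]
  rcases x with a | b <;> simp [letterLeft, letterRight, moment, listProd]

/-- The right side of the free product formula involves only proper subwords. As these need not
alternate, the induction on length runs over all words, each being first reduced to an alternating
word that is not longer. -/
theorem IsFreeProduct.unique {φ₁ : A₁ →ₗ[k] k} {φ₂ : A₂ →ₗ[k] k}
    {ψ ψ' : FreeProduct k A₁ A₂ →ₗ[k] k} (h : IsFreeProduct φ₁ φ₂ ψ)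
    (h' : IsFreeProduct φ₁ φ₂ ψ') : ψ = ψ' := by
  suffices H : ∀ n, ∀ l : List (A₁ ⊕ A₂), l.length = n →
      moment ψ (l.map (letter k)) = moment ψ' (l.map (letter k)) from
    ext_of_moment fun l _ _ => H _ l rfl
  intro n
  induction n using Nat.strong_induction_on with
  | _ n ih =>
    rintro l rfl
    have key : ∀ l' : List (A₁ ⊕ A₂), l'.length ≤ l.length → l' ≠ [] → Alternating l' →
        moment ψ (l'.map (letter k)) = moment ψ' (l'.map (letter k)) := by
      intro l' hl' hne hal
      rw [h l' hne hal, h' l' hne hal]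
      refine Finset.sum_congr rfl fun S hS => ?_
      have e : ((increasing S).map fun i => letter k (l'.get i)) =
        ((increasing S).map l'.get).map (letter k) := by rw [List.map_map]; rfl
      -- A proper subset omits some index, so filtering by it strictly shortens the list of indices.
      have hlen : ((increasing S).map l'.get).length < l.length := by
        have hS' : S ⊂ Finset.univ := by simpa using hS
        obtain ⟨i, -, hi⟩ := Finset.exists_of_ssubset hS'
        rw [List.length_map, increasing]
        refine (lt_of_le_of_ne (List.length_filter_le _ _) fun h => hi ?_).trans_le
          (List.length_finRange.trans_le hl')
        simpa using List.length_filter_eq_length_iff.1 h i (List.mem_finRange i)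
      rw [e, ih _ hlen _ rfl]
    cases l with
    | nil => rfl
    | cons x l =>
      obtain ⟨x', l', h1, h2, -, h4, -⟩ := exists_alternating (k := k) x l
      have := key (x' :: l') (Nat.succ_le_succ h2) (by simp) h1
      simp only [List.map_cons, moment] at this ⊢
      rw [h4, this]

end FreeProductWords

end UniversalProducts

end

/-! ### The theorem -/

theorem mainTheorem4 {k : Type*} [Field k] [CharZero k]
    {A₁ : Type*} [NonUnitalRing A₁] [Module k A₁] [IsScalarTower k A₁ A₁] [SMulCommClass k A₁ A₁]
    {A₂ : Type*} [NonUnitalRing A₂] [Module k A₂] [IsScalarTower k A₂ A₂] [SMulCommClass k A₂ A₂]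
    (φ₁ : A₁ →ₗ[k] k) (φ₂ : A₂ →ₗ[k] k)
    (Φ₁ Φ₂ : DoubleTensor k (FreeProduct k A₁ A₂) →ₐ[k] k)
    (hΦ₁ : Φ₁ = character (φ₁ ∘ₗ projLeft k A₁ A₂))
    (hΦ₂ : Φ₂ = character (φ₂ ∘ₗ projRight k A₁ A₂)) :
    (∀ ψ : FreeProduct k A₁ A₂ →ₗ[k] k,
      IsMonotoneProduct φ₁ φ₂ ψ ↔ ψ = restriction (convolution Φ₁ Φ₂)) ∧
    (∀ ψ : FreeProduct k A₁ A₂ →ₗ[k] k,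
      IsAntimonotoneProduct φ₁ φ₂ ψ ↔ ψ = restriction (convolution Φ₂ Φ₁)) ∧
    (∃ Φ : DoubleTensor k (FreeProduct k A₁ A₂) →ₐ[k] k,
      (∀ Ψ, IsLeftAdditiveConvolution Φ₁ Φ₂ Ψ ↔ Ψ = Φ) ∧
      ∀ ψ : FreeProduct k A₁ A₂ →ₗ[k] k, IsFreeProduct φ₁ φ₂ ψ ↔ ψ = restriction Φ) ∧
    (∃ Φ : DoubleTensor k (FreeProduct k A₁ A₂) →ₐ[k] k,
      (∀ Ψ, IsRightAdditiveConvolution Φ₁ Φ₂ Ψ ↔ Ψ = Φ) ∧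
      ∀ ψ : FreeProduct k A₁ A₂ →ₗ[k] k, IsBooleanProduct φ₁ φ₂ ψ ↔ ψ = restriction Φ) := by
  have iff_of : ∀ {p : (FreeProduct k A₁ A₂ →ₗ[k] k) → Prop} {χ : FreeProduct k A₁ A₂ →ₗ[k] k},
      p χ → (∀ ψ, p ψ → ψ = χ) → ∀ ψ, p ψ ↔ ψ = χ :=
    fun hχ h ψ => ⟨h ψ, by rintro rfl; exact hχ⟩
  have h1 := isMonotoneProduct_restriction φ₁ φ₂
  have h2 := isAntimonotoneProduct_restriction φ₁ φ₂
  rw [← hΦ₁, ← hΦ₂] at h1 h2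
  obtain ⟨Φ, hΦ, h3⟩ := exists_freeProduct φ₁ φ₂ hΦ₁ hΦ₂
  obtain ⟨Φ', hΦ', h4⟩ := exists_booleanProduct φ₁ φ₂ hΦ₁ hΦ₂
  -- Three of the formulas give the moments of alternating words explicitly, so `ext_of_moment`
  -- suffices for uniqueness; the free one is recursive and uses `IsFreeProduct.unique`.
  exact ⟨iff_of h1 fun ψ h => ext_of_moment fun l hne hl => (h l hne hl).trans (h1 l hne hl).symm,
    iff_of h2 fun ψ h => ext_of_moment fun l hne hl => (h l hne hl).trans (h2 l hne hl).symm,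
    ⟨Φ, hΦ, iff_of h3 fun ψ h => h.unique h3⟩,
    ⟨Φ', hΦ', iff_of h4 fun ψ h => ext_of_moment fun l hne hl =>
      (h l hne hl).trans (h4 l hne hl).symm⟩⟩
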